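/- Let $d\in\{1,2,3\}$, let $\mathbb T^d=[-\pi,\pi]^d$ be the flat torus with periodic boundary conditions, put $\widehat u(k)=(2\pi)^{-d}\int_{\mathbb T^d}u(x)e^{-ik\cdot x}\,dx$ for $k\in\mathbb Z^d$, and let $|k|$ be the Euclidean length of $k$. For $s\ge 0$ let $$\mathcal A_s=\Big\{u\in L^1(\mathbb T^d):\ |u|_s:=\sum_{k\in\mathbb Z^d}|k|^s|\widehat u(k)|<\infty\Big\}.$$ All functions $u$, $u_0$, $\phi$ below are real-valued. $L^p(0,T;X)$ denotes the Bochner space. Consider the multi-dimensional DLSS equation for $u=w-1$, $$\partial_t u+\sum_{i,j=1}^d\partial_i\partial_j\big((u+1)\,\partial_i\partial_j\log(u+1)\big)=0,\qquad u(0,\cdot)=u_0. \tag{1}$$ A function $u\in L^\infty(0,T;L^\infty)\cap L^2(0,T;H^1)\cap L^1(0,T;W^{2,1})$ with $u+1>0$ almost everywhere is a strong solution of (1) on $(0,T)$ if, with $\partial_i\partial_j\log(u+1)$ understood as weak derivatives, the functions $(u+1)\,\partial_i\partial_j\log(u+1)$ are integrable on $(0,T)\times\mathbb T^d$ and $$-\int_0^T\!\!\int_{\mathbb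 T^d}\partial_t\phi\,u\,dx\,dt-\int_{\mathbb T^d}\phi(0,x)u_0(x)\,dx+\sum_{i,j=1}^d\int_0^T\!\!\int_{\mathbb T^d}(u+1)\,\partial_i\partial_j\log(u+1)\;\partial_i\partial_j\phi\,dx\,dt=0$$ for all $\phi\in C^\infty([0,\infty)\times\mathbb T^d)$ with $\phi(T,\cdot)=0$. Let $$P_1(z)=\frac{4z}{1-z}+\frac{5z^2}{(1-z)^2}+\frac{4z^3}{(1-z)^3}.$$ **Theorem.** Let $u_0\in\mathcal A_0$ have zero mean and satisfy $|u_0|_0<1$ and $d^2P_1(|u_0|_0)<1$. Then there is a function $u$ on $[0,\infty)\times\mathbb T^d$ such that: 1. for every $T>0$, $u$ is a strong solution of (1) on $(0,T)$, and $$u\in L^\infty(0,T;L^\infty)\cap L^p(0,T;\mathcal A_{4/p})\qquad\text{for all }1<p<\infty;$$ 2. for all $t\ge 0$, $$\|u(t)\|_{L^\infty}\le |u_0|_0\,e^{-(1-d^2P_1(|u_0|_0))\,t};$$ 3. for every $\sigma>0$ with $1-\sigma-d^2P_1(|u_0|_0)>0$ and every $T>0$, $$\big(e^{\sigma t|k|}\,\widehat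 u(t,k)\big)_{k\in\mathbb Z^d}\in L^\infty(0,T;\ell^1).$$ -/

import Mathlib

open MeasureTheory Set
open scoped ENNReal ContDiff

namespace DLSS

noncomputable section

/-- The period cell `[-π, π]^d` of the flat torus. Functions on the torus are represented by
functions on `ℝ^d` that are `2π`-periodic in every variable (see `IsPeriodic`). -/
def cell (d : ℕ) : Set (Fin d → ℝ) := Set.Icc (fun _ => -Real.pi) (fun _ => Real.pi)

/-- Lebesgue measure on the torus. -/
def torusMeasure (d : ℕ) : Measure (Fin d → ℝ) := volume.restrict (cell d)

/-- Lebesgue measure on the time interval `(0, T)`. -/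
def timeMeasure (T : ℝ) : Measure ℝ := volume.restrict (Set.Ioo 0 T)

/-- `2π`-periodicity in every variable. -/
def IsPeriodic {d : ℕ} (f : (Fin d → ℝ) → ℝ) : Prop :=
  ∀ (x : Fin d → ℝ) (k : Fin d → ℤ), f (fun i => x i + 2 * Real.pi * (k i : ℝ)) = f x

/-- The Euclidean length `|k|` of a frequency. -/
def freqNorm {d : ℕ} (k : Fin d → ℤ) : ℝ := Real.sqrt (∑ i, (k i : ℝ) ^ 2)

/-- Fourier coefficients `û(k) = (2π)^{-d} ∫ u(x) e^{-i k·x} dx`. -/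
def fourierCoef {d : ℕ} (u : (Fin d → ℝ) → ℝ) (k : Fin d → ℤ) : ℂ :=
  (1 / (2 * (Real.pi : ℂ)) ^ d) *
    ∫ x, (u x : ℂ) * Complex.exp (-Complex.I * ((∑ i, (k i : ℝ) * x i : ℝ) : ℂ)) ∂(torusMeasure d)

/-- Membership in the Wiener space `A_s`: `u ∈ L¹` and `∑ |k|^s |û(k)| < ∞`
(with `|0|^0 = 1` and `|0|^s = 0` for `s > 0`). -/
def MemWiener {d : ℕ} (s : ℝ) (u : (Fin d → ℝ) → ℝ) : Prop :=
  Integrable u (torusMeasure d) ∧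
    Summable (fun k : Fin d → ℤ => freqNorm k ^ s * ‖fourierCoef u k‖)

/-- The norm `|u|_s = ∑ |k|^s |û(k)|`. -/
def wienerNorm {d : ℕ} (s : ℝ) (u : (Fin d → ℝ) → ℝ) : ℝ :=
  ∑' k : Fin d → ℤ, freqNorm k ^ s * ‖fourierCoef u k‖

/-- `u ∈ L^q(0, T; L^r)` in the sense of Bochner: for almost every `t` the slice `u t` is
(a representative of) the value at `t` of a strongly measurable `L^r`-valued function with
norm in `L^q(0, T)`. -/
def MemBochner {d : ℕ} (q r : ℝ≥0∞) [Fact (1 ≤ r)] (T : ℝ) (u : ℝ → (Fin d → ℝ) → ℝ) : Prop :=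
  ∃ U : ℝ → Lp ℝ r (torusMeasure d), MemLp U q (timeMeasure T) ∧
    ∀ᵐ t ∂(timeMeasure T), ∀ᵐ x ∂(torusMeasure d), U t x = u t x

/-- The family `w(t, k) û(t, k)` lies in `L^q(0, T; ℓ¹)` in the sense of Bochner. -/
def MemBochnerFourier {d : ℕ} (q : ℝ≥0∞) (w : ℝ → (Fin d → ℤ) → ℝ) (T : ℝ)
    (u : ℝ → (Fin d → ℝ) → ℝ) : Prop :=
  ∃ F : ℝ → lp (fun _ : Fin d → ℤ => ℂ) 1, MemLp F q (timeMeasure T) ∧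
    ∀ᵐ t ∂(timeMeasure T), Integrable (u t) (torusMeasure d) ∧
      ∀ k : Fin d → ℤ, F t k = (w t k : ℂ) * fourierCoef (u t) k

/-- `u ∈ L^q(0, T; A_s)`; the map `v ↦ (|k|^s v̂(k))_k` carries the norm of `A_s` to that
of `ℓ¹`. -/
def MemBochnerWiener {d : ℕ} (q : ℝ≥0∞) (s T : ℝ) (u : ℝ → (Fin d → ℝ) → ℝ) : Prop :=
  MemBochnerFourier q (fun _ k => freqNorm k ^ s) T u

/-- Partial derivative `∂_i ψ`. -/
def pderiv {d : ℕ} (i : Fin d) (ψ : (Fin d → ℝ) → ℝ) (x : Fin d → ℝ) : ℝ :=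
  fderiv ℝ ψ x (Pi.single i 1)

/-- `g` is the weak derivative `∂_i f` on the torus. -/
def HasWeakDeriv {d : ℕ} (i : Fin d) (f g : (Fin d → ℝ) → ℝ) : Prop :=
  Integrable f (torusMeasure d) ∧ Integrable g (torusMeasure d) ∧
    ∀ ψ : (Fin d → ℝ) → ℝ, ContDiff ℝ ∞ ψ → IsPeriodic ψ →
      ∫ x, f x * pderiv i ψ x ∂(torusMeasure d) = -∫ x, g x * ψ x ∂(torusMeasure d)

/-- `g` is the weak second derivative `∂_i ∂_j f` on the torus. -/
def HasWeakDerivTwo {d : ℕ} (i j : Fin d) (f g : (Fin d → ℝ) → ℝ) : Prop :=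
  Integrable f (torusMeasure d) ∧ Integrable g (torusMeasure d) ∧
    ∀ ψ : (Fin d → ℝ) → ℝ, ContDiff ℝ ∞ ψ → IsPeriodic ψ →
      ∫ x, f x * pderiv i (pderiv j ψ) x ∂(torusMeasure d) = ∫ x, g x * ψ x ∂(torusMeasure d)

/-- `u ∈ L^q(0, T; W^{1,r})`. -/
def MemBochnerSobolevOne {d : ℕ} (q r : ℝ≥0∞) [Fact (1 ≤ r)] (T : ℝ)
    (u : ℝ → (Fin d → ℝ) → ℝ) : Prop :=
  MemBochner q r T u ∧
    ∀ i : Fin d, ∃ v : ℝ → (Fin d → ℝ) → ℝ, MemBochner q r T v ∧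
      ∀ᵐ t ∂(timeMeasure T), HasWeakDeriv i (u t) (v t)

/-- `u ∈ L^q(0, T; W^{2,r})`. -/
def MemBochnerSobolevTwo {d : ℕ} (q r : ℝ≥0∞) [Fact (1 ≤ r)] (T : ℝ)
    (u : ℝ → (Fin d → ℝ) → ℝ) : Prop :=
  MemBochnerSobolevOne q r T u ∧
    ∀ i j : Fin d, ∃ v : ℝ → (Fin d → ℝ) → ℝ, MemBochner q r T v ∧
      ∀ᵐ t ∂(timeMeasure T), HasWeakDerivTwo i j (u t) (v t)

/-- Test functions for the problem on `[0, T)`: smooth on space-time, periodic in space, and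
vanishing at the final time `T`. -/
def IsTestFunction {d : ℕ} (T : ℝ) (φ : ℝ → (Fin d → ℝ) → ℝ) : Prop :=
  ContDiff ℝ ∞ (fun z : ℝ × (Fin d → ℝ) => φ z.1 z.2) ∧ (∀ t, IsPeriodic (φ t)) ∧
    ∀ x, φ T x = 0

/-- Strong solutions on `(0, T)` of
`∂_t u + ∑_{i,j} ∂_i ∂_j ((u + 1) ∂_i ∂_j log (u + 1)) = 0`, `u(0) = u₀`.
`L i j` is the weak derivative `∂_i ∂_j log (u + 1)`. -/
structure IsStrongSolution {d : ℕ} (T : ℝ) (u₀ : (Fin d → ℝ) → ℝ)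
    (u : ℝ → (Fin d → ℝ) → ℝ) : Prop where
  periodic : ∀ t, IsPeriodic (u t)
  integrable : Integrable (fun z : ℝ × (Fin d → ℝ) => u z.1 z.2)
    ((timeMeasure T).prod (torusMeasure d))
  mem_Linfty : MemBochner ∞ ∞ T u
  mem_H1 : MemBochnerSobolevOne 2 2 T u
  mem_W21 : MemBochnerSobolevTwo 1 1 T u
  pos : ∀ᵐ t ∂(timeMeasure T), ∀ᵐ x ∂(torusMeasure d), 0 < u t x + 1
  weak_form : ∃ L : Fin d → Fin d → ℝ → (Fin d → ℝ) → ℝ,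
    (∀ i j, ∀ᵐ t ∂(timeMeasure T),
      HasWeakDerivTwo i j (fun x => Real.log (u t x + 1)) (L i j t)) ∧
    (∀ i j, Integrable (fun z : ℝ × (Fin d → ℝ) => L i j z.1 z.2 * (u z.1 z.2 + 1))
      ((timeMeasure T).prod (torusMeasure d))) ∧
    ∀ φ : ℝ → (Fin d → ℝ) → ℝ, IsTestFunction T φ →
      -(∫ t, ∫ x, deriv (fun s => φ s x) t * u t x ∂(torusMeasure d) ∂(timeMeasure T))
        - (∫ x, φ 0 x * u₀ x ∂(torusMeasure d))
        + (∫ t, ∫ x, ∑ i, ∑ j, L i j t x * (u t x + 1) * pderiv i (pderiv j (φ t)) x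
            ∂(torusMeasure d) ∂(timeMeasure T)) = 0

/-- The rational function of the smallness condition. -/
def P1 (z : ℝ) : ℝ :=
  4 * z / (1 - z) + 5 * z ^ 2 / (1 - z) ^ 2 + 4 * z ^ 3 / (1 - z) ^ 3

end

end DLSS

/-!
# Global strong solutions of the DLSS equation for small data in the Wiener algebra

Since `(u + 1) ∂_i ∂_j log (u + 1) = ∂_i ∂_j u - ∂_i u ∂_j u / (u + 1)`, the equation is
`∂_t u + Δ² u = ∑ ∂_i ∂_j (∂_i u ∂_j u / (1 + u))`, and it is solved on the Fourier side. If `a`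
are the coefficients of `u` and `|u|_0 < 1`, those of `1 / (1 + u)` form the Neumann series
`∑ (-1)^m a^{*m}`, and the equation becomes the infinite system
`a' = -|k|^4 a - nlTerm ⊤ a`.

The estimate behind everything is `tsum_weight_nlTerm_le`: the `ℓ¹` norm of the nonlinearity is at
most `d² P₁(|u|_0) |u|_4`. It follows from the product rule for the moments `|u|_j = ∑ |k|^j |a k|`
under convolution and from the interpolation `|u|_{i+j}² ≤ |u|_i |u|_{i+2j}`. The linear part
dissipates exactly `|u|_4`, so the smallness condition makes `|u|_0` nonincreasing and `|u|_4`
integrable in time. The estimate holds as well with the weight `exp ((σ |k| + lam) t)`, which is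
submultiplicative in `k`. The weight costs `σ |k| + lam ≤ (σ + lam) |k|^4` for `k ≠ 0`, whereas
the zeroth coefficient vanishes because the mean is conserved. Hence the bound persists if
`σ + lam ≤ 1 - d² P₁(|u_0|_0)`: with `lam = 0` this is the gain of analyticity, with `σ = 0` the
exponential decay.

Solutions are constructed by delaying the time argument of the nonlinearity and keeping finitely
many modes and finitely many terms of the Neumann series (`IsDelayed`). The delayed problem is
solved explicitly, one delay after the other, and along the way it inherits the a priori estimate
without a continuity argument (`IsDelayed.apriori`). Each coefficient is equicontinuous
(`IsDelayed.norm_sub_le`), so that a subsequence converges; the exponential weight dominates the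
passage to the limit in the nonlinearity at positive times, and the bounds survive by Fatou's lemma
(`exists_isCoefSolution`).

Back in physical space, `u t = rseries (a t)` is a trigonometric series. At almost every time
`|u|_4` is finite, so `u t` has two continuous derivatives given by termwise differentiation, and
the flux `(u + 1) ∂_i ∂_j log (u + 1)` has coefficients dominated by `|u|_4` in `ℓ¹`
(`IsRegularSlice`). The Bochner norms are therefore controlled by the `ℓ¹`-valued norms of the
coefficients. The weak formulation is the sum over `k` of the equations for single modes
(`IsCoefSolution.weak_form`); in the initial term, `u_0` and its Fourier series define the same
functional on continuous periodic functions because trigonometric polynomials are dense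
(`integral_mul_eq_zero_of_pairing`).
-/

namespace DLSS

noncomputable section

open Filter Topology

variable {d : ℕ}

/-! ### Moments of nonnegative sequences under convolution -/

lemma freqNorm_nonneg (k : Fin d → ℤ) : 0 ≤ freqNorm k := Real.sqrt_nonneg _

lemma freqNorm_eq_norm (k : Fin d → ℤ) :
    freqNorm k = ‖(WithLp.toLp 2 (fun i => (k i : ℝ)) : EuclideanSpace ℝ (Fin d))‖ := by
  simp [freqNorm, EuclideanSpace.norm_eq]

lemma freqNorm_add_le (k l : Fin d → ℤ) : freqNorm (k + l) ≤ freqNorm k + freqNorm l := by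
  simp only [freqNorm_eq_norm]
  refine le_trans (le_of_eq ?_) (norm_add_le _ _)
  congr 1
  ext i
  simp

lemma freqNorm_sq (k : Fin d → ℤ) : freqNorm k ^ 2 = ∑ i, (k i : ℝ) ^ 2 :=
  Real.sq_sqrt (Finset.sum_nonneg fun _ _ => sq_nonneg _)

lemma freqNorm_zero : freqNorm (0 : Fin d → ℤ) = 0 := by simp [freqNorm]

lemma freqNorm_neg (k : Fin d → ℤ) : freqNorm (-k) = freqNorm k := by simp [freqNorm]

lemma abs_le_freqNorm (k : Fin d → ℤ) (i : Fin d) : |(k i : ℝ)| ≤ freqNorm k := by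
  refine Real.abs_le_sqrt ?_
  exact Finset.single_le_sum (f := fun i => (k i : ℝ) ^ 2) (fun _ _ => sq_nonneg _)
    (Finset.mem_univ i)

lemma one_le_freqNorm {k : Fin d → ℤ} (hk : k ≠ 0) : 1 ≤ freqNorm k := by
  obtain ⟨i, hi⟩ := Function.ne_iff.mp hk
  refine le_trans ?_ (abs_le_freqNorm k i)
  have : (1 : ℤ) ≤ |k i| := Int.one_le_abs hi
  exact_mod_cast this

/-- The length `|k|` as an extended nonnegative real. -/
def efreq (k : Fin d → ℤ) : ℝ≥0∞ := ENNReal.ofReal (freqNorm k)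

lemma efreq_add_le (k l : Fin d → ℤ) : efreq (k + l) ≤ efreq k + efreq l := by
  rw [efreq, efreq, efreq, ← ENNReal.ofReal_add (freqNorm_nonneg _) (freqNorm_nonneg _)]
  exact ENNReal.ofReal_le_ofReal (freqNorm_add_le k l)

/-- The moment `∑ |k|^j A(k)` of a nonnegative sequence. -/
def moment (j : ℕ) (A : (Fin d → ℤ) → ℝ≥0∞) : ℝ≥0∞ := ∑' k, efreq k ^ j * A k

/-- Convolution of nonnegative sequences. -/
def econv (A B : (Fin d → ℤ) → ℝ≥0∞) (k : Fin d → ℤ) : ℝ≥0∞ := ∑' l, A l * B (k - l)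

lemma tsum_mul_econv (g A B : (Fin d → ℤ) → ℝ≥0∞) :
    ∑' k, g k * econv A B k = ∑' l, ∑' m, g (l + m) * (A l * B m) := by
  simp only [econv, ← ENNReal.tsum_mul_left]
  rw [ENNReal.tsum_comm]
  refine tsum_congr fun l => ?_
  rw [← (Equiv.addLeft l).tsum_eq]
  simp

lemma econv_mono {A A' B B' : (Fin d → ℤ) → ℝ≥0∞} (hA : ∀ k, A k ≤ A' k)
    (hB : ∀ k, B k ≤ B' k) (k : Fin d → ℤ) : econv A B k ≤ econv A' B' k :=
  ENNReal.tsum_le_tsum fun l => mul_le_mul' (hA l) (hB _)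

lemma moment_mono (j : ℕ) {A B : (Fin d → ℤ) → ℝ≥0∞} (h : ∀ k, A k ≤ B k) :
    moment j A ≤ moment j B :=
  ENNReal.tsum_le_tsum fun k => mul_le_mul' le_rfl (h k)

lemma moment_add (j : ℕ) (A B : (Fin d → ℤ) → ℝ≥0∞) :
    moment j (fun k => A k + B k) = moment j A + moment j B := by
  simp only [moment, mul_add, ENNReal.tsum_add]

lemma tsum_tsum_mul (f g : (Fin d → ℤ) → ℝ≥0∞) :
    ∑' l, ∑' m, f l * g m = (∑' l, f l) * ∑' m, g m := by
  simp only [ENNReal.tsum_mul_left, ENNReal.tsum_mul_right]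

lemma moment_mul_moment (i j : ℕ) (A B : (Fin d → ℤ) → ℝ≥0∞) :
    moment i A * moment j B = ∑' l, ∑' m, (efreq l ^ i * A l) * (efreq m ^ j * B m) :=
  (tsum_tsum_mul _ _).symm

lemma moment_zero_econv (A B : (Fin d → ℤ) → ℝ≥0∞) :
    moment 0 (econv A B) = moment 0 A * moment 0 B := by
  rw [moment_mul_moment, moment, tsum_mul_econv]
  simp

lemma moment_one_econv_le (A B : (Fin d → ℤ) → ℝ≥0∞) :
    moment 1 (econv A B) ≤ moment 1 A * moment 0 B + moment 0 A * moment 1 B := by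
  simp only [moment_mul_moment, ← ENNReal.tsum_add]
  rw [moment, tsum_mul_econv]
  refine ENNReal.tsum_le_tsum fun l => ENNReal.tsum_le_tsum fun m => ?_
  calc efreq (l + m) ^ 1 * (A l * B m) ≤ (efreq l + efreq m) ^ 1 * (A l * B m) := by
        gcongr; exact efreq_add_le l m
    _ = _ := by ring

lemma moment_two_econv_le (A B : (Fin d → ℤ) → ℝ≥0∞) :
    moment 2 (econv A B) ≤
      moment 2 A * moment 0 B + 2 * (moment 1 A * moment 1 B) + moment 0 A * moment 2 B := by
  simp only [moment_mul_moment, ← ENNReal.tsum_mul_left, ← ENNReal.tsum_add]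
  rw [moment, tsum_mul_econv]
  refine ENNReal.tsum_le_tsum fun l => ENNReal.tsum_le_tsum fun m => ?_
  calc efreq (l + m) ^ 2 * (A l * B m) ≤ (efreq l + efreq m) ^ 2 * (A l * B m) := by
        gcongr; exact efreq_add_le l m
    _ = _ := by ring

/-- Interpolation between moments: the square of a moment is a double sum, to which
`2 x^j y^j ≤ x^{2j} + y^{2j}` is applied termwise. -/
lemma moment_sq_le (i j : ℕ) (A : (Fin d → ℤ) → ℝ≥0∞) :
    moment (i + j) A ^ 2 ≤ moment i A * moment (i + 2 * j) A := by
  have key : ∀ x y : ℝ≥0∞, 2 * (x ^ (i + j) * y ^ (i + j)) ≤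
      x ^ i * y ^ (i + 2 * j) + x ^ (i + 2 * j) * y ^ i := by
    intro x y
    have h1 : 2 * (x ^ j * y ^ j) ≤ (x ^ j) ^ 2 + (y ^ j) ^ 2 := by
      generalize x ^ j = u
      generalize y ^ j = v
      wlog huv : u ≤ v generalizing u v
      · have := this v u (le_of_not_ge huv)
        rwa [mul_comm v u, add_comm] at this
      obtain ⟨w, rfl⟩ := exists_add_of_le huv
      calc 2 * (u * (u + w)) ≤ 2 * (u * (u + w)) + w ^ 2 := le_self_add
        _ = _ := by ring
    calc 2 * (x ^ (i + j) * y ^ (i + j)) = (x ^ i * y ^ i) * (2 * (x ^ j * y ^ j)) := by ring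
      _ ≤ (x ^ i * y ^ i) * ((x ^ j) ^ 2 + (y ^ j) ^ 2) := by gcongr
      _ = _ := by ring
  have h2 : 2 * moment (i + j) A ^ 2 ≤ 2 * (moment i A * moment (i + 2 * j) A) := by
    calc 2 * moment (i + j) A ^ 2
        = ∑' l, ∑' m, 2 * (efreq l ^ (i + j) * efreq m ^ (i + j)) * (A l * A m) := by
          rw [sq, moment_mul_moment, ← ENNReal.tsum_mul_left]
          refine tsum_congr fun l => ?_
          rw [← ENNReal.tsum_mul_left]
          exact tsum_congr fun m => by ring
      _ ≤ ∑' l, ∑' m, (efreq l ^ i * efreq m ^ (i + 2 * j) + efreq l ^ (i + 2 * j) * efreq m ^ i)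
            * (A l * A m) :=
          ENNReal.tsum_le_tsum fun l => ENNReal.tsum_le_tsum fun m => by
            gcongr; exact key _ _
      _ = moment i A * moment (i + 2 * j) A + moment (i + 2 * j) A * moment i A := by
          simp only [moment_mul_moment, ← ENNReal.tsum_add]
          exact tsum_congr fun l => tsum_congr fun m => by ring
      _ = _ := by ring
  exact (ENNReal.mul_le_mul_iff_right (by norm_num) (by norm_num)).mp h2

/-- The unit sequence for convolution. -/
def edelta (k : Fin d → ℤ) : ℝ≥0∞ := if k = 0 then 1 else 0

/-- Convolution powers of a nonnegative sequence. -/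
def epow (A : (Fin d → ℤ) → ℝ≥0∞) : ℕ → (Fin d → ℤ) → ℝ≥0∞
  | 0 => edelta
  | m + 1 => econv A (epow A m)

/-- The geometric series `∑ A^{⋆m}`, which majorises the coefficients of `1 / (1 + u)`. -/
def egeom (A : (Fin d → ℤ) → ℝ≥0∞) (k : Fin d → ℤ) : ℝ≥0∞ := ∑' m, epow A m k

lemma epow_mono {A B : (Fin d → ℤ) → ℝ≥0∞} (h : ∀ k, A k ≤ B k) (m : ℕ) (k : Fin d → ℤ) :
    epow A m k ≤ epow B m k := by
  induction m generalizing k with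
  | zero => exact le_rfl
  | succ m ih => exact econv_mono h ih k

lemma moment_edelta (j : ℕ) :
    moment j (edelta : (Fin d → ℤ) → ℝ≥0∞) = if j = 0 then 1 else 0 := by
  rw [moment, tsum_eq_single 0]
  · rcases j with _ | j <;> simp [edelta, efreq, freqNorm_zero]
  · intro k hk; simp [edelta, hk]

/-- Moments of the partial geometric sums obey any bound that is stable under
`B ↦ δ + A ⋆ B`; this passes to the full series. -/
lemma moment_egeom_le (j : ℕ) (A : (Fin d → ℤ) → ℝ≥0∞) (C : ℝ≥0∞)
    (h : ∀ M, moment j (fun k => ∑ m ∈ Finset.range M, epow A m k) ≤ C) :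
    moment j (egeom A) ≤ C := by
  have h1 : moment j (egeom A) = ∑' m, moment j (epow A m) := by
    simp only [moment, egeom, ← ENNReal.tsum_mul_left]
    exact ENNReal.tsum_comm
  rw [h1]
  refine ENNReal.tsum_le_of_sum_range_le fun M => ?_
  refine le_trans (le_of_eq ?_) (h M)
  simp only [moment, Finset.mul_sum]
  exact (Summable.tsum_finsetSum fun _ _ => ENNReal.summable).symm

lemma sum_epow_succ (A : (Fin d → ℤ) → ℝ≥0∞) (M : ℕ) :
    (fun k => ∑ m ∈ Finset.range (M + 1), epow A m k) =
      fun k => edelta k + econv A (fun k => ∑ m ∈ Finset.range M, epow A m k) k := by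
  funext k
  rw [Finset.sum_range_succ', add_comm]
  congr 1
  simp only [epow, econv, Finset.mul_sum]
  exact (Summable.tsum_finsetSum fun _ _ => ENNReal.summable).symm

section geom

variable {A : (Fin d → ℤ) → ℝ≥0∞} {z : ℝ}

lemma moment_zero_sum_epow_le (hz0 : 0 ≤ z) (hz1 : z < 1)
    (hA : moment 0 A ≤ ENNReal.ofReal z) (M : ℕ) :
    moment 0 (fun k => ∑ m ∈ Finset.range M, epow A m k) ≤ ENNReal.ofReal (1 / (1 - z)) := by
  have h1z : 0 < 1 - z := by linarith
  induction M with
  | zero => simp [moment]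
  | succ M ih =>
    rw [sum_epow_succ, moment_add, moment_zero_econv, moment_edelta, if_pos rfl]
    calc 1 + moment 0 A * _
        ≤ ENNReal.ofReal 1 + ENNReal.ofReal z * ENNReal.ofReal (1 / (1 - z)) := by gcongr; simp
      _ = ENNReal.ofReal (1 + z * (1 / (1 - z))) := by
          rw [← ENNReal.ofReal_mul hz0, ← ENNReal.ofReal_add (by norm_num) (by positivity)]
      _ = _ := by congr 1; field_simp; ring

/-- The fixed point equation for the sum of the geometric series. -/
lemma geom_const_eq (hz0 : 0 ≤ z) (hz1 : z < 1) :
    1 + ENNReal.ofReal z * ENNReal.ofReal (1 / (1 - z)) = ENNReal.ofReal (1 / (1 - z)) := by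
  have h1z : 0 < 1 - z := by linarith
  rw [← ENNReal.ofReal_mul hz0, ← ENNReal.ofReal_one, ← ENNReal.ofReal_add (by norm_num)
    (by positivity)]
  congr 1; field_simp; ring

lemma moment_one_sum_epow_le (hz0 : 0 ≤ z) (hz1 : z < 1)
    (hA : moment 0 A ≤ ENNReal.ofReal z) (M : ℕ) :
    moment 1 (fun k => ∑ m ∈ Finset.range M, epow A m k) ≤
      moment 1 A * ENNReal.ofReal (1 / (1 - z)) ^ 2 := by
  induction M with
  | zero => simp [moment]
  | succ M ih =>
    have h0 := moment_zero_sum_epow_le hz0 hz1 hA M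
    rw [sum_epow_succ, moment_add, moment_edelta, if_neg one_ne_zero, zero_add]
    refine (moment_one_econv_le _ _).trans ?_
    set c := ENNReal.ofReal (1 / (1 - z)) with hc
    calc _ ≤ moment 1 A * c + ENNReal.ofReal z * (moment 1 A * c ^ 2) := by gcongr
      _ = moment 1 A * c * (1 + ENNReal.ofReal z * c) := by ring
      _ = _ := by rw [geom_const_eq hz0 hz1, ← hc]; ring

lemma moment_two_sum_epow_le (hz0 : 0 ≤ z) (hz1 : z < 1)
    (hA : moment 0 A ≤ ENNReal.ofReal z) (M : ℕ) :
    moment 2 (fun k => ∑ m ∈ Finset.range M, epow A m k) ≤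
      moment 2 A * ENNReal.ofReal (1 / (1 - z)) ^ 2 +
        2 * (moment 1 A ^ 2 * ENNReal.ofReal (1 / (1 - z)) ^ 3) := by
  induction M with
  | zero => simp [moment]
  | succ M ih =>
    have h0 := moment_zero_sum_epow_le hz0 hz1 hA M
    have h1 := moment_one_sum_epow_le hz0 hz1 hA M
    rw [sum_epow_succ, moment_add, moment_edelta, if_neg two_ne_zero, zero_add]
    refine (moment_two_econv_le _ _).trans ?_
    set c := ENNReal.ofReal (1 / (1 - z)) with hc
    calc _ ≤ moment 2 A * c + 2 * (moment 1 A * (moment 1 A * c ^ 2)) + ENNReal.ofReal z *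
          (moment 2 A * c ^ 2 + 2 * (moment 1 A ^ 2 * c ^ 3)) := by gcongr
      _ = (moment 2 A * c + 2 * (moment 1 A ^ 2 * c ^ 2)) * (1 + ENNReal.ofReal z * c) := by ring
      _ = _ := by rw [geom_const_eq hz0 hz1, ← hc]; ring

lemma moment_zero_egeom_le (hz0 : 0 ≤ z) (hz1 : z < 1)
    (hA : moment 0 A ≤ ENNReal.ofReal z) :
    moment 0 (egeom A) ≤ ENNReal.ofReal (1 / (1 - z)) :=
  moment_egeom_le _ _ _ (moment_zero_sum_epow_le hz0 hz1 hA)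

lemma moment_mul_efreq (j : ℕ) (A : (Fin d → ℤ) → ℝ≥0∞) :
    moment j (fun k => efreq k * A k) = moment (j + 1) A := by
  simp only [moment, pow_succ, mul_assoc]

/-- The bound for the nonlinearity: two derivatives of `∂u ∂u / (1 + u)` cost at most `P1(z)`
times the fourth moment. Every product of moments that arises has four derivatives in total, and
interpolation turns it into a power of `M0` times `M4`. -/
lemma moment_two_nonlinearity_le (hz0 : 0 ≤ z) (hz1 : z < 1)
    (hA : moment 0 A ≤ ENNReal.ofReal z) :
    moment 2 (econv (fun k => efreq k * A k) (econv (fun k => efreq k * A k) (egeom A))) ≤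
      ENNReal.ofReal (P1 z) * moment 4 A := by
  have h1z : 0 < 1 - z := by linarith
  have g0 := moment_zero_egeom_le hz0 hz1 hA
  have g1 := moment_egeom_le _ _ _ (moment_one_sum_epow_le hz0 hz1 hA)
  have g2 := moment_egeom_le _ _ _ (moment_two_sum_epow_le hz0 hz1 hA)
  set G := egeom A
  set E : (Fin d → ℤ) → ℝ≥0∞ := fun k => efreq k * A k with hE
  have e0 : moment 0 E = moment 1 A := moment_mul_efreq 0 A
  have e1 : moment 1 E = moment 2 A := moment_mul_efreq 1 A
  have e2 : moment 2 E = moment 3 A := moment_mul_efreq 2 A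
  have f0 := moment_zero_econv E G
  have f1 := moment_one_econv_le E G
  have f2 := moment_two_econv_le E G
  rw [e0] at f0
  rw [e0, e1] at f1
  rw [e0, e1, e2] at f2
  have I1 : moment 1 A ^ 2 ≤ moment 0 A * moment 2 A := moment_sq_le 0 1 A
  have I2 : moment 2 A ^ 2 ≤ moment 0 A * moment 4 A := moment_sq_le 0 2 A
  have I3 : moment 3 A ^ 2 ≤ moment 2 A * moment 4 A := moment_sq_le 2 1 A
  set M0 := moment 0 A
  set M1 := moment 1 A
  set M2 := moment 2 A
  set M3 := moment 3 A
  set M4 := moment 4 A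
  set c := ENNReal.ofReal (1 / (1 - z)) with hc
  set ζ := ENNReal.ofReal z with hζ
  have J1 : M3 * M1 ≤ M0 * M4 := by
    refine (ENNReal.pow_le_pow_left_iff two_ne_zero).mp ?_
    calc (M3 * M1) ^ 2 = M3 ^ 2 * M1 ^ 2 := by ring
      _ ≤ (M2 * M4) * (M0 * M2) := by gcongr
      _ = M2 ^ 2 * (M0 * M4) := by ring
      _ ≤ (M0 * M4) * (M0 * M4) := by gcongr
      _ = _ := by ring
  have J2 : M2 * M1 ^ 2 ≤ M0 ^ 2 * M4 := by
    calc M2 * M1 ^ 2 ≤ M2 * (M0 * M2) := by gcongr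
      _ = M0 * M2 ^ 2 := by ring
      _ ≤ M0 * (M0 * M4) := by gcongr
      _ = _ := by ring
  have J3 : M1 ^ 4 ≤ M0 ^ 3 * M4 := by
    calc M1 ^ 4 = (M1 ^ 2) ^ 2 := by ring
      _ ≤ (M0 * M2) ^ 2 := by gcongr
      _ = M0 ^ 2 * M2 ^ 2 := by ring
      _ ≤ M0 ^ 2 * (M0 * M4) := by gcongr
      _ = _ := by ring
  calc moment 2 (econv E (econv E G))
      ≤ M3 * moment 0 (econv E G) + 2 * (M2 * moment 1 (econv E G))
          + M1 * moment 2 (econv E G) := by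
        have := moment_two_econv_le E (econv E G)
        rwa [e0, e1, e2] at this
    _ ≤ M3 * (M1 * c) + 2 * (M2 * (M2 * c + M1 * (M1 * c ^ 2)))
          + M1 * (M3 * c + 2 * (M2 * (M1 * c ^ 2)) +
            M1 * (M2 * c ^ 2 + 2 * (M1 ^ 2 * c ^ 3))) := by
        have k0 : moment 0 (econv E G) ≤ M1 * c := f0.trans_le (by gcongr)
        have k1 : moment 1 (econv E G) ≤ M2 * c + M1 * (M1 * c ^ 2) := f1.trans (by gcongr)
        have k2 : moment 2 (econv E G) ≤ M3 * c + 2 * (M2 * (M1 * c ^ 2)) +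
            M1 * (M2 * c ^ 2 + 2 * (M1 ^ 2 * c ^ 3)) := f2.trans (by gcongr)
        gcongr
    _ = 2 * (M3 * M1) * c + 2 * M2 ^ 2 * c + 5 * (M2 * M1 ^ 2) * c ^ 2 + 2 * M1 ^ 4 * c ^ 3 := by
        ring
    _ ≤ 2 * (M0 * M4) * c + 2 * (M0 * M4) * c + 5 * (M0 ^ 2 * M4) * c ^ 2
          + 2 * (M0 ^ 3 * M4) * c ^ 3 := by gcongr
    -- the coefficient `4` of the cubic term of `P1` is larger than the `2` needed here
    _ ≤ 2 * (ζ * M4) * c + 2 * (ζ * M4) * c + 5 * (ζ ^ 2 * M4) * c ^ 2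
          + 4 * (ζ ^ 3 * M4) * c ^ 3 := by
        gcongr; norm_num
    _ = (4 * (ζ * c) + 5 * (ζ * c) ^ 2 + 4 * (ζ * c) ^ 3) * M4 := by ring
    _ = ENNReal.ofReal (P1 z) * M4 := by
        congr 1
        have hzc : ζ * c = ENNReal.ofReal (z / (1 - z)) := by
          rw [hζ, hc, ← ENNReal.ofReal_mul hz0, mul_one_div]
        have hq : 0 ≤ z / (1 - z) := by positivity
        have h4 : (4 : ℝ≥0∞) = ENNReal.ofReal 4 := by simp
        have h5 : (5 : ℝ≥0∞) = ENNReal.ofReal 5 := by simp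
        rw [hzc, ← ENNReal.ofReal_pow hq, ← ENNReal.ofReal_pow hq, h4, h5,
          ← ENNReal.ofReal_mul (by norm_num), ← ENNReal.ofReal_mul (by norm_num),
          ← ENNReal.ofReal_mul (by norm_num), ← ENNReal.ofReal_add (by positivity) (by positivity),
          ← ENNReal.ofReal_add (by positivity) (by positivity)]
        congr 1
        rw [P1, div_pow, div_pow]
        ring

end geom

/-! ### The nonlinearity on Fourier coefficients -/

/-- Convolution of sequences of Fourier coefficients. -/
def conv (a b : (Fin d → ℤ) → ℂ) (k : Fin d → ℤ) : ℂ := ∑' l, a l * b (k - l)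

/-- Fourier coefficients of the constant function `1`. -/
def delta (k : Fin d → ℤ) : ℂ := if k = 0 then 1 else 0

/-- Convolution powers. -/
def convPow (a : (Fin d → ℤ) → ℂ) : ℕ → (Fin d → ℤ) → ℂ
  | 0 => delta
  | m + 1 => conv a (convPow a m)

/-- The sum of the first `M` terms of the Neumann series `∑ (-1)^m a^{*m}`. For `M = ⊤` these are
the Fourier coefficients of `1 / (1 + u)`, where `a` are those of `u`. -/
def neumann (M : ℕ∞) (a : (Fin d → ℤ) → ℂ) (k : Fin d → ℤ) : ℂ :=
  ∑' m : ℕ, if (m : ℕ∞) < M then (-1) ^ m * convPow a m k else 0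

/-- Fourier coefficients of `∂_i u`. -/
def dcoef (i : Fin d) (a : (Fin d → ℤ) → ℂ) (k : Fin d → ℤ) : ℂ := Complex.I * (k i : ℂ) * a k

/-- Fourier coefficients of `∂_i u ∂_j u g`, where `a` and `g` are the coefficients of `u`
and of the third factor. -/
def gradProd (g a : (Fin d → ℤ) → ℂ) (i j : Fin d) : (Fin d → ℤ) → ℂ :=
  conv (dcoef i a) (conv (dcoef j a) g)

/-- Fourier coefficients of `-∑ ∂_i ∂_j (∂_i u ∂_j u / (1 + u))`, with the Neumann series for
`1 / (1 + u)` cut after `M` terms. -/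
def nlTerm (M : ℕ∞) (a : (Fin d → ℤ) → ℂ) (k : Fin d → ℤ) : ℂ :=
  ∑ i, ∑ j, (k i : ℂ) * (k j : ℂ) * gradProd (neumann M a) a i j k

/-- The sequence of absolute values, extended-real valued. -/
def eabs (a : (Fin d → ℤ) → ℂ) (k : Fin d → ℤ) : ℝ≥0∞ := ‖a k‖ₑ

lemma enorm_conv_le (a b : (Fin d → ℤ) → ℂ) (k : Fin d → ℤ) :
    ‖conv a b k‖ₑ ≤ econv (eabs a) (eabs b) k := by
  refine enorm_tsum_le_tsum_enorm.trans (le_of_eq ?_)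
  simp only [enorm_mul]
  rfl

lemma enorm_delta (k : Fin d → ℤ) : ‖delta k‖ₑ = edelta k := by
  unfold delta edelta; split_ifs <;> simp

lemma enorm_convPow_le (a : (Fin d → ℤ) → ℂ) (m : ℕ) (k : Fin d → ℤ) :
    ‖convPow a m k‖ₑ ≤ epow (eabs a) m k := by
  induction m generalizing k with
  | zero => exact (enorm_delta k).le
  | succ m ih => exact (enorm_conv_le _ _ _).trans (econv_mono (fun _ => le_rfl) ih k)

lemma enorm_neumann_le (M : ℕ∞) (a : (Fin d → ℤ) → ℂ) (k : Fin d → ℤ) :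
    ‖neumann M a k‖ₑ ≤ egeom (eabs a) k := by
  refine enorm_tsum_le_tsum_enorm.trans (ENNReal.tsum_le_tsum fun m => ?_)
  split_ifs
  · rw [enorm_mul]
    simpa using enorm_convPow_le a m k
  · simp

lemma enorm_intCast_le (k : Fin d → ℤ) (i : Fin d) : ‖(k i : ℂ)‖ₑ ≤ efreq k := by
  rw [← ofReal_norm]
  refine ENNReal.ofReal_le_ofReal ?_
  simpa using abs_le_freqNorm k i

lemma eabs_dcoef_le (i : Fin d) (a : (Fin d → ℤ) → ℂ) (k : Fin d → ℤ) :
    eabs (dcoef i a) k ≤ efreq k * eabs a k := by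
  simp only [eabs, dcoef, enorm_mul]
  have : ‖Complex.I‖ₑ = 1 := by rw [← ofReal_norm]; simp
  rw [this, one_mul]
  gcongr
  exact enorm_intCast_le k i

lemma enorm_gradProd_le (M : ℕ∞) (a : (Fin d → ℤ) → ℂ) (i j : Fin d) (k : Fin d → ℤ) :
    ‖gradProd (neumann M a) a i j k‖ₑ ≤ econv (fun k => efreq k * eabs a k)
      (econv (fun k => efreq k * eabs a k) (egeom (eabs a))) k :=
  (enorm_conv_le _ _ _).trans <| econv_mono (eabs_dcoef_le i a) (fun l =>
    (enorm_conv_le _ _ _).trans <| econv_mono (eabs_dcoef_le j a) (enorm_neumann_le M a) l) k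

lemma enorm_nlTerm_le (M : ℕ∞) (a : (Fin d → ℤ) → ℂ) (k : Fin d → ℤ) :
    ‖nlTerm M a k‖ₑ ≤ (d : ℝ≥0∞) ^ 2 * (efreq k ^ 2 * econv (fun k => efreq k * eabs a k)
      (econv (fun k => efreq k * eabs a k) (egeom (eabs a))) k) := by
  refine (enorm_sum_le _ _).trans ?_
  have : ∀ i : Fin d, ‖∑ j, (k i : ℂ) * (k j : ℂ) * gradProd (neumann M a) a i j k‖ₑ ≤
      (d : ℝ≥0∞) * (efreq k ^ 2 * econv (fun k => efreq k * eabs a k)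
      (econv (fun k => efreq k * eabs a k) (egeom (eabs a))) k) := by
    intro i
    refine (enorm_sum_le _ _).trans ?_
    refine (Finset.sum_le_card_nsmul _ _ _ fun j _ => ?_).trans
      (le_of_eq (by rw [Finset.card_univ, Fintype.card_fin, nsmul_eq_mul]))
    rw [enorm_mul, enorm_mul, sq]
    gcongr
    · exact enorm_intCast_le k i
    · exact enorm_intCast_le k j
    · exact enorm_gradProd_le M a i j k
  refine (Finset.sum_le_card_nsmul _ _ _ fun i _ => this i).trans (le_of_eq ?_)
  rw [Finset.card_univ, Fintype.card_fin, nsmul_eq_mul]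
  ring

/-! ### Submultiplicative weights -/

section weight

variable {W : (Fin d → ℤ) → ℝ≥0∞}

lemma weight_mul_econv_le (hW : ∀ k l, W (k + l) ≤ W k * W l)
    (A B : (Fin d → ℤ) → ℝ≥0∞) (k : Fin d → ℤ) :
    W k * econv A B k ≤ econv (fun k => W k * A k) (fun k => W k * B k) k := by
  simp only [econv, ← ENNReal.tsum_mul_left]
  refine ENNReal.tsum_le_tsum fun l => ?_
  calc W k * (A l * B (k - l)) = W (l + (k - l)) * (A l * B (k - l)) := by simp
    _ ≤ (W l * W (k - l)) * (A l * B (k - l)) := by gcongr; exact hW _ _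
    _ = _ := by ring

lemma weight_mul_epow_le (hW0 : W 0 = 1) (hW : ∀ k l, W (k + l) ≤ W k * W l)
    (A : (Fin d → ℤ) → ℝ≥0∞) (m : ℕ) (k : Fin d → ℤ) :
    W k * epow A m k ≤ epow (fun k => W k * A k) m k := by
  induction m generalizing k with
  | zero =>
    simp only [epow, edelta]
    split_ifs with h
    · simp [h, hW0]
    · simp
  | succ m ih =>
    exact (weight_mul_econv_le hW _ _ k).trans (econv_mono (fun _ => le_rfl) ih k)

lemma weight_mul_egeom_le (hW0 : W 0 = 1) (hW : ∀ k l, W (k + l) ≤ W k * W l)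
    (A : (Fin d → ℤ) → ℝ≥0∞) (k : Fin d → ℤ) :
    W k * egeom A k ≤ egeom (fun k => W k * A k) k := by
  simp only [egeom, ← ENNReal.tsum_mul_left]
  exact ENNReal.tsum_le_tsum fun m => weight_mul_epow_le hW0 hW A m k

/-- Weighted bound for the nonlinearity in `ℓ¹`. The scalar `Λ ≥ 1` is a decay factor; it may be
moved onto every factor because the nonlinearity has no constant or linear part. -/
lemma tsum_weight_nlTerm_le (hW0 : W 0 = 1) (hW : ∀ k l, W (k + l) ≤ W k * W l)
    {Λ : ℝ≥0∞} (hΛ : 1 ≤ Λ) (M : ℕ∞) (a : (Fin d → ℤ) → ℂ) {z : ℝ} (hz0 : 0 ≤ z) (hz1 : z < 1)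
    (ha : moment 0 (fun k => Λ * W k * eabs a k) ≤ ENNReal.ofReal z) :
    ∑' k, Λ * W k * ‖nlTerm M a k‖ₑ ≤
      ENNReal.ofReal ((d : ℝ) ^ 2 * P1 z) * moment 4 (fun k => Λ * W k * eabs a k) := by
  set A : (Fin d → ℤ) → ℝ≥0∞ := fun k => Λ * W k * eabs a k with hA
  have hWA : ∀ k, W k * eabs a k ≤ A k := fun k => by
    calc W k * eabs a k = 1 * (W k * eabs a k) := (one_mul _).symm
      _ ≤ Λ * (W k * eabs a k) := by gcongr
      _ = A k := by rw [hA]; ring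
  set E : (Fin d → ℤ) → ℝ≥0∞ := fun k => efreq k * eabs a k with hE
  set E' : (Fin d → ℤ) → ℝ≥0∞ := fun k => efreq k * A k with hE'
  have hWE : ∀ k, W k * E k ≤ E' k := fun k => by
    calc W k * E k = efreq k * (W k * eabs a k) := by rw [hE]; ring
      _ ≤ efreq k * A k := by gcongr; exact hWA k
  have key : ∀ k, Λ * W k * econv E (econv E (egeom (eabs a))) k ≤
      econv E' (econv E' (egeom A)) k := by
    intro k
    calc Λ * W k * econv E (econv E (egeom (eabs a))) k
        = Λ * (W k * econv E (econv E (egeom (eabs a))) k) := by ring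
      _ ≤ Λ * econv (fun k => W k * E k) (fun k => W k * econv E (egeom (eabs a)) k) k := by
          gcongr; exact weight_mul_econv_le hW _ _ k
      _ = econv (fun k => Λ * (W k * E k)) (fun k => W k * econv E (egeom (eabs a)) k) k := by
          simp only [econv, ← ENNReal.tsum_mul_left, mul_assoc]
      _ ≤ _ := by
          refine econv_mono (fun l => le_of_eq (by simp only [hE, hE', hA]; ring)) (fun l => ?_) k
          refine (weight_mul_econv_le hW _ _ l).trans (econv_mono hWE (fun p => ?_) l)
          refine (weight_mul_egeom_le hW0 hW _ p).trans ?_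
          exact ENNReal.tsum_le_tsum fun m => epow_mono hWA m p
  have hP := moment_two_nonlinearity_le hz0 hz1 ha
  calc ∑' k, Λ * W k * ‖nlTerm M a k‖ₑ
      ≤ ∑' k, (d : ℝ≥0∞) ^ 2 * (efreq k ^ 2 * econv E' (econv E' (egeom A)) k) := by
        refine ENNReal.tsum_le_tsum fun k => ?_
        calc Λ * W k * ‖nlTerm M a k‖ₑ ≤ Λ * W k * ((d : ℝ≥0∞) ^ 2 *
              (efreq k ^ 2 * econv E (econv E (egeom (eabs a))) k)) := by
              gcongr; exact enorm_nlTerm_le M a k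
          _ = (d : ℝ≥0∞) ^ 2 * (efreq k ^ 2 *
              (Λ * W k * econv E (econv E (egeom (eabs a))) k)) := by ring
          _ ≤ _ := by gcongr; exact key k
    _ = (d : ℝ≥0∞) ^ 2 * moment 2 (econv E' (econv E' (egeom A))) := by
        rw [ENNReal.tsum_mul_left]; rfl
    _ ≤ (d : ℝ≥0∞) ^ 2 * (ENNReal.ofReal (P1 z) * moment 4 A) := by gcongr
    _ = _ := by
        rw [ENNReal.ofReal_mul (by positivity), ENNReal.ofReal_pow (by positivity),
          ENNReal.ofReal_natCast]
        ring

end weight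

lemma le_moment_zero (A : (Fin d → ℤ) → ℝ≥0∞) (k : Fin d → ℤ) : A k ≤ moment 0 A := by
  simpa [moment] using ENNReal.le_tsum (f := A) k

/-- A bound for a single coefficient of the nonlinearity which costs only two first moments. -/
lemma enorm_nlTerm_le_moment (M : ℕ∞) (a : (Fin d → ℤ) → ℂ) {z : ℝ} (hz0 : 0 ≤ z) (hz1 : z < 1)
    (ha : moment 0 (eabs a) ≤ ENNReal.ofReal z) (k : Fin d → ℤ) :
    ‖nlTerm M a k‖ₑ ≤ (d : ℝ≥0∞) ^ 2 * (efreq k ^ 2 *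
      (moment 1 (eabs a) ^ 2 * ENNReal.ofReal (1 / (1 - z)))) := by
  refine (enorm_nlTerm_le M a k).trans ?_
  gcongr
  refine (le_moment_zero _ k).trans ?_
  rw [moment_zero_econv, moment_zero_econv, moment_mul_efreq, zero_add, ← mul_assoc, ← sq]
  gcongr
  exact moment_zero_egeom_le hz0 hz1 ha

lemma nlTerm_zero_freq (M : ℕ∞) (a : (Fin d → ℤ) → ℂ) : nlTerm M a 0 = 0 := by
  simp [nlTerm]

/-! ### Passage to the limit in the nonlinearity -/

section limit

variable {ι : Type*} {F : Filter ι}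

lemma tendsto_conv {x : ι → (Fin d → ℤ) → ℂ} {x' : (Fin d → ℤ) → ℂ}
    {y : ι → (Fin d → ℤ) → ℂ} {y' : (Fin d → ℤ) → ℂ} {b : (Fin d → ℤ) → ℝ} {C : ℝ}
    (hb : Summable b) (hxb : ∀ᶠ α in F, ∀ k, ‖x α k‖ ≤ b k) (hyC : ∀ᶠ α in F, ∀ k, ‖y α k‖ ≤ C)
    (hx : ∀ k, Tendsto (fun α => x α k) F (𝓝 (x' k)))
    (hy : ∀ k, Tendsto (fun α => y α k) F (𝓝 (y' k))) (k : Fin d → ℤ) :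
    Tendsto (fun α => conv (x α) (y α) k) F (𝓝 (conv x' y' k)) := by
  refine tendsto_tsum_of_dominated_convergence (bound := fun l => b l * C) (hb.mul_right C)
    (fun l => (hx l).mul (hy _)) ?_
  filter_upwards [hxb, hyC] with α h1 h2 l
  rw [norm_mul]
  exact mul_le_mul (h1 l) (h2 _) (norm_nonneg _) ((norm_nonneg _).trans (h1 l))

lemma norm_le_of_enorm_le {E : Type*} [NormedAddCommGroup E] {x : E} {r : ℝ} (hr : 0 ≤ r)
    (h : ‖x‖ₑ ≤ ENNReal.ofReal r) : ‖x‖ ≤ r := by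
  rwa [← ofReal_norm, ENNReal.ofReal_le_ofReal_iff hr] at h

lemma moment_zero_epow (A : (Fin d → ℤ) → ℝ≥0∞) (m : ℕ) :
    moment 0 (epow A m) = moment 0 A ^ m := by
  induction m with
  | zero => simp [epow, moment_edelta]
  | succ m ih => rw [epow, moment_zero_econv, ih, pow_succ, mul_comm]

lemma norm_convPow_le {a : (Fin d → ℤ) → ℂ} {z : ℝ} (hz0 : 0 ≤ z)
    (ha : moment 0 (eabs a) ≤ ENNReal.ofReal z) (m : ℕ) (k : Fin d → ℤ) :
    ‖convPow a m k‖ ≤ z ^ m := by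
  refine norm_le_of_enorm_le (by positivity) ((enorm_convPow_le a m k).trans ?_)
  refine (le_moment_zero _ k).trans ?_
  rw [moment_zero_epow, ENNReal.ofReal_pow hz0]
  gcongr

lemma norm_neumann_le {a : (Fin d → ℤ) → ℂ} {z : ℝ} (hz0 : 0 ≤ z) (hz1 : z < 1)
    (ha : moment 0 (eabs a) ≤ ENNReal.ofReal z) (M : ℕ∞) (k : Fin d → ℤ) :
    ‖neumann M a k‖ ≤ 1 / (1 - z) :=
  norm_le_of_enorm_le (by have : 0 < 1 - z := by linarith
                          positivity)
    ((enorm_neumann_le M a k).trans ((le_moment_zero _ k).trans (moment_zero_egeom_le hz0 hz1 ha)))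

lemma norm_dcoef_le (i : Fin d) (a : (Fin d → ℤ) → ℂ) (k : Fin d → ℤ) :
    ‖dcoef i a k‖ ≤ freqNorm k * ‖a k‖ := by
  have := abs_le_freqNorm k i
  simp only [dcoef, norm_mul, Complex.norm_I, one_mul, Complex.norm_intCast]
  gcongr

lemma tendsto_neumann {a : ι → (Fin d → ℤ) → ℂ} {a' : (Fin d → ℤ) → ℂ}
    {b : (Fin d → ℤ) → ℝ} {z : ℝ} {M : ι → ℕ∞} (hz0 : 0 ≤ z) (hz1 : z < 1) (hb : Summable b)
    (hab : ∀ᶠ α in F, ∀ k, ‖a α k‖ ≤ b k)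
    (haz : ∀ᶠ α in F, moment 0 (eabs (a α)) ≤ ENNReal.ofReal z)
    (ha : ∀ k, Tendsto (fun α => a α k) F (𝓝 (a' k)))
    (hM : ∀ m : ℕ, ∀ᶠ α in F, (m : ℕ∞) < M α) (k : Fin d → ℤ) :
    Tendsto (fun α => neumann (M α) (a α) k) F (𝓝 (neumann ⊤ a' k)) := by
  have hpow : ∀ m k, Tendsto (fun α => convPow (a α) m k) F (𝓝 (convPow a' m k)) := by
    intro m
    induction m with
    | zero => exact fun k => tendsto_const_nhds
    | succ m ih =>
      refine tendsto_conv hb hab (C := z ^ m) ?_ ha ih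
      filter_upwards [haz] with α h k using norm_convPow_le hz0 h m k
  refine tendsto_tsum_of_dominated_convergence (bound := fun m => z ^ m)
    (summable_geometric_of_lt_one hz0 hz1) (fun m => ?_) ?_
  · rw [if_pos (ENat.natCast_lt_top m)]
    refine ((hpow m k).const_mul ((-1) ^ m)).congr' ?_
    filter_upwards [hM m] with α h
    rw [if_pos h]
  · filter_upwards [haz] with α h m
    split_ifs
    · simpa using norm_convPow_le hz0 h m k
    · simpa using by positivity

lemma tendsto_gradProd {a : ι → (Fin d → ℤ) → ℂ} {a' : (Fin d → ℤ) → ℂ}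
    {b : (Fin d → ℤ) → ℝ} {z : ℝ} {M : ι → ℕ∞} (hz0 : 0 ≤ z) (hz1 : z < 1) (hb : Summable b)
    (hb1 : Summable fun k => freqNorm k * b k)
    (hab : ∀ᶠ α in F, ∀ k, ‖a α k‖ ≤ b k)
    (haz : ∀ᶠ α in F, moment 0 (eabs (a α)) ≤ ENNReal.ofReal z)
    (ha : ∀ k, Tendsto (fun α => a α k) F (𝓝 (a' k)))
    (hM : ∀ m : ℕ, ∀ᶠ α in F, (m : ℕ∞) < M α) (i j : Fin d) (k : Fin d → ℤ) :
    Tendsto (fun α => gradProd (neumann (M α) (a α)) (a α) i j k) F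
      (𝓝 (gradProd (neumann ⊤ a') a' i j k)) := by
  have hd : ∀ i k, Tendsto (fun α => dcoef i (a α) k) F (𝓝 (dcoef i a' k)) :=
    fun i k => (ha k).const_mul _
  have hdb : ∀ i, ∀ᶠ α in F, ∀ k, ‖dcoef i (a α) k‖ ≤ freqNorm k * b k := by
    intro i
    filter_upwards [hab] with α h k
    refine (norm_dcoef_le i _ k).trans ?_
    gcongr
    · exact freqNorm_nonneg k
    · exact h k
  have h1 := tendsto_conv hb1 (hdb j) (by
    filter_upwards [haz] with α h k using norm_neumann_le hz0 hz1 h (M α) k) (hd j)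
    (tendsto_neumann hz0 hz1 hb hab haz ha hM)
  refine tendsto_conv hb1 (hdb i) (C := (∑' k, freqNorm k * b k) * (1 / (1 - z))) ?_ (hd i) h1 k
  filter_upwards [hdb j, haz] with α h h' k
  refine tsum_of_norm_bounded (hb1.hasSum.mul_right (1 / (1 - z))) fun l => ?_
  rw [norm_mul]
  exact mul_le_mul (h l) (norm_neumann_le hz0 hz1 h' _ _) (norm_nonneg _)
    ((norm_nonneg _).trans (h l))

/-- Dominated convergence for the nonlinearity; one summable derivative of the majorant `b`
suffices. -/
lemma tendsto_nlTerm {a : ι → (Fin d → ℤ) → ℂ} {a' : (Fin d → ℤ) → ℂ}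
    {b : (Fin d → ℤ) → ℝ} {z : ℝ} {M : ι → ℕ∞} (hz0 : 0 ≤ z) (hz1 : z < 1) (hb : Summable b)
    (hb1 : Summable fun k => freqNorm k * b k)
    (hab : ∀ᶠ α in F, ∀ k, ‖a α k‖ ≤ b k)
    (haz : ∀ᶠ α in F, moment 0 (eabs (a α)) ≤ ENNReal.ofReal z)
    (ha : ∀ k, Tendsto (fun α => a α k) F (𝓝 (a' k)))
    (hM : ∀ m : ℕ, ∀ᶠ α in F, (m : ℕ∞) < M α) (k : Fin d → ℤ) :
    Tendsto (fun α => nlTerm (M α) (a α) k) F (𝓝 (nlTerm ⊤ a' k)) :=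
  tendsto_finsetSum _ fun i _ => tendsto_finsetSum _ fun j _ =>
    (tendsto_gradProd hz0 hz1 hb hb1 hab haz ha hM i j k).const_mul _

end limit

/-! ### Finitely many modes -/

section finite

variable {s : Finset (Fin d → ℤ)}

lemma conv_eq_sum {a : (Fin d → ℤ) → ℂ} (ha : ∀ k ∉ s, a k = 0) (b : (Fin d → ℤ) → ℂ)
    (k : Fin d → ℤ) : conv a b k = ∑ l ∈ s, a l * b (k - l) :=
  tsum_eq_sum fun l hl => by rw [ha l hl, zero_mul]

lemma continuous_conv {X : Type*} [TopologicalSpace X] {x y : X → (Fin d → ℤ) → ℂ}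
    (hs : ∀ t, ∀ k ∉ s, x t k = 0) (hx : ∀ k, Continuous fun t => x t k)
    (hy : ∀ k, Continuous fun t => y t k) (k : Fin d → ℤ) :
    Continuous fun t => conv (x t) (y t) k := by
  simp only [conv_eq_sum (hs _)]
  exact continuous_finsetSum _ fun l _ => (hx l).mul (hy _)

lemma continuous_nlTerm {X : Type*} [TopologicalSpace X] {x : X → (Fin d → ℤ) → ℂ}
    (hs : ∀ t, ∀ k ∉ s, x t k = 0) (hx : ∀ k, Continuous fun t => x t k) (M : ℕ)
    (k : Fin d → ℤ) : Continuous fun t => nlTerm M (x t) k := by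
  have hpow : ∀ m k, Continuous fun t => convPow (x t) m k := by
    intro m
    induction m with
    | zero => exact fun k => continuous_const
    | succ m ih => exact continuous_conv hs hx ih
  have hneu : ∀ k, Continuous fun t => neumann M (x t) k := by
    intro k
    have : (fun t => neumann M (x t) k) =
        fun t => ∑ m ∈ Finset.range M, (-1) ^ m * convPow (x t) m k := by
      funext t
      rw [neumann, tsum_eq_sum (s := Finset.range M)]
      · refine Finset.sum_congr rfl fun m hm => ?_
        rw [if_pos (by exact_mod_cast Finset.mem_range.mp hm)]
      · intro m hm
        rw [if_neg]
        rw [Nat.cast_lt]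
        simpa using hm
    rw [this]
    exact continuous_finsetSum _ fun m _ => continuous_const.mul (hpow m k)
  have hds : ∀ i t, ∀ k ∉ s, dcoef i (x t) k = 0 := fun i t k hk => by simp [dcoef, hs t k hk]
  have hd : ∀ i k, Continuous fun t => dcoef i (x t) k := fun i k => continuous_const.mul (hx k)
  exact continuous_finsetSum _ fun i _ => continuous_finsetSum _ fun j _ => continuous_const.mul
    (continuous_conv (hds i) (hd i) (continuous_conv (hds j) (hd j) hneu) k)

end finite

/-! ### Hermitian symmetry -/

/-- The symmetry of the Fourier coefficients of a real-valued function. -/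
def IsHermitian (a : (Fin d → ℤ) → ℂ) : Prop := ∀ k, a (-k) = (starRingEnd ℂ) (a k)

lemma IsHermitian.conv {a b : (Fin d → ℤ) → ℂ} (ha : IsHermitian a) (hb : IsHermitian b) :
    IsHermitian (conv a b) := by
  intro k
  rw [DLSS.conv, DLSS.conv, Complex.conj_tsum, ← (Equiv.neg (Fin d → ℤ)).tsum_eq]
  refine tsum_congr fun l => ?_
  have h : -k - (Equiv.neg (Fin d → ℤ)) l = -(k - l) := by simp; abel
  rw [h, hb, Equiv.neg_apply, ha, map_mul]

lemma IsHermitian.dcoef {a : (Fin d → ℤ) → ℂ} (ha : IsHermitian a) (i : Fin d) :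
    IsHermitian (dcoef i a) := by
  intro k
  simp [DLSS.dcoef, ha k]

lemma IsHermitian.neumann {a : (Fin d → ℤ) → ℂ} (ha : IsHermitian a) (M : ℕ∞) :
    IsHermitian (neumann M a) := by
  have hpow : ∀ m, IsHermitian (convPow a m) := by
    intro m
    induction m with
    | zero => intro k; simp only [convPow, delta, neg_eq_zero]; split_ifs <;> simp
    | succ m ih => exact ha.conv ih
  intro k
  rw [DLSS.neumann, DLSS.neumann, Complex.conj_tsum]
  refine tsum_congr fun m => ?_
  split_ifs
  · rw [hpow m k]; simp
  · simp

lemma IsHermitian.gradProd {a : (Fin d → ℤ) → ℂ} (ha : IsHermitian a) (M : ℕ∞) (i j : Fin d) :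
    IsHermitian (gradProd (DLSS.neumann M a) a i j) :=
  (ha.dcoef i).conv ((ha.dcoef j).conv (ha.neumann M))

lemma IsHermitian.nlTerm {a : (Fin d → ℤ) → ℂ} (ha : IsHermitian a) (M : ℕ∞) :
    IsHermitian (nlTerm M a) := by
  intro k
  simp only [DLSS.nlTerm, map_sum, map_mul, ha.gradProd M _ _ k]
  simp

/-! ### The delayed problem -/

/-- The frequencies in the cube `[-n, n]^d`. -/
def box (d n : ℕ) : Finset (Fin d → ℤ) := Fintype.piFinset fun _ => Finset.Icc (-(n : ℤ)) n

/-- The time delay in the nonlinearity of the `n`-th approximation. -/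
def delay (n : ℕ) : ℝ := 1 / (n + 1)

/-- A continuous cutoff in time, which vanishes up to time `h` and is `1` after time `2h`. -/
def ramp (h s : ℝ) : ℝ := min 1 (max 0 ((s - h) / h))

/-- The forcing of the delayed problem: the nonlinearity at time `s - h`, restricted to the
modes in `box d n` and with `n` terms of the Neumann series. The factor `exp (-h (|k| + 1))` makes
up for the growth of the weights `exp ((σ |k| + lam) t)` with `σ, lam ≤ 1` over a time step. The
cutoff `ramp` makes the forcing continuous; it vanishes where `s - h` is negative. -/
def forcing (n : ℕ) (U : ℝ → (Fin d → ℤ) → ℂ) (s : ℝ) (k : Fin d → ℤ) : ℂ :=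
  if k ∈ box d n then
    -((Real.exp (-(delay n * (freqNorm k + 1))) * ramp (delay n) s : ℝ) : ℂ) *
      nlTerm n (U (max (s - delay n) 0)) k
  else 0

/-- Duhamel's formula for `y' = -|k|^4 y + f`, started at the `k`-th coefficient of `c`. -/
def duhamel (n : ℕ) (c : (Fin d → ℤ) → ℂ) (f : ℝ → (Fin d → ℤ) → ℂ) (t : ℝ)
    (k : Fin d → ℤ) : ℂ :=
  Real.exp (-(freqNorm k ^ 4 * t)) *
    ((if k ∈ box d n then c k else 0) +
      ∫ s in (0 : ℝ)..t, (Real.exp (freqNorm k ^ 4 * s) : ℂ) * f s k)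

/-- `U` solves the delayed problem on `[0, T]`, in Duhamel form, with initial coefficients `c`
restricted to `box d n`. -/
structure IsDelayed (n : ℕ) (c : (Fin d → ℤ) → ℂ) (T : ℝ) (U : ℝ → (Fin d → ℤ) → ℂ) : Prop where
  cont : ∀ k, Continuous fun t => U t k
  supp : ∀ t, ∀ k ∉ box d n, U t k = 0
  herm : ∀ t, IsHermitian (U t)
  eq : ∀ t ∈ Icc 0 T, U t = duhamel n c (forcing n U) t

lemma delay_pos (n : ℕ) : 0 < delay n := by unfold delay; positivity

lemma ramp_nonneg (h s : ℝ) : 0 ≤ ramp h s := le_min zero_le_one (le_max_left _ _)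

lemma ramp_le_one (h s : ℝ) : ramp h s ≤ 1 := min_le_left _ _

lemma ramp_eq_zero {h s : ℝ} (hh : 0 < h) (hs : s ≤ h) : ramp h s = 0 := by
  have : (s - h) / h ≤ 0 := div_nonpos_of_nonpos_of_nonneg (by linarith) hh.le
  rw [ramp, max_eq_left this, min_eq_right zero_le_one]

lemma continuous_ramp (h : ℝ) : Continuous (ramp h) := by unfold ramp; fun_prop

lemma neg_mem_box {n : ℕ} {k : Fin d → ℤ} : -k ∈ box d n ↔ k ∈ box d n := by
  simp only [box, Fintype.mem_piFinset, Finset.mem_Icc, Pi.neg_apply]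
  exact forall_congr' fun i => by omega

lemma continuous_forcing {n : ℕ} {U : ℝ → (Fin d → ℤ) → ℂ}
    (hc : ∀ k, Continuous fun t => U t k) (hs : ∀ t, ∀ k ∉ box d n, U t k = 0) (k : Fin d → ℤ) :
    Continuous fun s => forcing n U s k := by
  unfold forcing
  split_ifs
  · have h1 : Continuous fun s : ℝ => nlTerm n (U (max (s - delay n) 0)) k :=
      (continuous_nlTerm hs hc n k).comp (by fun_prop)
    have h2 := continuous_ramp (delay n)
    fun_prop
  · exact continuous_const

lemma forcing_herm {n : ℕ} {U : ℝ → (Fin d → ℤ) → ℂ} (hU : ∀ t, IsHermitian (U t)) (s : ℝ) :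
    IsHermitian (forcing n U s) := by
  intro k
  simp only [forcing, neg_mem_box, freqNorm_neg]
  split_ifs
  · rw [(hU _).nlTerm, map_mul, map_neg, Complex.conj_ofReal]
  · simp

lemma continuous_duhamel {n : ℕ} {c : (Fin d → ℤ) → ℂ} {f : ℝ → (Fin d → ℤ) → ℂ}
    (hf : ∀ k, Continuous fun s => f s k) (k : Fin d → ℤ) :
    Continuous fun t => duhamel n c f t k := by
  have h1 : Continuous fun s => (Real.exp (freqNorm k ^ 4 * s) : ℂ) * f s k := by
    have := hf k; fun_prop
  have h2 : Continuous fun t => ∫ s in (0 : ℝ)..t, (Real.exp (freqNorm k ^ 4 * s) : ℂ) * f s k :=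
    intervalIntegral.continuous_primitive (fun a b => h1.intervalIntegrable a b) 0
  unfold duhamel
  fun_prop

lemma duhamel_herm {n : ℕ} {c : (Fin d → ℤ) → ℂ} (hc : IsHermitian c)
    {f : ℝ → (Fin d → ℤ) → ℂ} (hf : ∀ s, IsHermitian (f s)) (t : ℝ) :
    IsHermitian (duhamel n c f t) := by
  intro k
  simp only [duhamel, neg_mem_box, freqNorm_neg, map_mul, map_add, Complex.conj_ofReal]
  congr 2
  · split_ifs
    · exact hc k
    · simp
  · simp only [intervalIntegral.intervalIntegral_eq_integral_uIoc, hf _ k]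
    rw [Complex.real_smul, Complex.real_smul, map_mul, ← integral_conj, Complex.conj_ofReal]
    simp only [map_mul, Complex.conj_ofReal]

/-- The delayed problem is solved explicitly, one delay after the other. -/
lemma exists_isDelayed_mul (n : ℕ) {c : (Fin d → ℤ) → ℂ} (hc : IsHermitian c) (j : ℕ) :
    ∃ U, IsDelayed n c (j * delay n) U := by
  have hsupp : ∀ (V : ℝ → (Fin d → ℤ) → ℂ) (t : ℝ), ∀ k ∉ box d n,
      duhamel n c (forcing n V) t k = 0 := by
    intro V t k hk
    simp [duhamel, forcing, hk]
  induction j with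
  | zero =>
    refine ⟨duhamel n c (forcing n 0), continuous_duhamel (continuous_forcing (fun _ =>
      continuous_const) fun _ _ _ => rfl), hsupp 0, fun t => duhamel_herm hc
      (forcing_herm fun t k => by simp) t, fun t ht => ?_⟩
    obtain rfl : t = 0 := by simpa using ht
    funext k
    simp [duhamel]
  | succ j ih =>
    obtain ⟨U, hU⟩ := ih
    have hfc := continuous_forcing hU.cont hU.supp
    refine ⟨duhamel n c (forcing n U), continuous_duhamel hfc, hsupp U,
      fun t => duhamel_herm hc (forcing_herm hU.herm) t, fun t ht => ?_⟩
    funext k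
    have hδ := delay_pos n
    simp only [duhamel]
    congr 2
    refine intervalIntegral.integral_congr fun s hs => ?_
    rw [uIcc_of_le ht.1] at hs
    have hs2 : max (s - delay n) 0 ∈ Icc 0 (j * delay n) := by
      refine ⟨le_max_right _ _, max_le ?_ (by positivity)⟩
      have := hs.2.trans ht.2
      push_cast at this
      linarith
    simp only [forcing, hU.eq _ hs2]

lemma exists_isDelayed (n : ℕ) {c : (Fin d → ℤ) → ℂ} (hc : IsHermitian c) (T : ℝ) :
    ∃ U, IsDelayed n c T U := by
  obtain ⟨j, hj⟩ := exists_nat_ge (T / delay n)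
  obtain ⟨U, hU⟩ := exists_isDelayed_mul n hc j
  refine ⟨U, hU.cont, hU.supp, hU.herm, fun t ht => hU.eq t ⟨ht.1, ht.2.trans ?_⟩⟩
  rwa [div_le_iff₀ (delay_pos n)] at hj

/-- If `f` vanishes up to time `h` and is then bounded by `C` plus a value of `Y` at an earlier
time, its integral is controlled by that of `Y`. -/
lemma integral_delay_le {f Y : ℝ → ℝ} (hf : Continuous f) (hY : Continuous Y) (hY0 : ∀ r, 0 ≤ Y r)
    {h C s t : ℝ} (hC : 0 ≤ C) (hs : 0 ≤ s) (hst : s ≤ t) (hf0 : ∀ r ≤ h, f r = 0) (hh : 0 ≤ h)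
    (hfY : ∀ r ∈ Icc h t, f r ≤ C + Y (r - h)) :
    ∫ r in s..t, f r ≤ C * (t - s) + ∫ r in (0 : ℝ)..t, Y r := by
  have hint : ∀ a b, a ≤ b → b ≤ h → ∫ r in a..b, f r = 0 := fun a b hab hbh => by
    rw [intervalIntegral.integral_congr (g := fun _ => 0) fun r hr => by
      rw [uIcc_of_le hab] at hr
      exact hf0 r (hr.2.trans hbh)]
    simp
  have hpos : 0 ≤ ∫ r in (0 : ℝ)..t, Y r :=
    intervalIntegral.integral_nonneg (hs.trans hst) fun r _ => hY0 r
  rcases le_total t h with hth | hth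
  · rw [hint s t hst hth]
    have := mul_nonneg hC (sub_nonneg.mpr hst)
    linarith
  · have hm1 : s ≤ max s h := le_max_left _ _
    have hm2 : h ≤ max s h := le_max_right _ _
    have hm3 : max s h ≤ t := max_le hst hth
    have hfirst : ∫ r in s..(max s h), f r = 0 := by
      rcases le_total s h with hsh | hsh
      · exact hint _ _ hm1 (by rw [max_eq_right hsh])
      · rw [max_eq_left hsh, intervalIntegral.integral_same]
    rw [← intervalIntegral.integral_add_adjacent_intervals (hf.intervalIntegrable s (max s h))
      (hf.intervalIntegrable (max s h) t), hfirst, zero_add]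
    have hYs : Continuous fun r => Y (r - h) := by fun_prop
    calc ∫ r in (max s h)..t, f r ≤ ∫ r in (max s h)..t, (C + Y (r - h)) :=
          intervalIntegral.integral_mono_on hm3 (hf.intervalIntegrable _ _)
            ((continuous_const.add hYs).intervalIntegrable _ _)
            fun r hr => hfY r ⟨hm2.trans hr.1, hr.2⟩
      _ = C * (t - max s h) + ∫ r in (max s h - h)..(t - h), Y r := by
          rw [intervalIntegral.integral_add (continuous_const.intervalIntegrable _ _)
            (hYs.intervalIntegrable _ _), intervalIntegral.integral_comp_sub_right,
            intervalIntegral.integral_const, smul_eq_mul, mul_comm]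
      _ ≤ _ := by
          gcongr
          exact intervalIntegral.integral_mono_interval (by linarith) (by linarith) (by linarith)
            (ae_of_all _ hY0) (hY.intervalIntegrable _ _)

/-- Weighted energy inequality for a single mode. The weighted mode is dominated by the solution
`z` of `z' = -(κ - w) z + exp (w s) ‖f s‖`, for which it is an identity. -/
lemma duhamel_mode_le {κ w : ℝ} {c : ℂ} {f y : ℝ → ℂ} (hf : Continuous f) (hy : Continuous y)
    (hw : w ≤ κ) {t : ℝ} (ht : 0 ≤ t)
    (heq : ∀ s ∈ Icc 0 t, y s =
      Real.exp (-(κ * s)) * (c + ∫ r in (0 : ℝ)..s, (Real.exp (κ * r) : ℂ) * f r)) :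
    Real.exp (w * t) * ‖y t‖ + (κ - w) * ∫ s in (0 : ℝ)..t, Real.exp (w * s) * ‖y s‖ ≤
      ‖c‖ + ∫ s in (0 : ℝ)..t, Real.exp (w * s) * ‖f s‖ := by
  set g : ℝ → ℝ := fun s => ‖c‖ + ∫ r in (0 : ℝ)..s, Real.exp (κ * r) * ‖f r‖ with hg
  set z : ℝ → ℝ := fun s => Real.exp (-((κ - w) * s)) * g s with hz
  have hint : Continuous fun r => Real.exp (κ * r) * ‖f r‖ := by fun_prop
  have hgd : ∀ s, HasDerivAt g (Real.exp (κ * s) * ‖f s‖) s := fun s =>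
    (intervalIntegral.integral_hasDerivAt_right (hint.intervalIntegrable _ _)
      (hint.stronglyMeasurableAtFilter _ _) hint.continuousAt).const_add _
  have hgc : Continuous g := continuous_iff_continuousAt.mpr fun s => (hgd s).continuousAt
  have hzc : Continuous z := by fun_prop
  have hyz : ∀ s ∈ Icc 0 t, Real.exp (w * s) * ‖y s‖ ≤ z s := by
    intro s hs
    have h1 : ‖y s‖ ≤ Real.exp (-(κ * s)) * g s := by
      rw [heq s hs, norm_mul, Complex.norm_real, Real.norm_of_nonneg (Real.exp_pos _).le]
      gcongr
      refine (norm_add_le _ _).trans (add_le_add le_rfl ?_)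
      refine (intervalIntegral.norm_integral_le_integral_norm hs.1).trans (le_of_eq ?_)
      refine intervalIntegral.integral_congr fun r _ => ?_
      simp only [norm_mul, Complex.norm_real, Real.norm_of_nonneg (Real.exp_pos _).le]
    calc Real.exp (w * s) * ‖y s‖ ≤ Real.exp (w * s) * (Real.exp (-(κ * s)) * g s) := by gcongr
      _ = z s := by
        rw [hz, ← mul_assoc, ← Real.exp_add]
        congr 2; ring
  have hzd : ∀ s, HasDerivAt z (-(κ - w) * z s + Real.exp (w * s) * ‖f s‖) s := by
    intro s
    have h1 : HasDerivAt (fun s => Real.exp (-((κ - w) * s)))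
        (Real.exp (-((κ - w) * s)) * -((κ - w) * 1)) s :=
      (((hasDerivAt_id s).const_mul (κ - w)).neg).exp
    refine (h1.mul (hgd s)).congr_deriv ?_
    have : Real.exp (w * s) = Real.exp (-((κ - w) * s)) * Real.exp (κ * s) := by
      rw [← Real.exp_add]; congr 1; ring
    rw [this, hz]
    ring
  have hexpf : Continuous fun s => Real.exp (w * s) * ‖f s‖ := by fun_prop
  have hexpy : Continuous fun s => Real.exp (w * s) * ‖y s‖ := by fun_prop
  have hftc := intervalIntegral.integral_eq_sub_of_hasDerivAt (a := 0) (b := t) (fun s _ => hzd s)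
    (Continuous.intervalIntegrable
      (by fun_prop : Continuous fun s => -(κ - w) * z s + Real.exp (w * s) * ‖f s‖) _ _)
  rw [intervalIntegral.integral_add ((hzc.const_mul _).intervalIntegrable _ _)
    (hexpf.intervalIntegrable _ _), intervalIntegral.integral_const_mul] at hftc
  have hz0 : z 0 = ‖c‖ := by simp [hz, hg]
  have hI : ∫ s in (0 : ℝ)..t, Real.exp (w * s) * ‖y s‖ ≤ ∫ s in (0 : ℝ)..t, z s :=
    intervalIntegral.integral_mono_on ht (hexpy.intervalIntegrable _ _)
      (hzc.intervalIntegrable _ _) hyz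
  have hzt := hyz t ⟨ht, le_rfl⟩
  have := mul_le_mul_of_nonneg_left hI (sub_nonneg.mpr hw)
  rw [hz0] at hftc
  linarith

lemma moment_weight_eq {s : Finset (Fin d → ℤ)} {x : (Fin d → ℤ) → ℂ}
    (hx : ∀ k ∉ s, x k = 0) (j : ℕ) {w : (Fin d → ℤ) → ℝ} (hw : ∀ k, 0 ≤ w k) :
    moment j (fun k => ENNReal.ofReal (w k) * eabs x k) =
      ENNReal.ofReal (∑ k ∈ s, freqNorm k ^ j * (w k * ‖x k‖)) := by
  rw [moment, tsum_eq_sum (s := s), ENNReal.ofReal_sum_of_nonneg]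
  · refine Finset.sum_congr rfl fun k _ => ?_
    rw [ENNReal.ofReal_mul (pow_nonneg (freqNorm_nonneg k) _), ENNReal.ofReal_mul (hw k),
      ENNReal.ofReal_pow (freqNorm_nonneg k), ofReal_norm]
    rfl
  · intro k _
    have := hw k
    have := freqNorm_nonneg k
    positivity
  · intro k hk
    simp [eabs, hx k hk]

lemma P1_nonneg {z : ℝ} (h0 : 0 ≤ z) (h1 : z < 1) : 0 ≤ P1 z := by
  have : 0 < 1 - z := by linarith
  unfold P1
  positivity

/-- Data of the smallness condition: `Z` bounds `∑ |c k|`, the mean vanishes, and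
`d² P₁(Z) < 1`. -/
structure IsSmallData (c : (Fin d → ℤ) → ℂ) (Z : ℝ) : Prop where
  nonneg : 0 ≤ Z
  lt_one : Z < 1
  moment_le : moment 0 (eabs c) ≤ ENNReal.ofReal Z
  mean : c 0 = 0
  small : (d : ℝ) ^ 2 * P1 Z < 1

lemma IsSmallData.q_nonneg {c : (Fin d → ℤ) → ℂ} {Z : ℝ} (h : IsSmallData c Z) :
    0 ≤ (d : ℝ) ^ 2 * P1 Z := mul_nonneg (by positivity) (P1_nonneg h.nonneg h.lt_one)

section apriori

variable {n : ℕ} {c : (Fin d → ℤ) → ℂ} {Z T : ℝ} {U : ℝ → (Fin d → ℤ) → ℂ}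

lemma IsDelayed.zero_freq (hU : IsDelayed n c T U) (hc : c 0 = 0) {t : ℝ} (ht : t ∈ Icc 0 T) :
    U t 0 = 0 := by
  rw [hU.eq t ht]
  simp [duhamel, forcing, nlTerm_zero_freq, hc]

/-- The weight `exp ((σ |k| + lam) t)`. -/
def expWeight (σ lam t : ℝ) (k : Fin d → ℤ) : ℝ := Real.exp ((σ * freqNorm k + lam) * t)

/-- The forcing at time `s` in the norm with weight is controlled by the fourth moment at time
`s - h`, provided that the bound by `Z` is already known at that time. -/
lemma sum_forcing_le (hZ : IsSmallData c Z)
    (hsupp : ∀ t, ∀ k ∉ box d n, U t k = 0) {σ lam : ℝ} (hσ : 0 ≤ σ) (hlam : 0 ≤ lam)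
    (hsum : σ + lam ≤ 1) {s : ℝ} (hs : delay n ≤ s)
    (hV : ∑ k ∈ box d n, expWeight σ lam (s - delay n) k * ‖U (s - delay n) k‖ ≤ Z) :
    ∑ k ∈ box d n, expWeight σ lam s k * ‖forcing n U s k‖ ≤ (d : ℝ) ^ 2 * P1 Z *
      ∑ k ∈ box d n, freqNorm k ^ 4 * (expWeight σ lam (s - delay n) k * ‖U (s - delay n) k‖) := by
  have hδ := delay_pos n
  set r := s - delay n with hr
  have hr0 : 0 ≤ r := by linarith
  have hsr : s = r + delay n := by rw [hr]; ring
  set W : (Fin d → ℤ) → ℝ≥0∞ := fun k => ENNReal.ofReal (Real.exp (σ * freqNorm k * r)) with hW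
  set Λ : ℝ≥0∞ := ENNReal.ofReal (Real.exp (lam * r)) with hΛ
  have hΛW : ∀ k, Λ * W k = ENNReal.ofReal (expWeight σ lam r k) := fun k => by
    rw [hΛ, hW, ← ENNReal.ofReal_mul (Real.exp_pos _).le, ← Real.exp_add, expWeight]
    congr 2; ring
  have hmom : ∀ j, moment j (fun k => Λ * W k * eabs (U r) k) =
      ENNReal.ofReal (∑ k ∈ box d n, freqNorm k ^ j * (expWeight σ lam r k * ‖U r k‖)) := by
    intro j
    simp only [hΛW]
    exact moment_weight_eq (hsupp r) j fun k => (Real.exp_pos _).le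
  have key := tsum_weight_nlTerm_le (W := W) (by simp [hW, freqNorm_zero]) (fun k l => by
    simp only [hW]
    rw [← ENNReal.ofReal_mul (Real.exp_pos _).le, ← Real.exp_add]
    refine ENNReal.ofReal_le_ofReal (Real.exp_le_exp.mpr ?_)
    have := mul_le_mul_of_nonneg_left (freqNorm_add_le k l) (mul_nonneg hσ hr0)
    nlinarith) (Λ := Λ) (by
      rw [hΛ, ← ENNReal.ofReal_one]
      exact ENNReal.ofReal_le_ofReal (Real.one_le_exp (by positivity))) n (U r) hZ.nonneg hZ.lt_one
      (by rw [hmom]; exact ENNReal.ofReal_le_ofReal (by simpa using hV))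
  rw [hmom, ← ENNReal.ofReal_mul hZ.q_nonneg] at key
  have hY : 0 ≤ ∑ k ∈ box d n, freqNorm k ^ 4 * (expWeight σ lam r k * ‖U r k‖) :=
    Finset.sum_nonneg fun k _ => by
      have := freqNorm_nonneg k
      have : 0 < expWeight σ lam r k := Real.exp_pos _
      positivity
  -- the weight grows over one delay by no more than the damping factor of the forcing
  have hpt : ∀ k ∈ box d n, expWeight σ lam s k * ‖forcing n U s k‖ ≤
      expWeight σ lam r k * ‖nlTerm n (U r) k‖ := by
    intro k hk
    have hfk := freqNorm_nonneg k
    rw [forcing, if_pos hk, ← hr, max_eq_left hr0, norm_mul, norm_neg, Complex.norm_real,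
      Real.norm_of_nonneg (mul_nonneg (Real.exp_pos _).le (ramp_nonneg _ _)), ← mul_assoc]
    gcongr
    calc expWeight σ lam s k * (Real.exp (-(delay n * (freqNorm k + 1))) * ramp (delay n) s)
        ≤ expWeight σ lam s k * (Real.exp (-(delay n * (freqNorm k + 1))) * 1) := by
          have : 0 < expWeight σ lam s k := Real.exp_pos _
          gcongr
          exact ramp_le_one _ _
      _ ≤ expWeight σ lam r k := by
          rw [mul_one, expWeight, expWeight, ← Real.exp_add, hsr]
          refine Real.exp_le_exp.mpr ?_
          have h1 : σ * freqNorm k + lam ≤ freqNorm k + 1 := by nlinarith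
          have := mul_le_mul_of_nonneg_left h1 hδ.le
          nlinarith
  refine (Finset.sum_le_sum hpt).trans ?_
  rw [← ENNReal.ofReal_le_ofReal_iff (mul_nonneg hZ.q_nonneg hY)]
  refine le_trans ?_ key
  rw [ENNReal.ofReal_sum_of_nonneg (by intro k _; unfold expWeight; positivity)]
  refine le_trans (le_of_eq ?_) (ENNReal.sum_le_tsum (box d n))
  refine Finset.sum_congr rfl fun k _ => ?_
  rw [ENNReal.ofReal_mul (by unfold expWeight; positivity), ← hΛW, ofReal_norm]

/-- The a priori estimate. Over a time span of one delay the forcing is controlled by earlier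
times, so that the bound `Z` propagates without a continuity argument. -/
lemma IsDelayed.apriori (hU : IsDelayed n c T U) (hZ : IsSmallData c Z) {σ lam : ℝ} (hσ : 0 ≤ σ)
    (hlam : 0 ≤ lam) (hsum : σ + lam ≤ 1 - (d : ℝ) ^ 2 * P1 Z) {t : ℝ} (ht : t ∈ Icc 0 T) :
    (∑ k ∈ box d n, expWeight σ lam t k * ‖U t k‖) +
      (1 - σ - lam - (d : ℝ) ^ 2 * P1 Z) *
        ∫ s in (0 : ℝ)..t, ∑ k ∈ box d n, freqNorm k ^ 4 * (expWeight σ lam s k * ‖U s k‖) ≤ Z := by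
  set q := (d : ℝ) ^ 2 * P1 Z with hq
  have hq0 : 0 ≤ q := hZ.q_nonneg
  have hδ := delay_pos n
  set Y : ℝ → ℝ := fun s => ∑ k ∈ box d n, freqNorm k ^ 4 * (expWeight σ lam s k * ‖U s k‖) with hY
  have hY0 : ∀ s, 0 ≤ Y s := fun s => Finset.sum_nonneg fun k _ => by
    have := freqNorm_nonneg k
    have : 0 < expWeight σ lam s k := Real.exp_pos _
    positivity
  have hmodec : ∀ k, Continuous fun s => expWeight σ lam s k * ‖U s k‖ := fun k => by
    have := hU.cont k
    unfold expWeight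
    fun_prop
  have hYc : Continuous Y := continuous_finsetSum _ fun k _ => continuous_const.mul (hmodec k)
  have hfc := continuous_forcing hU.cont hU.supp
  suffices H : ∀ i : ℕ, ∀ t ∈ Icc 0 T, t ≤ i * delay n →
      (∑ k ∈ box d n, expWeight σ lam t k * ‖U t k‖) + (1 - σ - lam - q) * ∫ s in (0 : ℝ)..t, Y s
        ≤ Z by
    obtain ⟨i, hi⟩ := exists_nat_ge (t / delay n)
    exact H i t ht (by rwa [div_le_iff₀ hδ] at hi)
  intro i
  -- the mode-by-mode inequality, summed over the box
  have hmodes : ∀ t ∈ Icc 0 T, (∑ k ∈ box d n, expWeight σ lam t k * ‖U t k‖) +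
      (1 - σ - lam) * ∫ s in (0 : ℝ)..t, Y s ≤
        Z + ∫ s in (0 : ℝ)..t, ∑ k ∈ box d n, expWeight σ lam s k * ‖forcing n U s k‖ := by
    intro t ht
    have hcsum : ∑ k ∈ box d n, ‖c k‖ ≤ Z := by
      rw [← ENNReal.ofReal_le_ofReal_iff hZ.nonneg]
      refine le_trans ?_ hZ.moment_le
      rw [ENNReal.ofReal_sum_of_nonneg fun k _ => norm_nonneg _]
      refine le_trans (le_of_eq ?_) (ENNReal.sum_le_tsum (box d n))
      exact Finset.sum_congr rfl fun k _ => by rw [ofReal_norm, pow_zero, one_mul]; rfl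
    have hfcc : ∀ k, Continuous fun s => expWeight σ lam s k * ‖forcing n U s k‖ := fun k => by
      have := hfc k
      unfold expWeight
      fun_prop
    have hYI : ∫ s in (0 : ℝ)..t, Y s = ∑ k ∈ box d n,
        ∫ s in (0 : ℝ)..t, freqNorm k ^ 4 * (expWeight σ lam s k * ‖U s k‖) :=
      intervalIntegral.integral_finsetSum fun k _ =>
        (continuous_const.mul (hmodec k)).intervalIntegrable _ _
    rw [hYI, intervalIntegral.integral_finsetSum fun k _ => (hfcc k).intervalIntegrable _ _,
      Finset.mul_sum, ← Finset.sum_add_distrib]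
    refine le_trans ?_ (add_le_add_left hcsum _)
    rw [← Finset.sum_add_distrib]
    refine Finset.sum_le_sum fun k hk => ?_
    rcases eq_or_ne k 0 with rfl | hk0
    · have h0 : U t 0 = 0 := hU.zero_freq hZ.mean ht
      have hint : 0 ≤ ∫ s in (0 : ℝ)..t, expWeight σ lam s (0 : Fin d → ℤ) * ‖forcing n U s 0‖ :=
        intervalIntegral.integral_nonneg ht.1 fun s _ => mul_nonneg (Real.exp_pos _).le
          (norm_nonneg _)
      simp only [h0, freqNorm_zero, norm_zero, mul_zero, zero_add, zero_mul, ne_eq,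
        OfNat.ofNat_ne_zero, not_false_eq_true, zero_pow, intervalIntegral.integral_zero]
      exact add_nonneg (norm_nonneg _) hint
    · -- the growth rate of the weight is absorbed by the dissipation, as `1 ≤ |k|`
      have h1 := one_le_freqNorm hk0
      have h2 : freqNorm k ≤ freqNorm k ^ 4 := le_self_pow₀ h1 (by norm_num)
      have hw : σ * freqNorm k + lam ≤ (σ + lam) * freqNorm k ^ 4 := by nlinarith
      have h3 : (σ + lam) * freqNorm k ^ 4 ≤ 1 * freqNorm k ^ 4 := by
        gcongr; linarith
      have hm := duhamel_mode_le (w := σ * freqNorm k + lam) (κ := freqNorm k ^ 4) (c := c k)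
        (f := fun s => forcing n U s k) (y := fun s => U s k) (hfc k) (hU.cont k)
        (by linarith) ht.1 (fun s hs => by
          rw [hU.eq s ⟨hs.1, hs.2.trans ht.2⟩, duhamel, if_pos hk])
      refine le_trans ?_ hm
      rw [intervalIntegral.integral_const_mul]
      have hI : 0 ≤ ∫ s in (0 : ℝ)..t, expWeight σ lam s k * ‖U s k‖ :=
        intervalIntegral.integral_nonneg ht.1 fun s _ => mul_nonneg (Real.exp_pos _).le
          (norm_nonneg _)
      refine add_le_add le_rfl ?_
      rw [← mul_assoc]
      exact mul_le_mul_of_nonneg_right (by linarith) hI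
  induction i with
  | zero =>
    intro t ht hti
    obtain rfl : t = 0 := le_antisymm (by simpa using hti) ht.1
    simpa using hmodes 0 ht
  | succ i ih =>
    intro t ht hti
    push_cast at hti
    have hm := hmodes t ht
    set f : ℝ → ℝ := fun s => ∑ k ∈ box d n, expWeight σ lam s k * ‖forcing n U s k‖ with hf
    have hfc' : Continuous f := continuous_finsetSum _ fun k _ => by
      have := hfc k
      unfold expWeight
      fun_prop
    have hf0 : ∀ s ≤ delay n, f s = 0 := fun s hs => Finset.sum_eq_zero fun k _ => by
      simp [forcing, ramp_eq_zero hδ hs]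
    have hfY : ∀ s ∈ Icc (delay n) t, f s ≤ q * Y (s - delay n) := by
      intro s hs
      refine sum_forcing_le hZ hU.supp hσ hlam (by linarith) hs.1 ?_
      have hmem : s - delay n ∈ Icc 0 T := ⟨by linarith [hs.1], by linarith [hs.2, ht.2]⟩
      have := ih (s - delay n) hmem (by linarith [hs.2])
      have hnn : 0 ≤ (1 - σ - lam - q) * ∫ s in (0 : ℝ)..(s - delay n), Y s :=
        mul_nonneg (by linarith) (intervalIntegral.integral_nonneg hmem.1 fun s _ => hY0 s)
      linarith
    have hint := integral_delay_le (h := delay n) hfc' (hYc.const_mul q)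
      (fun r => mul_nonneg hq0 (hY0 r)) le_rfl le_rfl ht.1 hf0 hδ.le
      (fun r hr => (hfY r hr).trans (by simp))
    rw [zero_mul, zero_add, intervalIntegral.integral_const_mul] at hint
    linarith

end apriori

/-! ### Summability over the lattice -/

lemma tsum_prod_eq_pow (f : ℤ → ℝ≥0∞) (d : ℕ) :
    ∑' k : Fin d → ℤ, ∏ i, f (k i) = (∑' m, f m) ^ d := by
  induction d with
  | zero => simp
  | succ d ih =>
    rw [← (Fin.consEquiv fun _ => ℤ).tsum_eq, ENNReal.tsum_prod', pow_succ', ← ih,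
      ← ENNReal.tsum_mul_right]
    refine tsum_congr fun m => ?_
    rw [← ENNReal.tsum_mul_left]
    refine tsum_congr fun k => ?_
    simp [Fin.consEquiv, Fin.prod_univ_succ]

lemma summable_exp_neg_int {c : ℝ} (hc : 0 < c) :
    Summable fun m : ℤ => Real.exp (-(c * |(m : ℝ)|)) := by
  have h : Summable fun m : ℕ => Real.exp (-(c * |((m : ℤ) : ℝ)|)) := by
    refine (Real.summable_exp_nat_mul_iff.mpr (neg_lt_zero.mpr hc)).congr fun m => ?_
    simp [mul_comm]
  exact Summable.of_nat_of_neg h (by simpa using h)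

lemma summable_exp_neg_freqNorm {c : ℝ} (hc : 0 < c) :
    Summable fun k : Fin d → ℤ => Real.exp (-(c * freqNorm k)) := by
  have hd : (0 : ℝ) < d + 1 := by positivity
  have hs := summable_exp_neg_int (div_pos hc hd)
  have hfin : ∑' k : Fin d → ℤ, ENNReal.ofReal (Real.exp (-(c * freqNorm k))) ≠ ⊤ := by
    refine ne_top_of_le_ne_top ?_ (ENNReal.tsum_le_tsum (g := fun k : Fin d → ℤ =>
      ∏ i, ENNReal.ofReal (Real.exp (-(c / (d + 1) * |(k i : ℝ)|)))) fun k => ?_)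
    · rw [tsum_prod_eq_pow fun m => ENNReal.ofReal (Real.exp (-(c / (d + 1) * |(m : ℝ)|)))]
      refine ENNReal.pow_ne_top ?_
      rw [← ENNReal.ofReal_tsum_of_nonneg (fun _ => (Real.exp_pos _).le) hs]
      exact ENNReal.ofReal_ne_top
    · rw [← ENNReal.ofReal_prod_of_nonneg fun _ _ => (Real.exp_pos _).le, ← Real.exp_sum]
      refine ENNReal.ofReal_le_ofReal (Real.exp_le_exp.mpr ?_)
      rw [Finset.sum_neg_distrib, neg_le_neg_iff, ← Finset.mul_sum]
      have h1 : ∑ i, |(k i : ℝ)| ≤ (d + 1) * freqNorm k := by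
        refine (Finset.sum_le_card_nsmul _ _ _ fun i _ => abs_le_freqNorm k i).trans ?_
        rw [Finset.card_univ, Fintype.card_fin, nsmul_eq_mul]
        have := freqNorm_nonneg k
        gcongr
        linarith
      calc c / (d + 1) * ∑ i, |(k i : ℝ)| ≤ c / (d + 1) * ((d + 1) * freqNorm k) := by gcongr
        _ = c * freqNorm k := by field_simp
  exact (ENNReal.summable_toReal hfin).congr fun k => ENNReal.toReal_ofReal (Real.exp_pos _).le

lemma mul_exp_neg_le {c : ℝ} (hc : 0 < c) (x : ℝ) :
    x * Real.exp (-(c * x)) ≤ 2 / c * Real.exp (-(c / 2 * x)) := by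
  have h1 : c / 2 * x ≤ Real.exp (c / 2 * x) := by
    have := Real.add_one_le_exp (c / 2 * x); linarith
  have h2 : Real.exp (-(c * x)) = Real.exp (-(c / 2 * x)) * Real.exp (-(c / 2 * x)) := by
    rw [← Real.exp_add]; congr 1; ring
  have h3 : Real.exp (c / 2 * x) * Real.exp (-(c / 2 * x)) = 1 := by
    rw [← Real.exp_add]; simp
  have h4 : c / 2 * x * Real.exp (-(c / 2 * x)) ≤ 1 := by
    rw [← h3]; gcongr
  calc x * Real.exp (-(c * x))
      = 2 / c * ((c / 2 * x * Real.exp (-(c / 2 * x))) * Real.exp (-(c / 2 * x))) := by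
        rw [h2]; field_simp
    _ ≤ 2 / c * (1 * Real.exp (-(c / 2 * x))) := by gcongr
    _ = _ := by ring

lemma summable_freqNorm_mul_exp {c : ℝ} (hc : 0 < c) :
    Summable fun k : Fin d → ℤ => freqNorm k * Real.exp (-(c * freqNorm k)) :=
  Summable.of_nonneg_of_le (fun k => mul_nonneg (freqNorm_nonneg k) (Real.exp_pos _).le)
    (fun k => mul_exp_neg_le hc (freqNorm k))
    ((summable_exp_neg_freqNorm (half_pos hc)).mul_left (2 / c))

/-! ### Equicontinuity of the delayed solutions -/

section equicontinuity

variable {n : ℕ} {c : (Fin d → ℤ) → ℂ} {Z T : ℝ} {U : ℝ → (Fin d → ℤ) → ℂ}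

lemma IsDelayed.sub_eq (hU : IsDelayed n c T U) {s t : ℝ} (hs : s ∈ Icc 0 T) (ht : t ∈ Icc 0 T)
    (k : Fin d → ℤ) :
    U t k - U s k = ∫ r in s..t, (-(freqNorm k ^ 4 : ℝ) * U r k + forcing n U r k) := by
  have hfc := continuous_forcing hU.cont hU.supp k
  have hint : Continuous fun s => (Real.exp (freqNorm k ^ 4 * s) : ℂ) * forcing n U s k := by
    fun_prop
  have hD : ∀ r, HasDerivAt (fun t => duhamel n c (forcing n U) t k)
      (-(freqNorm k ^ 4 : ℝ) * duhamel n c (forcing n U) r k + forcing n U r k) r := by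
    intro r
    have h1 : HasDerivAt (fun t : ℝ => (Real.exp (-(freqNorm k ^ 4 * t)) : ℂ))
        ((Real.exp (-(freqNorm k ^ 4 * r)) * -(freqNorm k ^ 4 * 1) : ℝ) : ℂ) r :=
      (((hasDerivAt_id r).const_mul (freqNorm k ^ 4)).neg.exp).ofReal_comp
    have h2 : HasDerivAt (fun t => ∫ s in (0 : ℝ)..t,
        (Real.exp (freqNorm k ^ 4 * s) : ℂ) * forcing n U s k)
        ((Real.exp (freqNorm k ^ 4 * r) : ℂ) * forcing n U r k) r :=
      intervalIntegral.integral_hasDerivAt_right (hint.intervalIntegrable _ _)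
        (hint.stronglyMeasurableAtFilter _ _) hint.continuousAt
    refine (h1.mul (h2.const_add (if k ∈ box d n then c k else 0))).congr_deriv ?_
    have h3 : (Real.exp (-(freqNorm k ^ 4 * r)) : ℂ) * Real.exp (freqNorm k ^ 4 * r) = 1 := by
      rw [← Complex.ofReal_mul, ← Real.exp_add]; simp
    rw [← mul_assoc, h3, duhamel]
    push_cast
    ring
  have hDc : Continuous fun t => duhamel n c (forcing n U) t k :=
    continuous_duhamel (continuous_forcing hU.cont hU.supp) k
  have := intervalIntegral.integral_eq_sub_of_hasDerivAt (a := s) (b := t) (fun r _ => hD r)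
    ((by fun_prop : Continuous fun r => -(freqNorm k ^ 4 : ℝ) * duhamel n c (forcing n U) r k +
      forcing n U r k).intervalIntegrable _ _)
  rw [hU.eq t ht, hU.eq s hs, ← this]
  refine intervalIntegral.integral_congr fun r hr => ?_
  have hr' : r ∈ Icc 0 T := ⟨(le_min hs.1 ht.1).trans hr.1, hr.2.trans (max_le hs.2 ht.2)⟩
  simp only [hU.eq r hr']

lemma IsDelayed.sum_le (hU : IsDelayed n c T U) (hZ : IsSmallData c Z) {σ lam : ℝ} (hσ : 0 ≤ σ)
    (hlam : 0 ≤ lam) (hsum : σ + lam ≤ 1 - (d : ℝ) ^ 2 * P1 Z) {t : ℝ} (ht : t ∈ Icc 0 T) :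
    ∑ k ∈ box d n, expWeight σ lam t k * ‖U t k‖ ≤ Z := by
  refine le_trans ?_ (hU.apriori hZ hσ hlam hsum ht)
  refine le_add_of_nonneg_right (mul_nonneg (by linarith) ?_)
  refine intervalIntegral.integral_nonneg ht.1 fun s _ => Finset.sum_nonneg fun k _ => ?_
  have := freqNorm_nonneg k
  unfold expWeight
  positivity

lemma IsDelayed.sum_norm_le (hU : IsDelayed n c T U) (hZ : IsSmallData c Z)
    {t : ℝ} (ht : t ∈ Icc 0 T) : ∑ k ∈ box d n, ‖U t k‖ ≤ Z := by
  have := hU.sum_le hZ le_rfl le_rfl (by linarith [hZ.small]) ht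
  simpa [expWeight] using this

lemma IsDelayed.integral_le (hU : IsDelayed n c T U) (hZ : IsSmallData c Z)
    {t : ℝ} (ht : t ∈ Icc 0 T) :
    ∫ s in (0 : ℝ)..t, ∑ k ∈ box d n, freqNorm k ^ 4 * ‖U s k‖ ≤
      Z / (1 - (d : ℝ) ^ 2 * P1 Z) := by
  have h1 : 0 < 1 - (d : ℝ) ^ 2 * P1 Z := by linarith [hZ.small]
  have := hU.apriori hZ le_rfl le_rfl (by linarith) ht
  simp only [expWeight, zero_mul, add_zero, Real.exp_zero, one_mul, sub_zero] at this
  rw [le_div_iff₀ h1, mul_comm]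
  have h2 : 0 ≤ ∑ k ∈ box d n, ‖U t k‖ := Finset.sum_nonneg fun k _ => norm_nonneg _
  linarith

lemma norm_nlTerm_le_sum {s : Finset (Fin d → ℤ)} (M : ℕ∞) {x : (Fin d → ℤ) → ℂ}
    (hx : ∀ k ∉ s, x k = 0) {z : ℝ} (hz0 : 0 ≤ z) (hz1 : z < 1) (hz : ∑ k ∈ s, ‖x k‖ ≤ z)
    (k : Fin d → ℤ) :
    ‖nlTerm M x k‖ ≤ (d : ℝ) ^ 2 * freqNorm k ^ 2 * (1 / (1 - z)) *
      (∑ k ∈ s, freqNorm k * ‖x k‖) ^ 2 := by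
  have h1z : 0 < 1 - z := by linarith
  have hm := fun j => moment_weight_eq hx j (w := fun _ => 1) fun _ => zero_le_one
  simp only [ENNReal.ofReal_one, one_mul] at hm
  have h0 : moment 0 (eabs x) ≤ ENNReal.ofReal z := by
    rw [show eabs x = fun k => eabs x k from rfl, hm 0]
    exact ENNReal.ofReal_le_ofReal (by simpa using hz)
  have h1 : moment 1 (eabs x) = ENNReal.ofReal (∑ k ∈ s, freqNorm k * ‖x k‖) := by
    simpa using hm 1
  have hsum : 0 ≤ ∑ k ∈ s, freqNorm k * ‖x k‖ :=
    Finset.sum_nonneg fun k _ => mul_nonneg (freqNorm_nonneg k) (norm_nonneg _)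
  have hk := freqNorm_nonneg k
  refine norm_le_of_enorm_le (by positivity) ((enorm_nlTerm_le_moment M x hz0 hz1 h0 k).trans ?_)
  rw [h1, efreq, ← ENNReal.ofReal_natCast, ← ENNReal.ofReal_pow (by positivity),
    ← ENNReal.ofReal_pow hk, ← ENNReal.ofReal_pow hsum, ← ENNReal.ofReal_mul (by positivity),
    ← ENNReal.ofReal_mul (by positivity), ← ENNReal.ofReal_mul (by positivity)]
  exact le_of_eq (by congr 1; ring)

lemma norm_forcing_le {U : ℝ → (Fin d → ℤ) → ℂ} (s : ℝ) (k : Fin d → ℤ) :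
    ‖forcing n U s k‖ ≤ ‖nlTerm n (U (max (s - delay n) 0)) k‖ := by
  rw [forcing]
  split_ifs
  · rw [norm_mul, norm_neg, Complex.norm_real,
      Real.norm_of_nonneg (mul_nonneg (Real.exp_pos _).le (ramp_nonneg _ _))]
    refine mul_le_of_le_one_left (norm_nonneg _) (mul_le_one₀ ?_ (ramp_nonneg _ _)
      (ramp_le_one _ _))
    have h1 := delay_pos n
    have h2 := freqNorm_nonneg k
    exact Real.exp_le_one_iff.mpr (neg_nonpos.mpr (by positivity))
  · simp

/-- Interpolation with a free parameter; this makes the forcing uniformly integrable in time. -/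
lemma sq_sum_freqNorm_le {s : Finset (Fin d → ℤ)} {x : (Fin d → ℤ) → ℂ} {Z ε : ℝ}
    (hx : ∑ k ∈ s, ‖x k‖ ≤ Z) (hε : 0 < ε) :
    (∑ k ∈ s, freqNorm k * ‖x k‖) ^ 2 ≤
      Z * (Z / ε + ε * ∑ k ∈ s, freqNorm k ^ 4 * ‖x k‖) := by
  have h1 : (∑ k ∈ s, freqNorm k * ‖x k‖) ^ 2 ≤
      (∑ k ∈ s, ‖x k‖) * ∑ k ∈ s, freqNorm k ^ 2 * ‖x k‖ :=
    Finset.sum_sq_le_sum_mul_sum_of_sq_le_mul s (fun k _ => norm_nonneg _)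
      (fun k _ => by positivity) fun k _ => le_of_eq (by ring)
  have h2 : ∑ k ∈ s, freqNorm k ^ 2 * ‖x k‖ ≤
      Z / ε + ε * ∑ k ∈ s, freqNorm k ^ 4 * ‖x k‖ := by
    calc ∑ k ∈ s, freqNorm k ^ 2 * ‖x k‖
        ≤ ∑ k ∈ s, (‖x k‖ / ε + ε * (freqNorm k ^ 4 * ‖x k‖)) := by
          refine Finset.sum_le_sum fun k _ => ?_
          have : freqNorm k ^ 2 ≤ 1 / ε + ε * freqNorm k ^ 4 := by
            have h3 : 2 * freqNorm k ^ 2 ≤ 1 / ε + ε * freqNorm k ^ 4 := by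
              have h4 : 0 ≤ (1 - ε * freqNorm k ^ 2) ^ 2 / ε := by positivity
              have h5 : (1 - ε * freqNorm k ^ 2) ^ 2 / ε =
                  1 / ε - 2 * freqNorm k ^ 2 + ε * freqNorm k ^ 4 := by
                field_simp
                ring
              linarith
            have : 0 ≤ freqNorm k ^ 2 := by positivity
            linarith
          calc freqNorm k ^ 2 * ‖x k‖ ≤ (1 / ε + ε * freqNorm k ^ 4) * ‖x k‖ := by gcongr
            _ = _ := by ring
      _ = (∑ k ∈ s, ‖x k‖) / ε + ε * ∑ k ∈ s, freqNorm k ^ 4 * ‖x k‖ := by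
          rw [Finset.sum_add_distrib, Finset.sum_div, Finset.mul_sum]
      _ ≤ _ := by gcongr
  have h3 : 0 ≤ ∑ k ∈ s, freqNorm k ^ 2 * ‖x k‖ :=
    Finset.sum_nonneg fun k _ => by positivity
  have h4 : 0 ≤ Z := (Finset.sum_nonneg fun k _ => norm_nonneg _).trans hx
  refine h1.trans ?_
  gcongr

/-- The constant in the modulus of continuity of the `k`-th coefficient. -/
def modConst (d : ℕ) (Z : ℝ) (k : Fin d → ℤ) : ℝ :=
  freqNorm k ^ 4 * Z + (d : ℝ) ^ 2 * freqNorm k ^ 2 * (1 / (1 - Z)) *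
    (Z * (Z + Z / (1 - (d : ℝ) ^ 2 * P1 Z)))

lemma modConst_nonneg (hZ : IsSmallData c Z) (k : Fin d → ℤ) : 0 ≤ modConst d Z k := by
  have h1 : 0 < 1 - (d : ℝ) ^ 2 * P1 Z := by linarith [hZ.small]
  have h2 : 0 < 1 - Z := by linarith [hZ.lt_one]
  have h3 := hZ.nonneg
  have h4 := freqNorm_nonneg k
  unfold modConst
  positivity

/-- Equicontinuity in time. The bound on the forcing loses `|u|_1²`, which is not bounded but
uniformly integrable in time. -/
lemma IsDelayed.norm_sub_le_of_le (hU : IsDelayed n c T U) (hZ : IsSmallData c Z) {s t : ℝ}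
    (hs : s ∈ Icc 0 T) (ht : t ∈ Icc 0 T) (hst : s ≤ t) (k : Fin d → ℤ) :
    ‖U t k - U s k‖ ≤ modConst d Z k * ((t - s) + Real.sqrt (t - s)) := by
  rcases hst.eq_or_lt with rfl | hlt
  · simp
  have h1 : 0 < 1 - (d : ℝ) ^ 2 * P1 Z := by linarith [hZ.small]
  have h2 : 0 < 1 - Z := by linarith [hZ.lt_one]
  have hZ0 := hZ.nonneg
  have hk := freqNorm_nonneg k
  have hx : 0 < t - s := by linarith
  -- this choice balances the terms `(t - s) / ε` and `ε` of the interpolation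
  set ε := Real.sqrt (t - s) with hε
  have hε0 : 0 < ε := Real.sqrt_pos.mpr hx
  have hεε : (t - s) / ε = ε := Real.div_sqrt
  set D := (d : ℝ) ^ 2 * freqNorm k ^ 2 * (1 / (1 - Z)) with hD
  have hD0 : 0 ≤ D := by positivity
  set Y : ℝ → ℝ := fun s => ∑ k ∈ box d n, freqNorm k ^ 4 * ‖U s k‖ with hY
  have hYc : Continuous Y := continuous_finsetSum _ fun k _ => by
    have := hU.cont k
    fun_prop
  have hY0 : ∀ s, 0 ≤ Y s := fun s => Finset.sum_nonneg fun k _ => by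
    have := freqNorm_nonneg k
    positivity
  have hUc := hU.cont k
  have hfc := continuous_forcing hU.cont hU.supp k
  have hforce : ∫ r in s..t, ‖forcing n U r k‖ ≤
      D * Z * (Z / ε) * (t - s) + ∫ r in (0 : ℝ)..t, D * Z * ε * Y r := by
    have hδ := delay_pos n
    refine integral_delay_le (h := delay n) hfc.norm (by fun_prop) (fun r => ?_) (by positivity)
      hs.1 hst (fun r hr => ?_) hδ.le fun r hr => ?_
    · have := hY0 r
      positivity
    · simp [forcing, ramp_eq_zero hδ hr]
    · have hr0 : 0 ≤ r - delay n := by linarith [hr.1]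
      have hmem : r - delay n ∈ Icc 0 T := ⟨hr0, by linarith [hr.2, ht.2]⟩
      have hsum := hU.sum_norm_le hZ hmem
      refine (norm_forcing_le r k).trans ?_
      rw [max_eq_left hr0]
      refine (norm_nlTerm_le_sum n (hU.supp _) hZ0 hZ.lt_one hsum k).trans ?_
      calc _ ≤ D * (Z * (Z / ε + ε * Y (r - delay n))) :=
            mul_le_mul_of_nonneg_left (sq_sum_freqNorm_le hsum hε0) hD0
        _ = _ := by ring
  have hYint : ∫ r in (0 : ℝ)..t, Y r ≤ Z / (1 - (d : ℝ) ^ 2 * P1 Z) := hU.integral_le hZ ht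
  rw [hU.sub_eq hs ht]
  have hUn : Continuous fun r => freqNorm k ^ 4 * ‖U r k‖ := by fun_prop
  calc ‖∫ r in s..t, (-(freqNorm k ^ 4 : ℝ) * U r k + forcing n U r k)‖
      ≤ ∫ r in s..t, ‖-((freqNorm k ^ 4 : ℝ) : ℂ) * U r k + forcing n U r k‖ :=
        intervalIntegral.norm_integral_le_integral_norm hst
    _ ≤ ∫ r in s..t, (freqNorm k ^ 4 * Z + ‖forcing n U r k‖) := by
        refine intervalIntegral.integral_mono_on hst
          (Continuous.intervalIntegrable (by fun_prop) _ _)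
          (Continuous.intervalIntegrable (by fun_prop) _ _) fun r hr => ?_
        refine (norm_add_le _ _).trans ?_
        rw [norm_mul, norm_neg, Complex.norm_real, Real.norm_of_nonneg (by positivity)]
        gcongr
        have hr' : r ∈ Icc 0 T := ⟨hs.1.trans hr.1, hr.2.trans ht.2⟩
        by_cases hkb : k ∈ box d n
        · exact (Finset.single_le_sum (f := fun k => ‖U r k‖) (fun _ _ => norm_nonneg _) hkb).trans
            (hU.sum_norm_le hZ hr')
        · rw [hU.supp r k hkb, norm_zero]
          exact hZ0
    _ = freqNorm k ^ 4 * Z * (t - s) + ∫ r in s..t, ‖forcing n U r k‖ := by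
        rw [intervalIntegral.integral_add (continuous_const.intervalIntegrable _ _)
          (hfc.norm.intervalIntegrable _ _), intervalIntegral.integral_const, smul_eq_mul, mul_comm]
    _ ≤ freqNorm k ^ 4 * Z * (t - s) +
        (D * Z * (Z / ε) * (t - s) + D * Z * ε * (Z / (1 - (d : ℝ) ^ 2 * P1 Z))) := by
        gcongr
        refine hforce.trans ?_
        rw [intervalIntegral.integral_const_mul]
        gcongr
    _ = freqNorm k ^ 4 * Z * (t - s) + D * Z * (Z + Z / (1 - (d : ℝ) ^ 2 * P1 Z)) * ε := by
        have : D * Z * (Z / ε) * (t - s) = D * Z * Z * ((t - s) / ε) := by ring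
        rw [this, hεε]; ring
    _ ≤ modConst d Z k * (t - s) + modConst d Z k * ε := by
        have h5 : D * Z * (Z + Z / (1 - (d : ℝ) ^ 2 * P1 Z)) ≤ modConst d Z k := by
          unfold modConst
          have : 0 ≤ freqNorm k ^ 4 * Z := by positivity
          rw [← hD]; linarith
        have h6 : freqNorm k ^ 4 * Z ≤ modConst d Z k := by
          unfold modConst
          have : 0 ≤ D * (Z * (Z + Z / (1 - (d : ℝ) ^ 2 * P1 Z))) := by positivity
          rw [← hD]; linarith
        gcongr
    _ = _ := by ring

lemma IsDelayed.norm_sub_le (hU : IsDelayed n c T U) (hZ : IsSmallData c Z) {s t : ℝ}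
    (hs : s ∈ Icc 0 T) (ht : t ∈ Icc 0 T) (k : Fin d → ℤ) :
    ‖U t k - U s k‖ ≤ modConst d Z k * (|t - s| + Real.sqrt |t - s|) := by
  rcases le_total s t with h | h
  · rw [abs_of_nonneg (sub_nonneg.mpr h)]
    exact hU.norm_sub_le_of_le hZ hs ht h k
  · rw [abs_of_nonpos (sub_nonpos.mpr h), neg_sub, norm_sub_rev]
    exact hU.norm_sub_le_of_le hZ ht hs h k

end equicontinuity

/-- Compactness: a bounded sequence of families with a common modulus of continuity has a
subsequence converging pointwise. -/
lemma exists_subseq_tendsto {ι : Type*} [Countable ι] {V : ℕ → ℝ → ι → ℂ} {Z : ℝ}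
    (hV : ∀ n t k, ‖V n t k‖ ≤ Z) {ρ : ι → ℝ → ℝ} (hρ : ∀ k, Tendsto (ρ k) (𝓝 0) (𝓝 0))
    (hmod : ∀ n s t k, ‖V n t k - V n s k‖ ≤ ρ k (t - s)) :
    ∃ φ : ℕ → ℕ, StrictMono φ ∧ ∃ a : ℝ → ι → ℂ,
      ∀ t k, Tendsto (fun m => V (φ m) t k) atTop (𝓝 (a t k)) := by
  have hK : IsCompact (Set.pi univ fun _ : ℚ × ι => Metric.closedBall (0 : ℂ) Z) :=
    isCompact_univ_pi fun _ => isCompact_closedBall _ _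
  -- convergence at rational times is transferred to all times by the modulus of continuity
  obtain ⟨b, -, φ, hφ, hb⟩ := hK.isSeqCompact (x := fun n p => V n (p.1 : ℝ) p.2)
    (fun n p _ => by simpa using hV n p.1 p.2)
  rw [tendsto_pi_nhds] at hb
  refine ⟨φ, hφ, ?_⟩
  suffices H : ∀ t k, ∃ y, Tendsto (fun m => V (φ m) t k) atTop (𝓝 y) by
    choose a ha using H
    exact ⟨a, ha⟩
  intro t k
  refine cauchySeq_tendsto_of_complete (Metric.cauchySeq_iff'.mpr fun ε hε => ?_)
  obtain ⟨δ, hδ, hδε⟩ := Metric.tendsto_nhds_nhds.mp (hρ k) (ε / 3) (by positivity)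
  obtain ⟨r, hr1, hr2⟩ := exists_rat_btwn (show t < t + δ by linarith)
  have hclose : ∀ n, ‖V n t k - V n r k‖ < ε / 3 := by
    intro n
    refine (hmod n r t k).trans_lt ?_
    have := hδε (x := t - r) (by
      rw [Real.dist_eq, sub_zero, abs_lt]
      constructor <;> linarith)
    rw [Real.dist_eq, sub_zero] at this
    exact (le_abs_self _).trans_lt this
  obtain ⟨N, hN⟩ := Metric.cauchySeq_iff'.mp (hb (r, k)).cauchySeq (ε / 3) (by positivity)
  refine ⟨N, fun m hm => ?_⟩
  have h1 := hN m hm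
  simp only [Function.comp] at h1
  rw [dist_eq_norm] at h1 ⊢
  have e : V (φ m) t k - V (φ N) t k = (V (φ m) t k - V (φ m) r k) +
      (V (φ m) r k - V (φ N) r k) - (V (φ N) t k - V (φ N) r k) := by ring
  rw [e]
  calc _ ≤ ‖V (φ m) t k - V (φ m) r k‖ + ‖V (φ m) r k - V (φ N) r k‖ +
        ‖V (φ N) t k - V (φ N) r k‖ := (norm_sub_le _ _).trans (by gcongr; exact norm_add_le _ _)
    _ < ε / 3 + ε / 3 + ε / 3 := by gcongr <;> exact hclose _
    _ = ε := by ring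

/-! ### The limit of the delayed solutions -/

/-- The properties of the Fourier coefficients `a t` of the solution with initial coefficients
`c`. The fields `herm` and `cont` hold for all real times only for convenience, the solution being
frozen at negative times. -/
structure IsCoefSolution (c : (Fin d → ℤ) → ℂ) (Z : ℝ) (a : ℝ → (Fin d → ℤ) → ℂ) : Prop where
  cont : ∀ k, Continuous fun t => a t k
  herm : ∀ t, IsHermitian (a t)
  init : a 0 = c
  weight_le : ∀ σ lam : ℝ, 0 ≤ σ → 0 ≤ lam → σ + lam ≤ 1 - (d : ℝ) ^ 2 * P1 Z → ∀ t : ℝ, 0 ≤ t →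
    ∑' k, ENNReal.ofReal (expWeight σ lam t k) * eabs (a t) k ≤ ENNReal.ofReal Z
  lintegral_le : ∀ T : ℝ, ∫⁻ t in Ioc 0 T, moment 4 (eabs (a t)) ≤
    ENNReal.ofReal (Z / (1 - (d : ℝ) ^ 2 * P1 Z))
  hasDerivAt : ∀ t : ℝ, 0 < t → ∀ k, HasDerivAt (fun s => a s k)
    (-((freqNorm k ^ 4 : ℝ) : ℂ) * a t k - nlTerm ⊤ (a t) k) t

lemma eventually_mem_box (k : Fin d → ℤ) : ∀ᶠ n in atTop, k ∈ box d n := by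
  obtain ⟨N, hN⟩ : ∃ N : ℕ, ∀ i, |k i| ≤ N :=
    ⟨∑ i, (k i).natAbs, fun i => by
      rw [Int.abs_eq_natAbs]
      exact_mod_cast Finset.single_le_sum (f := fun i => (k i).natAbs) (fun _ _ => Nat.zero_le _)
        (Finset.mem_univ i)⟩
  filter_upwards [eventually_ge_atTop N] with n hn
  simp only [box, Fintype.mem_piFinset, Finset.mem_Icc]
  intro i
  have h1 := abs_le.mp (hN i)
  have h2 : (N : ℤ) ≤ n := by exact_mod_cast hn
  omega

lemma moment_zero_eabs_le_of_finite {s : Finset (Fin d → ℤ)} {x : (Fin d → ℤ) → ℂ}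
    (hx : ∀ k ∉ s, x k = 0) {z : ℝ} (hz : ∑ k ∈ s, ‖x k‖ ≤ z) :
    moment 0 (eabs x) ≤ ENNReal.ofReal z := by
  have := moment_weight_eq hx 0 (w := fun _ => 1) fun _ => zero_le_one
  simp only [ENNReal.ofReal_one, one_mul, pow_zero] at this
  rw [show eabs x = fun k => eabs x k from rfl, this]
  exact ENNReal.ofReal_le_ofReal hz

lemma tendsto_delay : Tendsto delay atTop (𝓝 0) := tendsto_one_div_add_atTop_nhds_zero_nat

section limit

variable {c : (Fin d → ℤ) → ℂ} {Z : ℝ} {U : ℕ → ℝ → (Fin d → ℤ) → ℂ} {φ : ℕ → ℕ}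
  {a : ℝ → (Fin d → ℤ) → ℂ}

/-- Projection of a time to `[0, n]`. -/
def clampTime (n : ℕ) (t : ℝ) : ℝ := max 0 (min t n)

lemma clampTime_mem (n : ℕ) (t : ℝ) : clampTime n t ∈ Icc (0 : ℝ) n :=
  ⟨le_max_left _ _, max_le (by positivity) (min_le_right _ _)⟩

lemma clampTime_eq {n : ℕ} {t : ℝ} (h0 : 0 ≤ t) (hn : t ≤ n) : clampTime n t = t := by
  rw [clampTime, min_eq_left hn, max_eq_right h0]

lemma abs_clampTime_sub_le (n : ℕ) (s t : ℝ) : |clampTime n t - clampTime n s| ≤ |t - s| := by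
  unfold clampTime
  rw [max_comm 0, max_comm 0]
  refine (abs_max_sub_max_le_abs _ _ _).trans ((abs_min_sub_min_le_max _ _ _ _).trans ?_)
  simp

/-- The exponential weight bounds the single modes; for `σ > 0` and positive times this dominates
all sums over the lattice. -/
lemma norm_mode_le (hZ : IsSmallData c Z) {n : ℕ} (hU : IsDelayed n c n (U n)) {t : ℝ}
    (ht : t ∈ Icc (0 : ℝ) n) {σ : ℝ} (hσ : 0 ≤ σ) (hσ1 : σ ≤ 1 - (d : ℝ) ^ 2 * P1 Z)
    (k : Fin d → ℤ) : ‖U n t k‖ ≤ Z * Real.exp (-(σ * t * freqNorm k)) := by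
  by_cases hk : k ∈ box d n
  · have h1 := hU.sum_le hZ hσ le_rfl (by linarith) ht
    have h2 : expWeight σ 0 t k * ‖U n t k‖ ≤ Z :=
      (Finset.single_le_sum (f := fun k => expWeight σ 0 t k * ‖U n t k‖)
        (fun k _ => mul_nonneg (Real.exp_pos _).le (norm_nonneg _)) hk).trans h1
    rw [Real.exp_neg, ← div_eq_mul_inv, le_div_iff₀ (Real.exp_pos _)]
    refine le_trans (le_of_eq ?_) h2
    rw [mul_comm, expWeight]
    congr 2; ring
  · rw [hU.supp t k hk, norm_zero]
    exact mul_nonneg hZ.nonneg (Real.exp_pos _).le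

/-- The exponential weight controls the first moment at positive times. -/
lemma sum_freqNorm_le (hZ : IsSmallData c Z) {n : ℕ} (hU : IsDelayed n c n (U n)) {t : ℝ}
    (ht : t ∈ Icc (0 : ℝ) n) (ht0 : 0 < t) :
    ∑ k ∈ box d n, freqNorm k * ‖U n t k‖ ≤ Z / ((1 - (d : ℝ) ^ 2 * P1 Z) * t) := by
  have h1 : 0 < 1 - (d : ℝ) ^ 2 * P1 Z := by linarith [hZ.small]
  set σ := 1 - (d : ℝ) ^ 2 * P1 Z
  rw [le_div_iff₀ (by positivity), Finset.sum_mul]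
  refine le_trans (Finset.sum_le_sum fun k _ => ?_)
    (hU.sum_le hZ h1.le le_rfl (by rw [add_zero]) ht)
  calc freqNorm k * ‖U n t k‖ * (σ * t) = (σ * freqNorm k + 0) * t * ‖U n t k‖ := by ring
    _ ≤ expWeight σ 0 t k * ‖U n t k‖ := by
        gcongr
        have := Real.add_one_le_exp ((σ * freqNorm k + 0) * t)
        unfold expWeight
        linarith

lemma sum_le_sum_box {s F : Finset (Fin d → ℤ)} {g : (Fin d → ℤ) → ℝ} (hg : ∀ k, 0 ≤ g k)
    (hs : ∀ k ∉ s, g k = 0) : ∑ k ∈ F, g k ≤ ∑ k ∈ s, g k := by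
  classical
  calc ∑ k ∈ F, g k ≤ ∑ k ∈ F ∪ s, g k :=
        Finset.sum_le_sum_of_subset_of_nonneg Finset.subset_union_left fun k _ _ => hg k
    _ = ∑ k ∈ s, g k :=
        (Finset.sum_subset Finset.subset_union_right fun k _ hk => hs k hk).symm

/-- The modulus of continuity shared by the approximations. -/
def modulus (d : ℕ) (Z : ℝ) (k : Fin d → ℤ) (x : ℝ) : ℝ := modConst d Z k * (|x| + Real.sqrt |x|)

lemma tendsto_modulus (Z : ℝ) (k : Fin d → ℤ) : Tendsto (modulus d Z k) (𝓝 0) (𝓝 0) := by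
  have : Continuous (modulus d Z k) := by unfold modulus; fun_prop
  simpa [modulus] using this.tendsto 0

lemma eventually_le_cast (hφ : StrictMono φ) (t : ℝ) : ∀ᶠ m in atTop, t ≤ φ m :=
  (tendsto_natCast_atTop_atTop.comp hφ.tendsto_atTop).eventually_ge_atTop t

lemma tendsto_delayed (hZ : IsSmallData c Z) (hU : ∀ n : ℕ, IsDelayed n c n (U n))
    (hφ : StrictMono φ)
    (hlim : ∀ t : ℝ, 0 ≤ t → ∀ k, Tendsto (fun m => U (φ m) t k) atTop (𝓝 (a t k)))
    {t : ℝ} (ht : 0 < t) (k : Fin d → ℤ) :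
    Tendsto (fun m => U (φ m) (t - delay (φ m)) k) atTop (𝓝 (a t k)) := by
  have hd : Tendsto (fun m => delay (φ m)) atTop (𝓝 0) := tendsto_delay.comp hφ.tendsto_atTop
  have h1 : Tendsto (fun m => U (φ m) (t - delay (φ m)) k - U (φ m) t k) atTop (𝓝 0) := by
    refine squeeze_zero_norm' ?_ ((tendsto_modulus Z k).comp hd)
    filter_upwards [eventually_le_cast hφ t, hd.eventually (ge_mem_nhds ht)] with m h1 h2
    have hδ := delay_pos (φ m)
    have := (hU (φ m)).norm_sub_le hZ (s := t) (t := t - delay (φ m)) ⟨ht.le, h1⟩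
      ⟨by linarith, by linarith⟩ k
    simpa [modulus] using this
  simpa using h1.add (hlim t ht.le k)

lemma tendsto_forcing (hZ : IsSmallData c Z) (hU : ∀ n : ℕ, IsDelayed n c n (U n))
    (hφ : StrictMono φ)
    (hlim : ∀ t : ℝ, 0 ≤ t → ∀ k, Tendsto (fun m => U (φ m) t k) atTop (𝓝 (a t k)))
    {t : ℝ} (ht : 0 < t) (k : Fin d → ℤ) :
    Tendsto (fun m => forcing (φ m) (U (φ m)) t k) atTop (𝓝 (-nlTerm ⊤ (a t) k)) := by
  have hd : Tendsto (fun m => delay (φ m)) atTop (𝓝 0) := tendsto_delay.comp hφ.tendsto_atTop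
  have hσ : 0 < 1 - (d : ℝ) ^ 2 * P1 Z := by linarith [hZ.small]
  set σ := 1 - (d : ℝ) ^ 2 * P1 Z with hσdef
  have hc : 0 < σ * (t / 2) := by positivity
  have hsmall : ∀ᶠ m in atTop, delay (φ m) ≤ t / 2 := hd.eventually (ge_mem_nhds (half_pos ht))
  have hN : Tendsto (fun m => nlTerm (φ m : ℕ∞) (U (φ m) (t - delay (φ m))) k) atTop
      (𝓝 (nlTerm ⊤ (a t) k)) := by
    refine tendsto_nlTerm hZ.nonneg hZ.lt_one
      (b := fun k => Z * Real.exp (-(σ * (t / 2) * freqNorm k)))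
      ((summable_exp_neg_freqNorm hc).mul_left Z) ?_ ?_ ?_ (tendsto_delayed hZ hU hφ hlim ht) ?_ k
    · exact ((summable_freqNorm_mul_exp hc).mul_left Z).congr fun k => by ring
    · filter_upwards [eventually_le_cast hφ t, hsmall] with m h1 h2 k
      have hδ := delay_pos (φ m)
      refine (norm_mode_le hZ (hU (φ m)) ⟨by linarith, by linarith⟩ hσ.le le_rfl k).trans ?_
      have h3 := freqNorm_nonneg k
      have h4 := hZ.nonneg
      gcongr
      linarith
    · filter_upwards [eventually_le_cast hφ t, hsmall] with m h1 h2
      have hδ := delay_pos (φ m)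
      exact moment_zero_eabs_le_of_finite ((hU (φ m)).supp _)
        ((hU (φ m)).sum_norm_le hZ ⟨by linarith, by linarith⟩)
    · intro j
      filter_upwards [hφ.tendsto_atTop.eventually_gt_atTop j] with m hm
      exact_mod_cast hm
  have hfac : Tendsto (fun m => (Real.exp (-(delay (φ m) * (freqNorm k + 1))) : ℂ)) atTop
      (𝓝 1) := by
    have h1 : Continuous fun x : ℝ => (Real.exp (-(x * (freqNorm k + 1))) : ℂ) := by fun_prop
    simpa [Function.comp_def] using (h1.tendsto 0).comp hd
  have hlim' := hfac.mul hN
  rw [one_mul] at hlim'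
  refine hlim'.neg.congr' ?_
  filter_upwards [hsmall, hφ.tendsto_atTop.eventually (eventually_mem_box k)] with m h1 h2
  have hδ := delay_pos (φ m)
  have hramp : ramp (delay (φ m)) t = 1 := by
    have : 1 ≤ (t - delay (φ m)) / delay (φ m) := by
      rw [le_div_iff₀ hδ]; linarith
    rw [ramp, min_eq_left (this.trans (le_max_right _ _))]
  rw [forcing, if_pos h2, hramp, mul_one, max_eq_left (by linarith), neg_mul]

/-- The limit solves the equation between positive times; the bounds used for dominated convergence
degenerate at time `0`. -/
lemma integral_equation (hZ : IsSmallData c Z) (hU : ∀ n : ℕ, IsDelayed n c n (U n))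
    (hφ : StrictMono φ)
    (hlim : ∀ t : ℝ, 0 ≤ t → ∀ k, Tendsto (fun m => U (φ m) t k) atTop (𝓝 (a t k)))
    {s t : ℝ} (hs : 0 < s) (hst : s ≤ t) (k : Fin d → ℤ) :
    a t k - a s k = ∫ r in s..t, (-((freqNorm k ^ 4 : ℝ) : ℂ) * a r k - nlTerm ⊤ (a r) k) := by
  have hd : Tendsto (fun m => delay (φ m)) atTop (𝓝 0) := tendsto_delay.comp hφ.tendsto_atTop
  have hσ : 0 < 1 - (d : ℝ) ^ 2 * P1 Z := by linarith [hZ.small]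
  have h1Z : 0 < 1 - Z := by linarith [hZ.lt_one]
  have hZ0 := hZ.nonneg
  have hk := freqNorm_nonneg k
  set σ := 1 - (d : ℝ) ^ 2 * P1 Z with hσdef
  have hsmall : ∀ᶠ m in atTop, delay (φ m) ≤ s / 2 := hd.eventually (ge_mem_nhds (half_pos hs))
  refine tendsto_nhds_unique ((hlim t (hs.le.trans hst) k).sub (hlim s hs.le k)) ?_
  refine Tendsto.congr' (f₁ := fun m => ∫ r in s..t, (-((freqNorm k ^ 4 : ℝ) : ℂ) * U (φ m) r k +
    forcing (φ m) (U (φ m)) r k)) ?_ ?_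
  · filter_upwards [eventually_le_cast hφ t] with m hm
    exact ((hU (φ m)).sub_eq ⟨hs.le, hst.trans hm⟩ ⟨hs.le.trans hst, hm⟩ k).symm
  · refine intervalIntegral.tendsto_integral_filter_of_dominated_convergence
      (fun _ => freqNorm k ^ 4 * Z + (d : ℝ) ^ 2 * freqNorm k ^ 2 * (1 / (1 - Z)) *
        (Z / (σ * (s / 2))) ^ 2) ?_ ?_ intervalIntegrable_const ?_
    · refine Eventually.of_forall fun m => Continuous.aestronglyMeasurable ?_
      have h1 := (hU (φ m)).cont k
      have h2 := continuous_forcing (hU (φ m)).cont (hU (φ m)).supp k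
      fun_prop
    · filter_upwards [eventually_le_cast hφ t, hsmall] with m hm hm2
      refine ae_of_all _ fun r hr => ?_
      rw [uIoc_of_le hst] at hr
      have hδ := delay_pos (φ m)
      have hr1 : r ∈ Icc (0 : ℝ) (φ m) := ⟨(hs.trans hr.1).le, hr.2.trans hm⟩
      have hr2 : r - delay (φ m) ∈ Icc (0 : ℝ) (φ m) :=
        ⟨by linarith [hr.1], by linarith [hr1.2]⟩
      refine (norm_add_le _ _).trans (add_le_add ?_ ?_)
      · rw [norm_mul, norm_neg, Complex.norm_real, Real.norm_of_nonneg (by positivity)]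
        gcongr
        have := norm_mode_le hZ (hU (φ m)) hr1 le_rfl hσ.le k
        simpa using this
      · refine (norm_forcing_le r k).trans ?_
        rw [max_eq_left hr2.1]
        refine (norm_nlTerm_le_sum _ ((hU (φ m)).supp _) hZ0 hZ.lt_one
          ((hU (φ m)).sum_norm_le hZ hr2) k).trans ?_
        have h3 : 0 ≤ ∑ k ∈ box d (φ m), freqNorm k * ‖U (φ m) (r - delay (φ m)) k‖ :=
          Finset.sum_nonneg fun k _ => mul_nonneg (freqNorm_nonneg k) (norm_nonneg _)
        gcongr
        refine (sum_freqNorm_le hZ (hU (φ m)) hr2 (by linarith [hr.1])).trans ?_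
        gcongr
        linarith [hr.1]
    · refine ae_of_all _ fun r hr => ?_
      rw [uIoc_of_le hst] at hr
      have hr0 : 0 < r := hs.trans hr.1
      have := ((hlim r hr0.le k).const_mul (-((freqNorm k ^ 4 : ℝ) : ℂ))).add
        (tendsto_forcing hZ hU hφ hlim hr0 k)
      simpa [sub_eq_add_neg] using this

end limit

lemma continuousAt_nlTerm {c : (Fin d → ℤ) → ℂ} {Z : ℝ} (hZ : IsSmallData c Z)
    {a : ℝ → (Fin d → ℤ) → ℂ} (ha : ∀ k, Continuous fun t => a t k)
    (hw : ∀ σ lam : ℝ, 0 ≤ σ → 0 ≤ lam → σ + lam ≤ 1 - (d : ℝ) ^ 2 * P1 Z → ∀ t : ℝ, 0 ≤ t →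
      ∑' k, ENNReal.ofReal (expWeight σ lam t k) * eabs (a t) k ≤ ENNReal.ofReal Z)
    {t : ℝ} (ht : 0 < t) (k : Fin d → ℤ) :
    ContinuousAt (fun s => nlTerm ⊤ (a s) k) t := by
  have hσ : 0 < 1 - (d : ℝ) ^ 2 * P1 Z := by linarith [hZ.small]
  set σ := 1 - (d : ℝ) ^ 2 * P1 Z with hσdef
  have hc : 0 < σ * (t / 2) := by positivity
  have hZ0 := hZ.nonneg
  refine tendsto_nlTerm hZ0 hZ.lt_one
      (b := fun k => Z * Real.exp (-(σ * (t / 2) * freqNorm k)))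
      ((summable_exp_neg_freqNorm hc).mul_left Z) ?_ ?_ ?_ (fun k => (ha k).continuousAt)
      (fun m => Eventually.of_forall fun _ => ENat.natCast_lt_top m) k
  · exact ((summable_freqNorm_mul_exp hc).mul_left Z).congr fun k => by ring
  · filter_upwards [lt_mem_nhds (half_lt_self ht)] with s hs k
    have hs0 : 0 ≤ s := by linarith
    have hk := freqNorm_nonneg k
    have h1 := (ENNReal.le_tsum k).trans (hw σ 0 hσ.le le_rfl (by simp) s hs0)
    rw [eabs, ← ofReal_norm, ← ENNReal.ofReal_mul (by unfold expWeight; positivity),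
      ENNReal.ofReal_le_ofReal_iff hZ0] at h1
    calc ‖a s k‖ = expWeight σ 0 s k * ‖a s k‖ * Real.exp (-((σ * freqNorm k + 0) * s)) := by
          rw [expWeight, Real.exp_neg]; field_simp
      _ ≤ Z * Real.exp (-(σ * (t / 2) * freqNorm k)) := by
          refine mul_le_mul h1 (Real.exp_le_exp.mpr ?_) (Real.exp_pos _).le hZ0
          nlinarith [mul_nonneg hσ.le hk]
  · filter_upwards [lt_mem_nhds (half_lt_self ht)] with s hs
    have hs0 : 0 ≤ s := by linarith
    have := hw 0 0 le_rfl le_rfl (by linarith) s hs0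
    simpa [expWeight, moment] using this

/-- Global solutions in Fourier space, as limits of the delayed problems. -/
lemma exists_isCoefSolution {c : (Fin d → ℤ) → ℂ} {Z : ℝ} (hZ : IsSmallData c Z)
    (hc : IsHermitian c) : ∃ a, IsCoefSolution c Z a := by
  have hZ0 := hZ.nonneg
  have hσ : 0 < 1 - (d : ℝ) ^ 2 * P1 Z := by linarith [hZ.small]
  choose U hU using fun n : ℕ => exists_isDelayed n hc n
  -- the `n`-th approximation lives on `[0, n]` and is extended by constants
  obtain ⟨φ, hφ, a, ha⟩ := exists_subseq_tendsto
    (V := fun n t k => U n (clampTime n t) k) (Z := Z) (fun n t k => by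
      have := norm_mode_le hZ (hU n) (clampTime_mem n t) le_rfl hσ.le k
      simpa using this)
    (ρ := modulus d Z) (tendsto_modulus Z) (fun n s t k => by
      refine ((hU n).norm_sub_le hZ (clampTime_mem n s) (clampTime_mem n t) k).trans ?_
      have h1 := modConst_nonneg hZ k
      have h2 := abs_clampTime_sub_le n s t
      unfold modulus
      gcongr)
  have hlim : ∀ t : ℝ, 0 ≤ t → ∀ k, Tendsto (fun m => U (φ m) t k) atTop (𝓝 (a t k)) := by
    intro t ht k
    refine (ha t k).congr' ?_
    filter_upwards [eventually_le_cast hφ t] with m hm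
    simp only [clampTime_eq ht hm]
  have hcont : ∀ k, Continuous fun t => a t k := by
    intro k
    have hmod : ∀ s t, ‖a t k - a s k‖ ≤ modulus d Z k (t - s) := by
      intro s t
      refine le_of_tendsto ((ha t k).sub (ha s k)).norm (Eventually.of_forall fun m => ?_)
      refine ((hU (φ m)).norm_sub_le hZ (clampTime_mem _ s) (clampTime_mem _ t) k).trans ?_
      have h1 := modConst_nonneg hZ k
      have h2 := abs_clampTime_sub_le (φ m) s t
      unfold modulus
      gcongr
    refine continuous_iff_continuousAt.mpr fun s => ?_
    rw [ContinuousAt, tendsto_iff_norm_sub_tendsto_zero]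
    refine squeeze_zero (fun _ => norm_nonneg _) (hmod s) ?_
    have h1 : Tendsto (fun t : ℝ => t - s) (𝓝 s) (𝓝 0) := by
      have : Continuous fun t : ℝ => t - s := by fun_prop
      simpa using this.tendsto s
    exact (tendsto_modulus Z k).comp h1
  have hweight : ∀ σ lam : ℝ, 0 ≤ σ → 0 ≤ lam → σ + lam ≤ 1 - (d : ℝ) ^ 2 * P1 Z →
      ∀ t : ℝ, 0 ≤ t →
      ∑' k, ENNReal.ofReal (expWeight σ lam t k) * eabs (a t) k ≤ ENNReal.ofReal Z := by
    intro σ lam h1 h2 h3 t ht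
    rw [ENNReal.tsum_eq_iSup_sum]
    refine iSup_le fun F => ?_
    have hF : ∑ k ∈ F, expWeight σ lam t k * ‖a t k‖ ≤ Z := by
      refine le_of_tendsto (tendsto_finsetSum F fun k _ => (hlim t ht k).norm.const_mul _) ?_
      filter_upwards [eventually_le_cast hφ t] with m hm
      refine le_trans ?_ ((hU (φ m)).sum_le hZ h1 h2 h3 ⟨ht, hm⟩)
      refine sum_le_sum_box (fun k => mul_nonneg (Real.exp_pos _).le (norm_nonneg _)) fun k hk => ?_
      rw [(hU (φ m)).supp t k hk, norm_zero, mul_zero]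
    refine le_trans (le_of_eq ?_) (ENNReal.ofReal_le_ofReal hF)
    rw [ENNReal.ofReal_sum_of_nonneg (by intro k _; unfold expWeight; positivity)]
    refine Finset.sum_congr rfl fun k _ => ?_
    rw [ENNReal.ofReal_mul (by unfold expWeight; positivity), ofReal_norm]
    rfl
  refine ⟨a, hcont, fun t k => ?_, ?_, hweight, fun T => ?_, fun t ht k => ?_⟩
  · refine tendsto_nhds_unique (ha t (-k)) ?_
    refine ((Complex.continuous_conj.tendsto _).comp (ha t k)).congr fun m => ?_
    exact ((hU (φ m)).herm _ k).symm
  · funext k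
    refine tendsto_nhds_unique (hlim 0 le_rfl k) (tendsto_const_nhds.congr' ?_)
    filter_upwards [hφ.tendsto_atTop.eventually (eventually_mem_box k)] with m hm
    rw [(hU (φ m)).eq 0 ⟨le_rfl, by positivity⟩]
    simp [duhamel, hm]
  · rcases le_or_gt T 0 with hT | hT
    · simp [Ioc_eq_empty_of_le hT]
    simp only [moment]
    have hmeas : ∀ k, Measurable fun t => eabs (a t) k := fun k => (hcont k).enorm.measurable
    rw [lintegral_tsum fun k => ((hmeas k).const_mul _).aemeasurable, ENNReal.tsum_eq_iSup_sum]
    refine iSup_le fun F => ?_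
    have hF : ∫ t in (0 : ℝ)..T, ∑ k ∈ F, freqNorm k ^ 4 * ‖a t k‖ ≤
        Z / (1 - (d : ℝ) ^ 2 * P1 Z) := by
      refine le_of_tendsto (x := atTop) (f := fun m => ∫ t in (0 : ℝ)..T,
        ∑ k ∈ F, freqNorm k ^ 4 * ‖U (φ m) t k‖) ?_ ?_
      · refine intervalIntegral.tendsto_integral_filter_of_dominated_convergence
          (fun _ => ∑ k ∈ F, freqNorm k ^ 4 * Z) ?_ ?_ intervalIntegrable_const ?_
        · refine Eventually.of_forall fun m => Continuous.aestronglyMeasurable ?_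
          exact continuous_finsetSum _ fun k _ => by
            have := (hU (φ m)).cont k
            fun_prop
        · filter_upwards [eventually_le_cast hφ T] with m hm
          refine ae_of_all _ fun t ht => ?_
          rw [uIoc_of_le hT.le] at ht
          rw [Real.norm_of_nonneg (Finset.sum_nonneg fun k _ => by positivity)]
          refine Finset.sum_le_sum fun k _ => ?_
          gcongr
          have := norm_mode_le hZ (hU (φ m)) ⟨ht.1.le, ht.2.trans hm⟩ le_rfl hσ.le k
          simpa using this
        · refine ae_of_all _ fun t ht => ?_
          rw [uIoc_of_le hT.le] at ht
          exact tendsto_finsetSum F fun k _ => (hlim t ht.1.le k).norm.const_mul _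
      · filter_upwards [eventually_le_cast hφ T] with m hm
        refine le_trans ?_ ((hU (φ m)).integral_le hZ ⟨hT.le, hm⟩)
        refine intervalIntegral.integral_mono_on hT.le
          (Continuous.intervalIntegrable (continuous_finsetSum _ fun k _ => by
            have := (hU (φ m)).cont k
            fun_prop) _ _)
          (Continuous.intervalIntegrable (continuous_finsetSum _ fun k _ => by
            have := (hU (φ m)).cont k
            fun_prop) _ _) fun t _ => ?_
        refine sum_le_sum_box (fun k => by positivity) fun k hk => ?_
        rw [(hU (φ m)).supp t k hk, norm_zero, mul_zero]
    refine le_trans (le_of_eq ?_) (ENNReal.ofReal_le_ofReal hF)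
    have hFc : Continuous fun t => ∑ k ∈ F, freqNorm k ^ 4 * ‖a t k‖ :=
      continuous_finsetSum _ fun k _ => by
        have := hcont k
        fun_prop
    rw [intervalIntegral.integral_of_le hT.le,
      ofReal_integral_eq_lintegral_ofReal hFc.integrableOn_Ioc
        (ae_of_all _ fun t => Finset.sum_nonneg fun k _ => by positivity),
      ← lintegral_finsetSum F fun k _ => (hmeas k).const_mul _]
    refine lintegral_congr fun t => ?_
    rw [ENNReal.ofReal_sum_of_nonneg fun k _ => by positivity]
    refine Finset.sum_congr rfl fun k _ => ?_
    rw [ENNReal.ofReal_mul (pow_nonneg (freqNorm_nonneg k) _), ofReal_norm,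
      ENNReal.ofReal_pow (freqNorm_nonneg k)]
    rfl
  · set g : ℝ → ℂ := fun r => -((freqNorm k ^ 4 : ℝ) : ℂ) * a r k - nlTerm ⊤ (a r) k with hg
    have hgc : ∀ r, 0 < r → ContinuousAt g r := fun r hr =>
      ((hcont k).continuousAt.const_mul _).sub (continuousAt_nlTerm hZ hcont hweight hr k)
    have hgon : ContinuousOn g (Ioi 0) := fun r hr => (hgc r hr).continuousWithinAt
    have h2 : 0 < t / 2 := half_pos ht
    have hd : HasDerivAt (fun s => ∫ r in (t / 2)..s, g r) (g t) t := by
      refine intervalIntegral.integral_hasDerivAt_right ?_ ?_ (hgc t ht)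
      · refine ContinuousOn.intervalIntegrable (hgon.mono fun r hr => ?_)
        rw [uIcc_of_le (by linarith)] at hr
        exact h2.trans_le hr.1
      · exact hgon.stronglyMeasurableAtFilter isOpen_Ioi t ht
    refine (hd.const_add (a (t / 2) k)).congr_of_eventuallyEq ?_
    filter_upwards [lt_mem_nhds (half_lt_self ht)] with s hs
    rw [← integral_equation hZ hU hφ hlim h2 hs.le k]
    ring

/-! ### Trigonometric series -/

/-- The linear phase `x ↦ k · x`. -/
def phase (k : Fin d → ℤ) : (Fin d → ℝ) →L[ℝ] ℝ :=
  ∑ i, (k i : ℝ) • ContinuousLinearMap.proj (R := ℝ) (φ := fun _ : Fin d => ℝ) i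

lemma phase_apply (k : Fin d → ℤ) (x : Fin d → ℝ) : phase k x = ∑ i, (k i : ℝ) * x i := by
  simp [phase]

lemma phase_single (k : Fin d → ℤ) (i : Fin d) : phase k (Pi.single i 1) = k i := by
  rw [phase_apply, Finset.sum_eq_single i]
  · simp
  · intro j _ hj; simp [hj]
  · simp

lemma norm_phase_le (k : Fin d → ℤ) : ‖phase k‖ ≤ d * freqNorm k := by
  have hk := freqNorm_nonneg k
  refine ContinuousLinearMap.opNorm_le_bound _ (by positivity) fun x => ?_
  rw [phase_apply]
  refine (norm_sum_le _ _).trans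
    ((Finset.sum_le_card_nsmul _ _ (freqNorm k * ‖x‖) fun i _ => ?_).trans (le_of_eq ?_))
  · rw [norm_mul, Real.norm_eq_abs]
    exact mul_le_mul (abs_le_freqNorm k i) (norm_le_pi_norm x i) (norm_nonneg _) hk
  · rw [Finset.card_univ, Fintype.card_fin, nsmul_eq_mul]; ring

/-- The character `e^{i k·x}`. -/
def chi (k : Fin d → ℤ) (x : Fin d → ℝ) : ℂ := Complex.exp ((phase k x : ℂ) * Complex.I)

lemma norm_chi (k : Fin d → ℤ) (x : Fin d → ℝ) : ‖chi k x‖ = 1 :=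
  Complex.norm_exp_ofReal_mul_I _

lemma chi_add (k l : Fin d → ℤ) (x : Fin d → ℝ) : chi (k + l) x = chi k x * chi l x := by
  rw [chi, chi, chi, ← Complex.exp_add, ← add_mul, ← Complex.ofReal_add]
  congr 3
  simp only [phase_apply, ← Finset.sum_add_distrib, Pi.add_apply, Int.cast_add, add_mul]

lemma chi_zero (x : Fin d → ℝ) : chi 0 x = 1 := by simp [chi, phase_apply]

lemma chi_neg (k : Fin d → ℤ) (x : Fin d → ℝ) : chi (-k) x = (starRingEnd ℂ) (chi k x) := by
  rw [chi, chi, ← Complex.exp_conj, map_mul, Complex.conj_ofReal, Complex.conj_I]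
  congr 1
  simp [phase_apply]

lemma chi_periodic (k : Fin d → ℤ) (x : Fin d → ℝ) (m : Fin d → ℤ) :
    chi k (fun i => x i + 2 * Real.pi * (m i : ℝ)) = chi k x := by
  have : ((phase k fun i => x i + 2 * Real.pi * (m i : ℝ) : ℝ) : ℂ) * Complex.I =
      (phase k x : ℂ) * Complex.I + ((∑ i, k i * m i : ℤ) : ℂ) * (2 * Real.pi * Complex.I) := by
    simp only [phase_apply, mul_add, Finset.sum_add_distrib]
    push_cast
    rw [add_mul, Finset.sum_mul, Finset.sum_mul, Finset.sum_mul]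
    congr 1
    exact Finset.sum_congr rfl fun i _ => by ring
  rw [chi, this, Complex.exp_add, Complex.exp_int_mul_two_pi_mul_I, mul_one, chi]

lemma continuous_chi (k : Fin d → ℤ) : Continuous (chi k) := by unfold chi; fun_prop

lemma hasFDerivAt_chi (k : Fin d → ℤ) (x : Fin d → ℝ) :
    HasFDerivAt (chi k) ((phase k).smulRight (chi k x * Complex.I)) x := by
  have h1 : HasDerivAt (fun s : ℝ => Complex.exp ((s : ℂ) * Complex.I))
      (Complex.exp ((phase k x : ℂ) * Complex.I) * (1 * Complex.I)) (phase k x) :=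
    ((Complex.ofRealCLM.hasDerivAt (x := phase k x)).mul_const Complex.I).cexp
  have h2 := h1.hasFDerivAt.comp x (phase k).hasFDerivAt
  refine h2.congr_fderiv ?_
  ext v
  simp [chi]

/-- The function with Fourier coefficients `c`. -/
def series (c : (Fin d → ℤ) → ℂ) (x : Fin d → ℝ) : ℂ := ∑' k, c k * chi k x

/-- The real part of `series c`; for Hermitian `c` the two agree. -/
def rseries (c : (Fin d → ℤ) → ℂ) (x : Fin d → ℝ) : ℝ := (series c x).re

section series

variable {c : (Fin d → ℤ) → ℂ}

lemma norm_mul_chi (k : Fin d → ℤ) (x : Fin d → ℝ) : ‖c k * chi k x‖ = ‖c k‖ := by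
  rw [norm_mul, norm_chi, mul_one]

lemma summable_mul_chi (hc : Summable fun k => ‖c k‖) (x : Fin d → ℝ) :
    Summable fun k => c k * chi k x :=
  Summable.of_norm (hc.congr fun k => (norm_mul_chi k x).symm)

lemma norm_series_le (hc : Summable fun k => ‖c k‖) (x : Fin d → ℝ) :
    ‖series c x‖ ≤ ∑' k, ‖c k‖ :=
  tsum_of_norm_bounded hc.hasSum fun k => (norm_mul_chi k x).le

lemma abs_rseries_le (hc : Summable fun k => ‖c k‖) (x : Fin d → ℝ) :
    |rseries c x| ≤ ∑' k, ‖c k‖ :=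
  (Complex.abs_re_le_norm _).trans (norm_series_le hc x)

lemma continuous_series (hc : Summable fun k => ‖c k‖) : Continuous (series c) :=
  continuous_tsum (fun k => continuous_const.mul (continuous_chi k)) hc
    fun k x => (norm_mul_chi k x).le

lemma continuous_rseries (hc : Summable fun k => ‖c k‖) : Continuous (rseries c) :=
  Complex.continuous_re.comp (continuous_series hc)

lemma rseries_periodic (c : (Fin d → ℤ) → ℂ) : IsPeriodic (rseries c) := by
  intro x m
  simp only [rseries, series, chi_periodic]

lemma series_eq_ofReal (hc : IsHermitian c) (x : Fin d → ℝ) : series c x = (rseries c x : ℂ) := by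
  refine (Complex.conj_eq_iff_re.mp ?_).symm
  rw [series, Complex.conj_tsum, ← (Equiv.neg (Fin d → ℤ)).tsum_eq]
  refine tsum_congr fun k => ?_
  rw [Equiv.neg_apply, hc, chi_neg, map_mul, Complex.conj_conj, Complex.conj_conj]

/-- Convolution of coefficients corresponds to multiplication of functions. -/
lemma series_mul {b : (Fin d → ℤ) → ℂ} (hc : Summable fun k => ‖c k‖)
    (hb : Summable fun k => ‖b k‖) :
    (Summable fun k => ‖conv c b k‖) ∧ ∀ x, series (conv c b) x = series c x * series b x := by
  -- the change of summation indices `(k, l) ↦ (l, k - l)`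
  let e : (Fin d → ℤ) × (Fin d → ℤ) ≃ (Fin d → ℤ) × (Fin d → ℤ) :=
    { toFun := fun p => (p.2, p.1 - p.2)
      invFun := fun p => (p.1 + p.2, p.1)
      left_inv := fun p => by simp
      right_inv := fun p => by simp }
  have hprod : Summable fun p : (Fin d → ℤ) × (Fin d → ℤ) => ‖c p.1‖ * ‖b p.2‖ :=
    hc.mul_of_nonneg hb (fun _ => norm_nonneg _) fun _ => norm_nonneg _
  have hprod' : Summable fun p : (Fin d → ℤ) × (Fin d → ℤ) => ‖c p.2 * b (p.1 - p.2)‖ :=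
    ((e.summable_iff).mpr hprod).congr fun p => by simp [e]
  have hin : ∀ k, Summable fun l => ‖c l * b (k - l)‖ := fun k => hprod'.prod_factor k
  refine ⟨Summable.of_nonneg_of_le (fun _ => norm_nonneg _)
    (fun k => norm_tsum_le_tsum_norm (hin k)) hprod'.prod, fun x => ?_⟩
  have hsx : Summable fun p : (Fin d → ℤ) × (Fin d → ℤ) => c p.2 * b (p.1 - p.2) * chi p.1 x :=
    Summable.of_norm (hprod'.congr fun p => by
      rw [norm_mul _ (chi p.1 x), norm_chi, mul_one])
  calc series (conv c b) x = ∑' k, ∑' l, c l * b (k - l) * chi k x := by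
        refine tsum_congr fun k => ?_
        rw [conv, tsum_mul_right]
    _ = ∑' p : (Fin d → ℤ) × (Fin d → ℤ), c p.2 * b (p.1 - p.2) * chi p.1 x :=
        (hsx.tsum_prod' fun k => hsx.prod_factor k).symm
    _ = ∑' p : (Fin d → ℤ) × (Fin d → ℤ), (c p.1 * chi p.1 x) * (b p.2 * chi p.2 x) := by
        rw [← e.tsum_eq fun p => (c p.1 * chi p.1 x) * (b p.2 * chi p.2 x)]
        refine tsum_congr fun p => ?_
        have : chi p.1 x = chi p.2 x * chi (p.1 - p.2) x := by rw [← chi_add]; simp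
        simp only [e, Equiv.coe_fn_mk, this]
        ring
    _ = _ := (tsum_mul_tsum_of_summable_norm
        (hc.congr fun k => (norm_mul_chi k x).symm)
        (hb.congr fun k => (norm_mul_chi k x).symm)).symm

/-- Two summability conditions that make the series continuously differentiable. -/
lemma contDiff_series (hc : Summable fun k => ‖c k‖)
    (hc1 : Summable fun k => freqNorm k * ‖c k‖) :
    ContDiff ℝ 1 (series c) ∧
      ∀ i x, fderiv ℝ (series c) x (Pi.single i 1) = series (dcoef i c) x := by
  set f' : (Fin d → ℤ) → (Fin d → ℝ) → ((Fin d → ℝ) →L[ℝ] ℂ) := fun k x =>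
    c k • ((phase k).smulRight (chi k x * Complex.I)) with hf'
  have hbound : ∀ k x, ‖f' k x‖ ≤ d * (freqNorm k * ‖c k‖) := by
    intro k x
    rw [hf', norm_smul, ContinuousLinearMap.norm_smulRight_apply, norm_mul, norm_chi,
      Complex.norm_I, mul_one, mul_one]
    calc ‖c k‖ * ‖phase k‖ ≤ ‖c k‖ * (d * freqNorm k) := by gcongr; exact norm_phase_le k
      _ = _ := by ring
  have hu : Summable fun k => (d : ℝ) * (freqNorm k * ‖c k‖) := hc1.mul_left _
  have hder : ∀ x, HasFDerivAt (series c) (∑' k, f' k x) x := fun x =>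
    hasFDerivAt_tsum hu (fun k x => (hasFDerivAt_chi k x).const_mul (c k)) hbound
      (summable_mul_chi hc 0) x
  have hfd : fderiv ℝ (series c) = fun x => ∑' k, f' k x := funext fun x => (hder x).fderiv
  refine ⟨contDiff_one_iff_fderiv.mpr ⟨fun x => (hder x).differentiableAt, ?_⟩, fun i x => ?_⟩
  · rw [hfd]
    refine continuous_tsum (fun k => ?_) hu hbound
    have h1 : Continuous fun x => chi k x * Complex.I := (continuous_chi k).mul continuous_const
    exact ((ContinuousLinearMap.smulRightL ℝ (Fin d → ℝ) ℂ (phase k)).continuous.comp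
      h1).const_smul (c k)
  · rw [hfd]
    have hs : Summable fun k => f' k x := Summable.of_norm_bounded hu fun k => hbound k x
    rw [show (∑' k, f' k x) (Pi.single i 1) = ∑' k, f' k x (Pi.single i 1) from
      (ContinuousLinearMap.apply ℝ ℂ (Pi.single i (1 : ℝ) : Fin d → ℝ)).map_tsum hs]
    refine tsum_congr fun k => ?_
    simp only [hf', _root_.smul_apply, ContinuousLinearMap.smulRight_apply,
      phase_single, dcoef, smul_eq_mul, Complex.real_smul, Complex.ofReal_intCast]
    ring

lemma contDiff_rseries (hc : Summable fun k => ‖c k‖)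
    (hc1 : Summable fun k => freqNorm k * ‖c k‖) : ContDiff ℝ 1 (rseries c) :=
  Complex.reCLM.contDiff.comp (contDiff_series hc hc1).1

lemma pderiv_rseries (hc : Summable fun k => ‖c k‖)
    (hc1 : Summable fun k => freqNorm k * ‖c k‖) (i : Fin d) :
    pderiv i (rseries c) = rseries (dcoef i c) := by
  obtain ⟨h1, h2⟩ := contDiff_series hc hc1
  funext x
  have h3 : HasFDerivAt (rseries c) (Complex.reCLM.comp (fderiv ℝ (series c) x)) x :=
    Complex.reCLM.hasFDerivAt.comp x ((h1.differentiable one_ne_zero) x).hasFDerivAt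
  rw [pderiv, h3.fderiv, rseries, ← h2]
  rfl

end series

/-! ### Integration over the cell -/

instance : IsFiniteMeasure (torusMeasure d) := by
  unfold torusMeasure cell
  exact isFiniteMeasure_restrict.mpr isCompact_Icc.measure_ne_top

lemma integrable_of_continuous {E : Type*} [NormedAddCommGroup E] {g : (Fin d → ℝ) → E}
    (hg : Continuous g) : Integrable g (torusMeasure d) :=
  hg.continuousOn.integrableOn_compact isCompact_Icc

/-- The integral of a derivative over a period cell vanishes. -/
lemma integral_fderiv_eq_zero {E : Type*} [NormedAddCommGroup E] [NormedSpace ℝ E]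
    {g : (Fin d → ℝ) → E} (hg : ContDiff ℝ 1 g)
    (hper : ∀ x (m : Fin d → ℤ), g (fun i => x i + 2 * Real.pi * (m i : ℝ)) = g x) (i : Fin d) :
    ∫ x, fderiv ℝ g x (Pi.single i 1) ∂(torusMeasure d) = 0 := by
  obtain ⟨n, rfl⟩ : ∃ n, d = n + 1 := ⟨d - 1, by have := i.pos; omega⟩
  have hcont : Continuous fun x => fderiv ℝ g x (Pi.single i 1) :=
    (hg.continuous_fderiv one_ne_zero).clm_apply continuous_const
  have hpi : (fun _ => -Real.pi : Fin (n + 1) → ℝ) ≤ fun _ => Real.pi := fun _ => by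
    simp only; linarith [Real.pi_pos]
  have hsum : ∀ x, ∑ j, (if j = i then fderiv ℝ g x else 0) (Pi.single j 1) =
      fderiv ℝ g x (Pi.single i 1) := fun x => by
    rw [Finset.sum_eq_single i]
    · simp
    · intro j _ hj; simp [hj]
    · simp
  -- the divergence theorem for the vector field with the single component `g` in direction `i`
  have key := integral_divergence_of_hasFDerivAt_off_countable' (fun _ => -Real.pi)
    (fun _ => Real.pi) hpi (fun j x => if j = i then g x else 0)
    (fun j x => if j = i then fderiv ℝ g x else 0) ∅ countable_empty (fun j => by
      split_ifs
      · exact hg.continuous.continuousOn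
      · exact continuousOn_const) (fun x _ j => by
      split_ifs
      · exact ((hg.differentiable one_ne_zero) x).hasFDerivAt
      · exact hasFDerivAt_const _ _) (by
      simp only [hsum]
      exact integrable_of_continuous hcont)
  simp only [hsum] at key
  rw [torusMeasure, cell, key]
  refine Finset.sum_eq_zero fun j _ => ?_
  split_ifs with hj
  · subst hj
    rw [sub_eq_zero]
    refine integral_congr_ae (ae_of_all _ fun y => ?_)
    simp only
    rw [← hper (j.insertNth (-Real.pi) y) (Pi.single j 1)]
    congr 1
    funext l
    rcases eq_or_ne l j with rfl | hl
    · simp; ring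
    · obtain ⟨m, rfl⟩ := Fin.exists_succAbove_eq hl
      simp
  · simp

lemma integral_mul_pderiv {f ψ : (Fin d → ℝ) → ℝ} (hf : ContDiff ℝ 1 f) (hψ : ContDiff ℝ 1 ψ)
    (hfp : IsPeriodic f) (hψp : IsPeriodic ψ) (i : Fin d) :
    ∫ x, f x * pderiv i ψ x ∂(torusMeasure d) = -∫ x, pderiv i f x * ψ x ∂(torusMeasure d) := by
  have h := integral_fderiv_eq_zero (hf.mul hψ) (fun x m => by
    simp only [hfp x m, hψp x m]) i
  have hd : ∀ x, fderiv ℝ (fun x => f x * ψ x) x (Pi.single i 1) =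
      f x * pderiv i ψ x + pderiv i f x * ψ x := fun x => by
    rw [fderiv_fun_mul ((hf.differentiable one_ne_zero) x) ((hψ.differentiable one_ne_zero) x)]
    simp [pderiv]
    ring
  have hc : ∀ {g : (Fin d → ℝ) → ℝ}, ContDiff ℝ 1 g → Continuous (pderiv i g) := fun hg =>
    (hg.continuous_fderiv one_ne_zero).clm_apply continuous_const
  simp only [hd] at h
  rw [integral_add (f := fun x => f x * pderiv i ψ x) (g := fun x => pderiv i f x * ψ x)
    (integrable_of_continuous (hf.continuous.mul (hc hψ)))
    (integrable_of_continuous ((hc hf).mul hψ.continuous))] at h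
  linarith

lemma contDiff_chi (k : Fin d → ℤ) : ContDiff ℝ ∞ (chi k) := by
  unfold chi
  exact ((Complex.ofRealCLM.contDiff.comp (phase k).contDiff).mul contDiff_const).cexp

lemma integral_chi (k : Fin d → ℤ) :
    ∫ x, chi k x ∂(torusMeasure d) = if k = 0 then ((2 * Real.pi : ℝ) : ℂ) ^ d else 0 := by
  split_ifs with hk
  · subst hk
    simp only [chi_zero, integral_const, torusMeasure, cell]
    rw [measureReal_restrict_apply_univ, measureReal_def, Real.volume_Icc_pi_toReal]
    · simp [two_mul]
    · intro _; simp only; linarith [Real.pi_pos]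
  · obtain ⟨i, hi⟩ := Function.ne_iff.mp hk
    have h := integral_fderiv_eq_zero ((contDiff_chi k).of_le (by simp)) (chi_periodic k) i
    simp only [(hasFDerivAt_chi k _).fderiv, ContinuousLinearMap.smulRight_apply, phase_single,
      integral_smul, integral_mul_const] at h
    have h' : k i = 0 ∨ ∫ x, chi k x ∂(torusMeasure d) = 0 := by simpa using h
    exact h'.resolve_left hi

/-- The pairing `∫ ψ e^{i k·x} dx`. -/
def pairing (ψ : (Fin d → ℝ) → ℝ) (k : Fin d → ℤ) : ℂ := ∫ x, chi k x * (ψ x : ℂ) ∂(torusMeasure d)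

lemma pairing_pderiv {ψ : (Fin d → ℝ) → ℝ} (hψ : ContDiff ℝ 1 ψ) (hψp : IsPeriodic ψ) (i : Fin d)
    (k : Fin d → ℤ) : pairing (pderiv i ψ) k = -(Complex.I * (k i : ℂ)) * pairing ψ k := by
  have hψc : ContDiff ℝ 1 fun x => (ψ x : ℂ) := Complex.ofRealCLM.contDiff.comp hψ
  have hχ : ContDiff ℝ 1 (chi k) := (contDiff_chi k).of_le (by simp)
  have h := integral_fderiv_eq_zero (hχ.mul hψc) (fun x m => by
    simp only [chi_periodic, hψp x m]) i
  have hd : ∀ x, fderiv ℝ (fun x => chi k x * (ψ x : ℂ)) x (Pi.single i 1) =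
      chi k x * (pderiv i ψ x : ℂ) + Complex.I * (k i : ℂ) * (chi k x * (ψ x : ℂ)) := fun x => by
    have h1 : HasFDerivAt (fun x => (ψ x : ℂ)) (Complex.ofRealCLM.comp (fderiv ℝ ψ x)) x :=
      Complex.ofRealCLM.hasFDerivAt.comp x ((hψ.differentiable one_ne_zero) x).hasFDerivAt
    rw [((hasFDerivAt_chi k x).fun_mul h1).fderiv]
    simp [pderiv, phase_single]
    ring
  have hc : Continuous fun x => (pderiv i ψ x : ℂ) := Complex.continuous_ofReal.comp
    ((hψ.continuous_fderiv one_ne_zero).clm_apply continuous_const)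
  simp only [hd] at h
  rw [integral_add (f := fun x => chi k x * (pderiv i ψ x : ℂ))
    (g := fun x => Complex.I * (k i : ℂ) * (chi k x * (ψ x : ℂ)))
    (integrable_of_continuous ((continuous_chi k).mul hc))
    (integrable_of_continuous (continuous_const.mul ((continuous_chi k).mul hψc.continuous))),
    integral_const_mul] at h
  rw [pairing, pairing, neg_mul]
  exact eq_neg_of_add_eq_zero_left h

lemma integral_series_mul {c : (Fin d → ℤ) → ℂ} (hc : Summable fun k => ‖c k‖)
    {ψ : (Fin d → ℝ) → ℂ} (hψ : Integrable ψ (torusMeasure d)) :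
    HasSum (fun k => c k * ∫ x, chi k x * ψ x ∂(torusMeasure d))
      (∫ x, series c x * ψ x ∂(torusMeasure d)) := by
  have hint : ∀ k, Integrable (fun x => c k * (chi k x * ψ x)) (torusMeasure d) := fun k =>
    (hψ.bdd_mul (c := 1) (continuous_chi k).aestronglyMeasurable
      (ae_of_all _ fun x => (norm_chi k x).le)).const_mul (c k)
  have hn : ∀ k, ∫ x, ‖c k * (chi k x * ψ x)‖ ∂(torusMeasure d) =
      ‖c k‖ * ∫ x, ‖ψ x‖ ∂(torusMeasure d) := fun k => by
    rw [← integral_const_mul]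
    refine integral_congr_ae (ae_of_all _ fun x => ?_)
    simp [norm_chi]
  have h := hasSum_integral_of_summable_integral_norm hint
    ((hc.mul_right (∫ x, ‖ψ x‖ ∂(torusMeasure d))).congr fun k => (hn k).symm)
  simp only [integral_const_mul] at h
  have he : ∀ x, series c x * ψ x = ∑' k, c k * (chi k x * ψ x) := fun x => by
    rw [series, ← tsum_mul_right]
    exact tsum_congr fun k => mul_assoc _ _ _
  simpa only [he] using h

lemma fourierCoef_eq (u : (Fin d → ℝ) → ℝ) (k : Fin d → ℤ) :
    fourierCoef u k = (1 / (2 * (Real.pi : ℂ)) ^ d) * pairing u (-k) := by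
  rw [fourierCoef, pairing]
  congr 1
  refine integral_congr_ae (ae_of_all _ fun x => ?_)
  simp only
  rw [mul_comm, chi_neg, chi, ← Complex.exp_conj, map_mul, Complex.conj_ofReal, Complex.conj_I,
    phase_apply]
  congr 2
  ring

lemma fourierCoef_rseries {c : (Fin d → ℤ) → ℂ} (hc : Summable fun k => ‖c k‖)
    (hh : IsHermitian c) (k : Fin d → ℤ) : fourierCoef (rseries c) k = c k := by
  have h := integral_series_mul hc (integrable_of_continuous (continuous_chi (-k)))
  have h2 : HasSum (fun l => c l * ∫ x, chi l x * chi (-k) x ∂(torusMeasure d))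
      (c k * ((2 * Real.pi : ℝ) : ℂ) ^ d) := by
    have h3 : ∀ l, c l * ∫ x, chi l x * chi (-k) x ∂(torusMeasure d) =
        if l = k then c k * ((2 * Real.pi : ℝ) : ℂ) ^ d else 0 := fun l => by
      simp only [← chi_add, integral_chi, add_neg_eq_zero]
      split_ifs with hl
      · rw [hl]
      · simp
    simp only [h3]
    exact hasSum_ite_eq k _
  have hpi : ((2 : ℂ) * (Real.pi : ℂ)) ^ d ≠ 0 :=
    pow_ne_zero _ (mul_ne_zero two_ne_zero (by exact_mod_cast Real.pi_ne_zero))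
  have h4 := h.unique h2
  rw [fourierCoef_eq, pairing]
  simp only [← series_eq_ofReal hh, mul_comm (chi (-k) _), h4]
  push_cast
  field_simp

/-! ### Bochner spaces of Fourier coefficients -/

lemma summable_norm_lp (F : lp (fun _ : Fin d → ℤ => ℂ) 1) : Summable fun k => ‖F k‖ := by
  simpa using (lp.memℓp F).summable (by simp)

lemma norm_lp_one (F : lp (fun _ : Fin d → ℤ => ℂ) 1) : ‖F‖ = ∑' k, ‖F k‖ := by
  simp [lp.norm_eq_tsum_rpow (p := 1) (by simp) F]

/-- The map from summable coefficients to bounded continuous functions. -/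
def lpSeries : lp (fun _ : Fin d → ℤ => ℂ) 1 →L[ℝ] BoundedContinuousFunction (Fin d → ℝ) ℝ :=
  LinearMap.mkContinuous
    { toFun := fun F => BoundedContinuousFunction.ofNormedAddCommGroup (rseries F)
        (continuous_rseries (summable_norm_lp F)) (∑' k, ‖F k‖)
        fun x => abs_rseries_le (summable_norm_lp F) x
      map_add' := fun F G => by
        ext x
        have h := (summable_mul_chi (summable_norm_lp F) x).tsum_add
          (summable_mul_chi (summable_norm_lp G) x)
        simp only [← add_mul] at h
        simp [rseries, series, h]
      map_smul' := fun r F => by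
        ext x
        simp [rseries, series, mul_assoc, tsum_mul_left] }
    1 fun F => by
      rw [one_mul, norm_lp_one]
      exact BoundedContinuousFunction.norm_ofNormedAddCommGroup_le _
        (tsum_nonneg fun _ => norm_nonneg _) fun x => abs_rseries_le (summable_norm_lp F) x

lemma lpSeries_apply (F : lp (fun _ : Fin d → ℤ => ℂ) 1) (x : Fin d → ℝ) :
    lpSeries F x = rseries F x := rfl

open Classical in
/-- A summable sequence as an element of `ℓ¹`; other sequences are sent to `0`. -/
def toLpOne (x : (Fin d → ℤ) → ℂ) : lp (fun _ : Fin d → ℤ => ℂ) 1 :=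
  if h : Memℓp x 1 then ⟨x, h⟩ else 0

lemma coe_toLpOne {x : (Fin d → ℤ) → ℂ} (h : Summable fun k => ‖x k‖) : ⇑(toLpOne x) = x := by
  have : Memℓp x 1 := memℓp_gen (by simpa using h)
  rw [toLpOne, dif_pos this]

lemma enorm_toLpOne_le (x : (Fin d → ℤ) → ℂ) : ‖toLpOne x‖ₑ ≤ ∑' k, ‖x k‖ₑ := by
  by_cases h : Memℓp x 1
  · have hs : Summable fun k => ‖x k‖ := by simpa using h.summable (by simp)
    rw [← ofReal_norm, norm_lp_one, coe_toLpOne hs,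
      ENNReal.ofReal_tsum_of_nonneg (fun _ => norm_nonneg _) hs]
    simp
  · simp [toLpOne, h]

lemma aestronglyMeasurable_lp {α : Type*} [MeasurableSpace α] {μ : Measure α}
    {F : α → lp (fun _ : Fin d → ℤ => ℂ) 1}
    (hF : ∀ k, AEStronglyMeasurable (fun t => F t k) μ) : AEStronglyMeasurable F μ := by
  classical
  refine aestronglyMeasurable_of_tendsto_ae (atTop : Filter (Finset (Fin d → ℤ)))
    (f := fun s t => ∑ k ∈ s, lp.single (E := fun _ : Fin d → ℤ => ℂ) 1 k (F t k))
    (fun s => ?_) (ae_of_all _ fun t => lp.hasSum_single (by simp) (F t))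
  refine Finset.aestronglyMeasurable_fun_sum _ fun k _ => ?_
  have hc : Continuous fun z : ℂ => lp.single (E := fun _ : Fin d → ℤ => ℂ) 1 k z := by
    refine (isometry_iff_dist_eq.mpr fun z w => ?_ : Isometry _).continuous
    rw [dist_eq_norm, ← lp.single_sub (E := fun _ : Fin d → ℤ => ℂ) 1 k z w, dist_eq_norm]
    exact lp.norm_single (E := fun _ : Fin d → ℤ => ℂ) (by simp) k (z - w)
  exact hc.comp_aestronglyMeasurable (hF k)

section bochner

variable {x : ℝ → (Fin d → ℤ) → ℂ} {T : ℝ}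

lemma aestronglyMeasurable_toLpOne (hm : ∀ k, Measurable fun t => x t k)
    (hs : ∀ᵐ t ∂(timeMeasure T), Summable fun k => ‖x t k‖) :
    AEStronglyMeasurable (fun t => toLpOne (x t)) (timeMeasure T) := by
  refine aestronglyMeasurable_lp fun k => ?_
  refine (hm k).aestronglyMeasurable.congr ?_
  filter_upwards [hs] with t ht
  rw [coe_toLpOne ht]

lemma summable_norm_of_tsum_enorm_ne_top {ι : Type*} {x : ι → ℂ} (h : ∑' k, ‖x k‖ₑ ≠ ⊤) :
    Summable fun k => ‖x k‖ := by
  simpa using ENNReal.summable_toReal h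

lemma memLp_toLpOne (hm : ∀ k, Measurable fun t => x t k) {p : ℝ} (hp : 0 < p)
    (h : ∫⁻ t, (∑' k, ‖x t k‖ₑ) ^ p ∂(timeMeasure T) ≠ ⊤) :
    (∀ᵐ t ∂(timeMeasure T), Summable fun k => ‖x t k‖) ∧
      MemLp (fun t => toLpOne (x t)) (ENNReal.ofReal p) (timeMeasure T) := by
  have hmeas : Measurable fun t => (∑' k, ‖x t k‖ₑ) ^ p :=
    (Measurable.tsum fun k => (hm k).enorm).pow_const p
  have hs : ∀ᵐ t ∂(timeMeasure T), Summable fun k => ‖x t k‖ := by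
    filter_upwards [ae_lt_top hmeas h] with t ht
    refine summable_norm_of_tsum_enorm_ne_top fun htop => ?_
    rw [htop, ENNReal.top_rpow_of_pos hp] at ht
    exact lt_irrefl _ ht
  refine ⟨hs, aestronglyMeasurable_toLpOne hm hs, ?_⟩
  rw [eLpNorm_lt_top_iff_lintegral_rpow_enorm_lt_top (by simpa using hp) ENNReal.ofReal_ne_top,
    ENNReal.toReal_ofReal hp.le]
  refine lt_of_le_of_lt (lintegral_mono fun t => ?_) h.lt_top
  exact ENNReal.rpow_le_rpow (enorm_toLpOne_le _) hp.le

lemma memLp_top_toLpOne (hm : ∀ k, Measurable fun t => x t k) {C : ℝ}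
    (h : ∀ᵐ t ∂(timeMeasure T), ∑' k, ‖x t k‖ₑ ≤ ENNReal.ofReal C) :
    (∀ᵐ t ∂(timeMeasure T), Summable fun k => ‖x t k‖) ∧
      MemLp (fun t => toLpOne (x t)) ⊤ (timeMeasure T) := by
  have hs : ∀ᵐ t ∂(timeMeasure T), Summable fun k => ‖x t k‖ := by
    filter_upwards [h] with t ht
    exact summable_norm_of_tsum_enorm_ne_top (ne_top_of_le_ne_top ENNReal.ofReal_ne_top ht)
  refine ⟨hs, memLp_top_of_bound (aestronglyMeasurable_toLpOne hm hs) (max C 0) ?_⟩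
  filter_upwards [h] with t ht
  refine norm_le_of_enorm_le (le_max_right _ _) ((enorm_toLpOne_le _).trans (ht.trans ?_))
  exact ENNReal.ofReal_le_ofReal (le_max_left _ _)

/-- Integrability of the coefficients in `ℓ¹` gives integrability of the functions in every
Lebesgue space. -/
lemma memBochner_rseries {q : ℝ≥0∞} (r : ℝ≥0∞) [Fact (1 ≤ r)]
    (h : (∀ᵐ t ∂(timeMeasure T), Summable fun k => ‖x t k‖) ∧
      MemLp (fun t => toLpOne (x t)) q (timeMeasure T)) :
    MemBochner q r T fun t => rseries (x t) := by
  obtain ⟨hs, hL⟩ := h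
  refine ⟨fun t => BoundedContinuousFunction.toLp r (torusMeasure d) ℝ (lpSeries (toLpOne (x t))),
    ((BoundedContinuousFunction.toLp r (torusMeasure d) ℝ).comp lpSeries).comp_memLp' hL, ?_⟩
  filter_upwards [hs] with t ht
  filter_upwards [BoundedContinuousFunction.coeFn_toLp (p := r) (torusMeasure d) ℝ
    (lpSeries (toLpOne (x t)))] with y hy
  rw [hy, lpSeries_apply, coe_toLpOne ht]

lemma memBochnerFourier_rseries {q : ℝ≥0∞} {w : ℝ → (Fin d → ℤ) → ℝ}
    (hx : ∀ᵐ t ∂(timeMeasure T), IsHermitian (x t) ∧ Summable fun k => ‖x t k‖)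
    (h : (∀ᵐ t ∂(timeMeasure T), Summable fun k => ‖(w t k : ℂ) * x t k‖) ∧
      MemLp (fun t => toLpOne fun k => (w t k : ℂ) * x t k) q (timeMeasure T)) :
    MemBochnerFourier q w T fun t => rseries (x t) := by
  obtain ⟨hs, hL⟩ := h
  refine ⟨_, hL, ?_⟩
  filter_upwards [hs, hx] with t ht ⟨hh, hsum⟩
  refine ⟨integrable_of_continuous (continuous_rseries hsum), fun k => ?_⟩
  rw [coe_toLpOne ht, fourierCoef_rseries hsum hh]

end bochner

/-! ### The nonlinearity in physical space -/

section physical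

variable {a : (Fin d → ℤ) → ℂ} {z : ℝ}

lemma series_delta (x : Fin d → ℝ) : series (delta : (Fin d → ℤ) → ℂ) x = 1 := by
  rw [series, tsum_eq_single 0]
  · simp [delta, chi_zero]
  · intro k hk; simp [delta, hk]

lemma tsum_enorm_eq_moment (a : (Fin d → ℤ) → ℂ) : ∑' k, ‖a k‖ₑ = moment 0 (eabs a) := by
  simp [moment, eabs]

lemma summable_of_moment_zero_le (ha : moment 0 (eabs a) ≤ ENNReal.ofReal z) :
    Summable fun k => ‖a k‖ :=
  summable_norm_of_tsum_enorm_ne_top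
    (ne_top_of_le_ne_top ENNReal.ofReal_ne_top (by rwa [tsum_enorm_eq_moment]))

lemma tsum_norm_le_of_moment_zero_le (hz0 : 0 ≤ z)
    (ha : moment 0 (eabs a) ≤ ENNReal.ofReal z) : ∑' k, ‖a k‖ ≤ z := by
  rw [← ENNReal.ofReal_le_ofReal_iff hz0, ENNReal.ofReal_tsum_of_nonneg (fun _ => norm_nonneg _)
    (summable_of_moment_zero_le ha)]
  simpa [moment, eabs] using ha

lemma summable_convPow (ha : Summable fun k => ‖a k‖) (m : ℕ) :
    (Summable fun k => ‖convPow a m k‖) ∧ ∀ x, series (convPow a m) x = series a x ^ m := by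
  induction m with
  | zero =>
    refine ⟨?_, fun x => by simp [convPow, series_delta]⟩
    refine summable_of_ne_finset_zero (s := {0}) fun k hk => ?_
    simp only [Finset.mem_singleton] at hk
    simp [convPow, delta, hk]
  | succ m ih =>
    obtain ⟨h1, h2⟩ := series_mul ha ih.1
    exact ⟨h1, fun x => by rw [convPow, h2, ih.2, pow_succ']⟩

lemma summable_neumann (hz0 : 0 ≤ z) (hz1 : z < 1)
    (ha : moment 0 (eabs a) ≤ ENNReal.ofReal z) (M : ℕ∞) :
    Summable fun k => ‖neumann M a k‖ := by
  refine summable_norm_of_tsum_enorm_ne_top (ne_top_of_le_ne_top ENNReal.ofReal_ne_top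
    ((ENNReal.tsum_le_tsum (enorm_neumann_le M a)).trans ?_) (b := ENNReal.ofReal (1 / (1 - z))))
  simpa [moment] using moment_zero_egeom_le hz0 hz1 ha

lemma summable_neumann_terms (hz0 : 0 ≤ z) (hz1 : z < 1)
    (ha : moment 0 (eabs a) ≤ ENNReal.ofReal z) (x : Fin d → ℝ) :
    Summable (Function.uncurry fun (k : Fin d → ℤ) (m : ℕ) =>
      (-1) ^ m * convPow a m k * chi k x) := by
  refine Summable.of_norm (summable_norm_of_tsum_enorm_ne_top
    (ne_top_of_le_ne_top (b := ENNReal.ofReal (1 / (1 - z))) ENNReal.ofReal_ne_top ?_))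
  rw [ENNReal.tsum_prod']
  refine le_trans ?_ (moment_zero_egeom_le hz0 hz1 ha)
  simp only [moment, pow_zero, one_mul]
  refine ENNReal.tsum_le_tsum fun k => ENNReal.tsum_le_tsum fun m => ?_
  have h : ‖(-1 : ℂ) ^ m * convPow a m k * chi k x‖ = ‖convPow a m k‖ := by
    rw [norm_mul, norm_chi, mul_one, norm_mul, norm_pow, norm_neg, norm_one, one_pow, one_mul]
  rw [Function.uncurry_apply_pair, ← ofReal_norm, h, ofReal_norm]
  exact enorm_convPow_le a m k

/-- The full Neumann series consists of the coefficients of `1 / (1 + u)`. -/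
lemma series_neumann (hz0 : 0 ≤ z) (hz1 : z < 1)
    (ha : moment 0 (eabs a) ≤ ENNReal.ofReal z) (x : Fin d → ℝ) :
    series (neumann ⊤ a) x = (1 + series a x)⁻¹ := by
  have hs := summable_of_moment_zero_le ha
  have hlt : ‖-series a x‖ < 1 := by
    rw [norm_neg]
    exact ((norm_series_le hs x).trans (tsum_norm_le_of_moment_zero_le hz0 ha)).trans_lt hz1
  have hsum := summable_neumann_terms hz0 hz1 ha x
  have h1 : ∀ k, neumann ⊤ a k * chi k x = ∑' m : ℕ, (-1) ^ m * convPow a m k * chi k x := by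
    intro k
    rw [neumann, ← tsum_mul_right]
    refine tsum_congr fun m => ?_
    rw [if_pos (ENat.natCast_lt_top m)]
  have h2 : ∀ m : ℕ, ∑' k, (-1) ^ m * convPow a m k * chi k x = (-series a x) ^ m := by
    intro m
    rw [neg_pow (series a x) m, ← (summable_convPow hs m).2 x, series, ← tsum_mul_left]
    exact tsum_congr fun k => by ring
  rw [series]
  simp only [h1]
  rw [← Summable.tsum_comm hsum]
  simp only [h2]
  rw [tsum_geometric_of_norm_lt_one hlt, sub_neg_eq_add]

end physical

/-! ### Weak derivatives of differentiable functions -/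

lemma IsPeriodic.pderiv {f : (Fin d → ℝ) → ℝ} (hf : IsPeriodic f) (i : Fin d) :
    IsPeriodic (pderiv i f) := by
  intro x m
  have h : (fun y : Fin d → ℝ => f (y + fun i => 2 * Real.pi * (m i : ℝ))) = f := by
    funext y
    exact hf y m
  have := fderiv_comp_add_right (𝕜 := ℝ) (f := f) (x := x) (fun i => 2 * Real.pi * (m i : ℝ))
  rw [h] at this
  rw [DLSS.pderiv, DLSS.pderiv, this]
  rfl

lemma continuous_pderiv {f : (Fin d → ℝ) → ℝ} (hf : ContDiff ℝ 1 f) (i : Fin d) :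
    Continuous (pderiv i f) :=
  (hf.continuous_fderiv one_ne_zero).clm_apply continuous_const

lemma contDiff_pderiv {ψ : (Fin d → ℝ) → ℝ} (hψ : ContDiff ℝ ∞ ψ) (i : Fin d) :
    ContDiff ℝ ∞ (pderiv i ψ) :=
  (hψ.fderiv_right (m := ∞) (by simp)).clm_apply contDiff_const

lemma hasWeakDeriv_pderiv {f : (Fin d → ℝ) → ℝ} (hf : ContDiff ℝ 1 f) (hp : IsPeriodic f)
    (i : Fin d) : HasWeakDeriv i f (pderiv i f) :=
  ⟨integrable_of_continuous hf.continuous, integrable_of_continuous (continuous_pderiv hf i),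
    fun _ hψ hψp => integral_mul_pderiv hf (hψ.of_le (by simp)) hp hψp i⟩

lemma hasWeakDerivTwo_pderiv {f : (Fin d → ℝ) → ℝ} (hf : ContDiff ℝ 1 f) (hp : IsPeriodic f)
    {i : Fin d} (hfi : ContDiff ℝ 1 (pderiv i f)) (j : Fin d) :
    HasWeakDerivTwo i j f (pderiv j (pderiv i f)) := by
  refine ⟨integrable_of_continuous hf.continuous,
    integrable_of_continuous (continuous_pderiv hfi j), fun ψ hψ hψp => ?_⟩
  rw [integral_mul_pderiv hf ((contDiff_pderiv hψ j).of_le (by simp)) hp (hψp.pderiv j) i,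
    integral_mul_pderiv hfi (hψ.of_le (by simp)) (hp.pderiv i) hψp j, neg_neg]

section log

variable {f : (Fin d → ℝ) → ℝ}

lemma pderiv_log (hf : ContDiff ℝ 1 f) (hpos : ∀ x, 0 < f x + 1) (i : Fin d) :
    pderiv i (fun x => Real.log (f x + 1)) = fun x => pderiv i f x / (f x + 1) := by
  funext x
  have h : HasFDerivAt (fun x => Real.log (f x + 1)) ((f x + 1)⁻¹ • fderiv ℝ f x) x :=
    (((hf.differentiable one_ne_zero) x).hasFDerivAt.add_const 1).log (hpos x).ne'
  rw [pderiv, h.fderiv]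
  simp [pderiv, div_eq_inv_mul]

/-- The second weak derivatives of `log (u + 1)`. -/
lemma hasWeakDerivTwo_log (hf : ContDiff ℝ 1 f) (hp : IsPeriodic f) (hpos : ∀ x, 0 < f x + 1)
    {i : Fin d} (hfi : ContDiff ℝ 1 (pderiv i f)) (j : Fin d) :
    HasWeakDerivTwo i j (fun x => Real.log (f x + 1)) fun x =>
      pderiv j (pderiv i f) x / (f x + 1) - pderiv i f x * pderiv j f x / (f x + 1) ^ 2 := by
  have hf1 : ContDiff ℝ 1 fun x => f x + 1 := hf.add contDiff_const
  have hlog : ContDiff ℝ 1 fun x => Real.log (f x + 1) := hf1.log fun x => (hpos x).ne'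
  have hlogp : IsPeriodic fun x => Real.log (f x + 1) := fun x m => by simp only [hp x m]
  have h := hasWeakDerivTwo_pderiv hlog hlogp (i := i) (by
    rw [pderiv_log hf hpos]
    exact hfi.div hf1 fun x => (hpos x).ne') j
  rw [pderiv_log hf hpos] at h
  convert h using 1
  funext x
  have h1 := ((hfi.differentiable one_ne_zero) x).hasFDerivAt
  have h2 := ((hf1.differentiable one_ne_zero) x).hasFDerivAt
  have h3 : fderiv ℝ (fun x => f x + 1) x = fderiv ℝ f x := fderiv_add_const _
  have hne := (hpos x).ne'
  rw [h3] at h2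
  have h4 := h1.mul ((hasDerivAt_inv hne).hasFDerivAt.comp x h2)
  have h5 : (fun x => pderiv i f x / (f x + 1)) =
      pderiv i f * ((fun y => y⁻¹) ∘ fun x => f x + 1) := by
    funext y; simp [div_eq_mul_inv]
  have h6 := congrArg (fun D : (Fin d → ℝ) →L[ℝ] ℝ => D (Pi.single j 1)) h4.fderiv
  rw [← h5] at h6
  refine Eq.trans ?_ h6.symm
  simp [pderiv]
  field_simp
  ring

end log

/-! ### Uniqueness of Fourier coefficients of integrable functions -/

/-- The covering map of the torus, rescaled to period `2π`. -/
def toTorus (x : Fin d → ℝ) : UnitAddTorus (Fin d) :=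
  fun i => ((x i / (2 * Real.pi) : ℝ) : UnitAddCircle)

lemma mFourier_toTorus (k : Fin d → ℤ) (x : Fin d → ℝ) :
    UnitAddTorus.mFourier k (toTorus x) = chi k x := by
  have hpi : (Real.pi : ℂ) ≠ 0 := by exact_mod_cast Real.pi_ne_zero
  simp only [UnitAddTorus.mFourier, ContinuousMap.coe_mk, toTorus, fourier_coe_apply]
  rw [← Complex.exp_sum, chi, phase_apply]
  congr 1
  push_cast
  rw [Finset.sum_mul]
  refine Finset.sum_congr rfl fun i _ => ?_
  field_simp

lemma isOpenQuotientMap_toTorus : IsOpenQuotientMap (toTorus (d := d)) := by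
  have h1 : IsOpenQuotientMap (fun (x : Fin d → ℝ) (i : Fin d) => ((x i : ℝ) : UnitAddCircle)) :=
    IsOpenQuotientMap.piMap fun _ => QuotientAddGroup.isOpenQuotientMap_mk
  have h2 : (2 * Real.pi)⁻¹ ≠ 0 := by positivity
  have h3 := (Homeomorph.smulOfNeZero (α := Fin d → ℝ) _ h2).isOpenQuotientMap
  convert h1.comp h3 using 1
  funext x i
  simp [toTorus, div_eq_inv_mul]

/-- An integrable function with vanishing Fourier coefficients is orthogonal to continuous
periodic functions, because trigonometric polynomials are dense. -/
lemma integral_mul_eq_zero_of_pairing {f ψ : (Fin d → ℝ) → ℝ} (hf : Integrable f (torusMeasure d))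
    (h0 : ∀ k, pairing f k = 0) (hψ : Continuous ψ) (hψp : IsPeriodic ψ) :
    ∫ x, f x * ψ x ∂(torusMeasure d) = 0 := by
  have hcont : Continuous (toTorus (d := d)) := isOpenQuotientMap_toTorus.continuous
  have hint : ∀ Φ : C(UnitAddTorus (Fin d), ℂ),
      Integrable (fun x => Φ (toTorus x) * (f x : ℂ)) (torusMeasure d) := fun Φ =>
    hf.ofReal.bdd_mul (c := ‖Φ‖) (Φ.continuous.comp hcont).aestronglyMeasurable
      (ae_of_all _ fun x => Φ.norm_coe_le_norm _)
  -- integration against `f` as a continuous functional, which vanishes on trigonometric polynomials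
  let Λ : C(UnitAddTorus (Fin d), ℂ) →L[ℂ] ℂ := LinearMap.mkContinuous
    { toFun := fun Φ => ∫ x, Φ (toTorus x) * (f x : ℂ) ∂(torusMeasure d)
      map_add' := fun Φ Θ => by
        simp only [ContinuousMap.add_apply, add_mul]
        exact integral_add (hint Φ) (hint Θ)
      map_smul' := fun r Φ => by
        simp only [ContinuousMap.smul_apply, smul_eq_mul, mul_assoc, integral_const_mul,
          RingHom.id_apply] }
    (∫ x, ‖f x‖ ∂(torusMeasure d)) fun Φ => by
      refine (norm_integral_le_integral_norm _).trans ?_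
      rw [← integral_mul_const]
      refine integral_mono (hint Φ).norm (hf.norm.mul_const _) fun x => ?_
      simp only [norm_mul, Complex.norm_real]
      rw [mul_comm]
      gcongr
      exact Φ.norm_coe_le_norm _
  have hker : (Submodule.span ℂ (range (UnitAddTorus.mFourier (d := Fin d)))).topologicalClosure ≤
      Λ.ker := by
    refine Submodule.topologicalClosure_minimal _ (Submodule.span_le.mpr ?_) Λ.isClosed_ker
    rintro _ ⟨k, rfl⟩
    have := h0 k
    simp only [pairing, ← mFourier_toTorus] at this
    exact this
  -- `ψ` descends to the torus
  let g : C(Fin d → ℝ, ℂ) := ⟨fun x => (ψ x : ℂ), Complex.continuous_ofReal.comp hψ⟩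
  let π : C(Fin d → ℝ, UnitAddTorus (Fin d)) := ⟨toTorus, hcont⟩
  have hπ : Topology.IsQuotientMap π := isOpenQuotientMap_toTorus.isQuotientMap
  have hfac : Function.FactorsThrough g π := by
    intro x y hxy
    have : ∀ i, ∃ m : ℤ, x i + 2 * Real.pi * m = y i := by
      intro i
      have h1 := congrFun hxy i
      simp only [π, ContinuousMap.coe_mk, toTorus] at h1
      rw [← sub_eq_zero, ← AddCircle.coe_sub, AddCircle.coe_eq_zero_iff] at h1
      obtain ⟨m, hm⟩ := h1
      refine ⟨-m, ?_⟩
      have hpi := Real.pi_ne_zero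
      rw [← sub_div, eq_div_iff (by positivity)] at hm
      simp only [zsmul_eq_mul] at hm
      push_cast
      linarith
    choose m hm using this
    have h2 := hψp x m
    simp only [hm] at h2
    change (ψ x : ℂ) = (ψ y : ℂ)
    rw [← h2]
  let Ψ : C(UnitAddTorus (Fin d), ℂ) := hπ.lift g hfac
  have hΨ : ∀ x, Ψ (toTorus x) = (ψ x : ℂ) := fun x =>
    DFunLike.congr_fun (hπ.lift_comp g hfac) x
  have hΛ : Λ Ψ = 0 := by
    have : Ψ ∈ Λ.ker := hker (by rw [UnitAddTorus.span_mFourier_closure_eq_top]; trivial)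
    simpa using this
  have h3 : Λ Ψ = ((∫ x, f x * ψ x ∂(torusMeasure d) : ℝ) : ℂ) := by
    refine Eq.trans ?_ (integral_ofReal (𝕜 := ℂ))
    refine integral_congr_ae (ae_of_all _ fun x => ?_)
    simp only [hΨ]
    exact (mul_comm _ _).trans (Complex.ofReal_mul _ _).symm
  exact_mod_cast h3.symm.trans hΛ

/-! ### The solution at a fixed time -/

/-- Coefficients of a real function `u` with `|u|_0 ≤ Z` and `|u|_4 < ∞`; almost every time slice
of the solution is of this kind. -/
structure IsRegularSlice (Z : ℝ) (b : (Fin d → ℤ) → ℂ) : Prop where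
  herm : IsHermitian b
  moment_zero_le : moment 0 (eabs b) ≤ ENNReal.ofReal Z
  moment_four_ne_top : moment 4 (eabs b) ≠ ⊤

lemma moment_le_moment_four {i : ℕ} (hi : 1 ≤ i) (hi4 : i ≤ 4) (A : (Fin d → ℤ) → ℝ≥0∞) :
    moment i A ≤ moment 4 A := by
  refine ENNReal.tsum_le_tsum fun k => mul_le_mul' ?_ le_rfl
  by_cases hk : k = 0
  · subst hk
    simp [efreq, freqNorm_zero, zero_pow (by omega : i ≠ 0)]
  · have h1 : 1 ≤ efreq k := by
      rw [efreq, ← ENNReal.ofReal_one]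
      exact ENNReal.ofReal_le_ofReal (one_le_freqNorm hk)
    exact pow_le_pow_right₀ h1 hi4

lemma moment_dcoef_le (j : ℕ) (i : Fin d) (b : (Fin d → ℤ) → ℂ) :
    moment j (eabs (dcoef i b)) ≤ moment (j + 1) (eabs b) :=
  (moment_mono j (eabs_dcoef_le i b)).trans (moment_mul_efreq j _).le

lemma summable_of_moment_ne_top {j : ℕ} {b : (Fin d → ℤ) → ℂ} (h : moment j (eabs b) ≠ ⊤) :
    Summable fun k => freqNorm k ^ j * ‖b k‖ := by
  refine (ENNReal.summable_toReal h).congr fun k => ?_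
  rw [ENNReal.toReal_mul, ENNReal.toReal_pow, efreq, ENNReal.toReal_ofReal (freqNorm_nonneg k),
    eabs, toReal_enorm]

/-- Coefficients of the flux `(u + 1) ∂_i ∂_j log (u + 1) = ∂_i ∂_j u - ∂_i u ∂_j u / (u + 1)`. -/
def flux (b : (Fin d → ℤ) → ℂ) (i j : Fin d) (k : Fin d → ℤ) : ℂ :=
  dcoef j (dcoef i b) k - gradProd (neumann ⊤ b) b i j k

/-- The second derivative `∂_i ∂_j log (u + 1)`, where `u` has coefficients `b`. -/
def logHess (b : (Fin d → ℤ) → ℂ) (i j : Fin d) (x : Fin d → ℝ) : ℝ :=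
  rseries (dcoef j (dcoef i b)) x / (rseries b x + 1) -
    rseries (dcoef i b) x * rseries (dcoef j b) x / (rseries b x + 1) ^ 2

namespace IsRegularSlice

variable {Z : ℝ} {b : (Fin d → ℤ) → ℂ}

lemma moment_ne_top (h : IsRegularSlice Z b) {j : ℕ} (hj : j ≤ 4) : moment j (eabs b) ≠ ⊤ := by
  rcases Nat.eq_zero_or_pos j with rfl | hj1
  · exact ne_top_of_le_ne_top ENNReal.ofReal_ne_top h.moment_zero_le
  · exact ne_top_of_le_ne_top h.moment_four_ne_top (moment_le_moment_four hj1 hj _)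

lemma summable (h : IsRegularSlice Z b) : Summable fun k => ‖b k‖ :=
  summable_of_moment_zero_le h.moment_zero_le

lemma summable_freqNorm (h : IsRegularSlice Z b) : Summable fun k => freqNorm k * ‖b k‖ := by
  simpa using summable_of_moment_ne_top (h.moment_ne_top (j := 1) (by norm_num))

lemma moment_dcoef_ne_top (h : IsRegularSlice Z b) (i : Fin d) {j : ℕ} (hj : j ≤ 3) :
    moment j (eabs (dcoef i b)) ≠ ⊤ :=
  ne_top_of_le_ne_top (h.moment_ne_top (by omega)) (moment_dcoef_le j i b)

lemma summable_dcoef (h : IsRegularSlice Z b) (i : Fin d) : Summable fun k => ‖dcoef i b k‖ := by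
  simpa using summable_of_moment_ne_top (h.moment_dcoef_ne_top i (j := 0) (by norm_num))

lemma summable_freqNorm_dcoef (h : IsRegularSlice Z b) (i : Fin d) :
    Summable fun k => freqNorm k * ‖dcoef i b k‖ := by
  simpa using summable_of_moment_ne_top (h.moment_dcoef_ne_top i (j := 1) (by norm_num))

lemma summable_dcoef_dcoef (h : IsRegularSlice Z b) (i j : Fin d) :
    Summable fun k => ‖dcoef j (dcoef i b) k‖ :=
  (h.summable_freqNorm_dcoef i).of_nonneg_of_le (fun _ => norm_nonneg _) (norm_dcoef_le j _)

lemma contDiff (h : IsRegularSlice Z b) : ContDiff ℝ 1 (rseries b) :=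
  contDiff_rseries h.summable h.summable_freqNorm

lemma pderiv_eq (h : IsRegularSlice Z b) (i : Fin d) :
    pderiv i (rseries b) = rseries (dcoef i b) :=
  pderiv_rseries h.summable h.summable_freqNorm i

lemma contDiff_pderiv (h : IsRegularSlice Z b) (i : Fin d) :
    ContDiff ℝ 1 (pderiv i (rseries b)) := by
  rw [h.pderiv_eq]
  exact contDiff_rseries (h.summable_dcoef i) (h.summable_freqNorm_dcoef i)

lemma pderiv_pderiv_eq (h : IsRegularSlice Z b) (i j : Fin d) :
    pderiv j (pderiv i (rseries b)) = rseries (dcoef j (dcoef i b)) := by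
  rw [h.pderiv_eq, pderiv_rseries (h.summable_dcoef i) (h.summable_freqNorm_dcoef i)]

lemma pos (h : IsRegularSlice Z b) (hZ0 : 0 ≤ Z) (hZ1 : Z < 1) (x : Fin d → ℝ) :
    0 < rseries b x + 1 := by
  have h1 := (abs_rseries_le h.summable x).trans
    (tsum_norm_le_of_moment_zero_le hZ0 h.moment_zero_le)
  linarith [neg_abs_le (rseries b x)]

lemma hasWeakDeriv (h : IsRegularSlice Z b) (i : Fin d) :
    HasWeakDeriv i (rseries b) (rseries (dcoef i b)) := by
  rw [← h.pderiv_eq]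
  exact hasWeakDeriv_pderiv h.contDiff (rseries_periodic b) i

lemma hasWeakDerivTwo (h : IsRegularSlice Z b) (i j : Fin d) :
    HasWeakDerivTwo i j (rseries b) (rseries (dcoef j (dcoef i b))) := by
  rw [← h.pderiv_pderiv_eq]
  exact hasWeakDerivTwo_pderiv h.contDiff (rseries_periodic b) (h.contDiff_pderiv i) j

lemma hasWeakDerivTwo_log (h : IsRegularSlice Z b) (hZ0 : 0 ≤ Z) (hZ1 : Z < 1) (i j : Fin d) :
    HasWeakDerivTwo i j (fun x => Real.log (rseries b x + 1)) (logHess b i j) := by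
  have := DLSS.hasWeakDerivTwo_log h.contDiff (rseries_periodic b) (h.pos hZ0 hZ1)
    (h.contDiff_pderiv i) j
  rw [h.pderiv_pderiv_eq] at this
  simp only [h.pderiv_eq] at this
  exact this

lemma hermitian_flux (h : IsRegularSlice Z b) (i j : Fin d) : IsHermitian (flux b i j) := by
  intro k
  rw [flux, flux, ((h.herm.dcoef i).dcoef j) k, h.herm.gradProd ⊤ i j k, map_sub]

/-- Multiplied by `u + 1`, the second derivatives of `log (u + 1)` form the flux. -/
lemma logHess_mul (h : IsRegularSlice Z b) (hZ0 : 0 ≤ Z) (hZ1 : Z < 1) (i j : Fin d)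
    (x : Fin d → ℝ) : logHess b i j x * (rseries b x + 1) = rseries (flux b i j) x := by
  have hpos := (h.pos hZ0 hZ1 x).ne'
  obtain ⟨s1, e1⟩ := series_mul (h.summable_dcoef j) (summable_neumann hZ0 hZ1 h.moment_zero_le ⊤)
  obtain ⟨s2, e2⟩ := series_mul (h.summable_dcoef i) s1
  have e3 : series (flux b i j) x = series (dcoef j (dcoef i b)) x -
      series (gradProd (neumann ⊤ b) b i j) x := by
    simp only [series, flux, sub_mul]
    exact (summable_mul_chi (h.summable_dcoef_dcoef i j) x).tsum_sub (summable_mul_chi s2 x)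
  have e4 : series (gradProd (neumann ⊤ b) b i j) x = _ := e2 x
  rw [e4, e1, series_neumann hZ0 hZ1 h.moment_zero_le, series_eq_ofReal (h.hermitian_flux i j),
    series_eq_ofReal ((h.herm.dcoef i).dcoef j), series_eq_ofReal (h.herm.dcoef i),
    series_eq_ofReal (h.herm.dcoef j), series_eq_ofReal h.herm] at e3
  have e5 : rseries (flux b i j) x = rseries (dcoef j (dcoef i b)) x -
      rseries (dcoef i b) x * (rseries (dcoef j b) x * (1 + rseries b x)⁻¹) := by
    exact_mod_cast e3
  rw [e5, logHess, add_comm 1]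
  field_simp

lemma moment_flux_le (h : IsRegularSlice Z b) (hZ0 : 0 ≤ Z) (hZ1 : Z < 1) (i j : Fin d) :
    ∑' k, ‖flux b i j k‖ₑ ≤ ENNReal.ofReal (1 / (1 - Z)) * moment 4 (eabs b) := by
  have h24 := moment_le_moment_four (i := 2) (by norm_num) (by norm_num) (eabs b)
  have hA : ∑' k, ‖dcoef j (dcoef i b) k‖ₑ ≤ moment 2 (eabs b) := by
    rw [tsum_enorm_eq_moment]
    exact (moment_dcoef_le 0 j _).trans (moment_dcoef_le 1 i b)
  have hB : ∑' k, ‖gradProd (neumann ⊤ b) b i j k‖ₑ ≤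
      moment 1 (eabs b) ^ 2 * ENNReal.ofReal (1 / (1 - Z)) := by
    have h1 : moment 0 (fun k => efreq k * eabs b k) = moment 1 (eabs b) := moment_mul_efreq 0 _
    calc ∑' k, ‖gradProd (neumann ⊤ b) b i j k‖ₑ
        ≤ moment 0 (econv (fun k => efreq k * eabs b k)
          (econv (fun k => efreq k * eabs b k) (egeom (eabs b)))) := by
          rw [tsum_enorm_eq_moment]
          exact moment_mono 0 (enorm_gradProd_le ⊤ b i j)
      _ = moment 1 (eabs b) ^ 2 * moment 0 (egeom (eabs b)) := by
          rw [moment_zero_econv, moment_zero_econv, h1, sq, mul_assoc]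
      _ ≤ _ := by
          gcongr
          exact moment_zero_egeom_le hZ0 hZ1 h.moment_zero_le
  have hC : moment 1 (eabs b) ^ 2 ≤ ENNReal.ofReal Z * moment 2 (eabs b) :=
    (moment_sq_le 0 1 (eabs b)).trans (mul_le_mul' h.moment_zero_le le_rfl)
  calc ∑' k, ‖flux b i j k‖ₑ
      ≤ ∑' k, (‖dcoef j (dcoef i b) k‖ₑ + ‖gradProd (neumann ⊤ b) b i j k‖ₑ) :=
        ENNReal.tsum_le_tsum fun k => enorm_sub_le
    _ ≤ moment 2 (eabs b) +
          ENNReal.ofReal Z * moment 2 (eabs b) * ENNReal.ofReal (1 / (1 - Z)) := by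
        rw [ENNReal.tsum_add]
        exact add_le_add hA (hB.trans (mul_le_mul' hC le_rfl))
    _ = ENNReal.ofReal (1 / (1 - Z)) * moment 2 (eabs b) := by
        conv_rhs => rw [← geom_const_eq hZ0 hZ1]
        ring
    _ ≤ _ := by gcongr

lemma summable_flux (h : IsRegularSlice Z b) (hZ0 : 0 ≤ Z) (hZ1 : Z < 1) (i j : Fin d) :
    Summable fun k => ‖flux b i j k‖ :=
  summable_norm_of_tsum_enorm_ne_top (ne_top_of_le_ne_top
    (ENNReal.mul_ne_top ENNReal.ofReal_ne_top h.moment_four_ne_top) (h.moment_flux_le hZ0 hZ1 i j))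

end IsRegularSlice

/-- The double divergence of the flux consists of the bi-Laplacian and the nonlinearity. -/
lemma sum_flux (b : (Fin d → ℤ) → ℂ) (k : Fin d → ℤ) :
    ∑ i, ∑ j, -((k i : ℂ) * (k j : ℂ)) * flux b i j k =
      ((freqNorm k ^ 4 : ℝ) : ℂ) * b k + nlTerm ⊤ b k := by
  have h4 : ((freqNorm k ^ 4 : ℝ) : ℂ) = ∑ i, ∑ j, (k i : ℂ) ^ 2 * (k j : ℂ) ^ 2 := by
    rw [← Finset.sum_mul_sum, show freqNorm k ^ 4 = freqNorm k ^ 2 * freqNorm k ^ 2 by ring,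
      freqNorm_sq]
    push_cast
    rfl
  rw [h4, nlTerm, Finset.sum_mul, ← Finset.sum_add_distrib]
  refine Finset.sum_congr rfl fun i _ => ?_
  rw [Finset.sum_mul, ← Finset.sum_add_distrib]
  refine Finset.sum_congr rfl fun j _ => ?_
  rw [flux, dcoef, dcoef]
  linear_combination (-(k i : ℂ) ^ 2 * (k j : ℂ) ^ 2 * b k) * Complex.I_sq

/-- Hölder interpolation between the moments of order `0` and `4`. -/
lemma tsum_rpow_freqNorm_le {p : ℝ} (hp : 1 < p) (A : (Fin d → ℤ) → ℝ≥0∞) :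
    (∑' k, ENNReal.ofReal (freqNorm k ^ (4 / p)) * A k) ^ p ≤
      moment 0 A ^ (p - 1) * moment 4 A := by
  have hp0 : 0 < p := by linarith
  have hp' : 1 - p⁻¹ + p⁻¹ = 1 := by ring
  have hpi : p⁻¹ ≤ 1 := inv_le_one_of_one_le₀ hp.le
  have h := ENNReal.lintegral_mul_norm_pow_le (μ := (Measure.count : Measure (Fin d → ℤ)))
    (f := A) (g := fun k => efreq k ^ 4 * A k) (p := 1 - p⁻¹) (q := p⁻¹)
    (measurable_of_countable _).aemeasurable (measurable_of_countable _).aemeasurable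
    (by linarith) (by positivity) hp'
  rw [lintegral_count, lintegral_count, lintegral_count] at h
  have h1 : ∀ k, ENNReal.ofReal (freqNorm k ^ (4 / p)) * A k =
      A k ^ (1 - p⁻¹) * (efreq k ^ 4 * A k) ^ p⁻¹ := by
    intro k
    rw [ENNReal.mul_rpow_of_nonneg _ _ (by positivity), mul_left_comm,
      ← ENNReal.rpow_add_of_nonneg _ _ (by linarith) (by positivity), hp', ENNReal.rpow_one,
      ← ENNReal.rpow_natCast, ← ENNReal.rpow_mul, efreq,
      ENNReal.ofReal_rpow_of_nonneg (freqNorm_nonneg k) (by positivity)]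
    norm_num [div_eq_mul_inv]
  simp only [h1]
  refine (ENNReal.rpow_le_rpow h hp0.le).trans (le_of_eq ?_)
  rw [ENNReal.mul_rpow_of_nonneg _ _ hp0.le, ← ENNReal.rpow_mul, ← ENNReal.rpow_mul,
    inv_mul_cancel₀ hp0.ne', ENNReal.rpow_one, sub_mul, inv_mul_cancel₀ hp0.ne', one_mul]
  simp [moment]

/-! ### Regularity of the solution -/

lemma measurable_gradProd_neumann {a : ℝ → (Fin d → ℤ) → ℂ} (ha : ∀ k, Measurable fun t => a t k)
    (i j : Fin d) (k : Fin d → ℤ) :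
    Measurable fun t => gradProd (neumann ⊤ (a t)) (a t) i j k := by
  have hconv : ∀ x y : ℝ → (Fin d → ℤ) → ℂ, (∀ k, Measurable fun t => x t k) →
      (∀ k, Measurable fun t => y t k) → ∀ k, Measurable fun t => conv (x t) (y t) k :=
    fun x y hx hy k => Measurable.tsum fun l => (hx l).mul (hy _)
  have hpow : ∀ (m : ℕ) k, Measurable fun t => convPow (a t) m k := by
    intro m
    induction m with
    | zero => exact fun k => measurable_const
    | succ m ih => exact hconv a _ ha ih
  have hneu : ∀ k, Measurable fun t => neumann ⊤ (a t) k := fun k =>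
    Measurable.tsum fun m => by
      split_ifs
      exacts [(hpow m k).const_mul _, measurable_const]
  have hd : ∀ (i : Fin d) k, Measurable fun t => dcoef i (a t) k := fun i k => (ha k).const_mul _
  exact hconv _ _ (hd i) (hconv _ _ (hd j) hneu) k

instance (T : ℝ) : IsFiniteMeasure (timeMeasure T) := by
  unfold timeMeasure
  exact isFiniteMeasure_restrict.mpr measure_Ioo_lt_top.ne

/-- Functions with coefficients integrable in time with values in `ℓ¹` are integrable on
space-time. -/
lemma integrable_prod_rseries {x : ℝ → (Fin d → ℤ) → ℂ} {T : ℝ}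
    (hm : ∀ k, Measurable fun t => x t k)
    (h : ∫⁻ t, ∑' k, ‖x t k‖ₑ ∂(timeMeasure T) ≠ ⊤) :
    Integrable (fun z : ℝ × (Fin d → ℝ) => rseries (x z.1) z.2)
      ((timeMeasure T).prod (torusMeasure d)) := by
  have hmeas : Measurable fun z : ℝ × (Fin d → ℝ) => rseries (x z.1) z.2 :=
    Complex.measurable_re.comp (Measurable.tsum fun k =>
      ((hm k).comp measurable_fst).mul ((continuous_chi k).measurable.comp measurable_snd))
  refine ⟨hmeas.aestronglyMeasurable, ?_⟩
  rw [HasFiniteIntegral, lintegral_prod _ hmeas.enorm.aemeasurable]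
  calc ∫⁻ t, ∫⁻ y, ‖rseries (x t) y‖ₑ ∂(torusMeasure d) ∂(timeMeasure T)
      ≤ ∫⁻ t, ∫⁻ _, ∑' k, ‖x t k‖ₑ ∂(torusMeasure d) ∂(timeMeasure T) := by
        refine lintegral_mono fun t => lintegral_mono fun y => ?_
        have h1 : ‖rseries (x t) y‖ₑ ≤ ‖series (x t) y‖ₑ := by
          rw [← ofReal_norm, ← ofReal_norm]
          exact ENNReal.ofReal_le_ofReal (Complex.abs_re_le_norm _)
        refine h1.trans (enorm_tsum_le_tsum_enorm.trans (le_of_eq (tsum_congr fun k => ?_)))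
        rw [← ofReal_norm, norm_mul_chi, ofReal_norm]
    _ = (∫⁻ t, ∑' k, ‖x t k‖ₑ ∂(timeMeasure T)) * torusMeasure d univ := by
        simp only [lintegral_const]
        exact lintegral_mul_const _ (Measurable.tsum fun k => (hm k).enorm)
    _ < ⊤ := ENNReal.mul_lt_top h.lt_top (measure_lt_top _ _)

namespace IsCoefSolution

variable {c : (Fin d → ℤ) → ℂ} {Z : ℝ} {a : ℝ → (Fin d → ℤ) → ℂ}

lemma measurable (ha : IsCoefSolution c Z a) (k : Fin d → ℤ) : Measurable fun t => a t k :=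
  (ha.cont k).measurable

lemma moment_zero_le (hZ : IsSmallData c Z) (ha : IsCoefSolution c Z a) {t : ℝ} (ht : 0 ≤ t) :
    moment 0 (eabs (a t)) ≤ ENNReal.ofReal Z := by
  have := ha.weight_le 0 0 le_rfl le_rfl (by linarith [hZ.small]) t ht
  simpa [expWeight, moment] using this

lemma measurable_moment (ha : IsCoefSolution c Z a) (j : ℕ) :
    Measurable fun t => moment j (eabs (a t)) :=
  Measurable.tsum fun k => (ha.measurable k).enorm.const_mul _

lemma lintegral_moment_four_ne_top (ha : IsCoefSolution c Z a) (T : ℝ) :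
    ∫⁻ t, moment 4 (eabs (a t)) ∂(timeMeasure T) ≠ ⊤ :=
  ne_top_of_le_ne_top ENNReal.ofReal_ne_top
    ((lintegral_mono_set Ioo_subset_Ioc_self).trans (ha.lintegral_le T))

lemma ae_isRegularSlice (hZ : IsSmallData c Z) (ha : IsCoefSolution c Z a) (T : ℝ) :
    ∀ᵐ t ∂(timeMeasure T), IsRegularSlice Z (a t) := by
  filter_upwards [ae_lt_top (ha.measurable_moment 4) (ha.lintegral_moment_four_ne_top T),
    ae_restrict_mem measurableSet_Ioo] with t h4 ht
  exact ⟨ha.herm t, ha.moment_zero_le hZ ht.1.le, h4.ne⟩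

lemma ae_tsum_enorm_le (hZ : IsSmallData c Z) (ha : IsCoefSolution c Z a) (T : ℝ) :
    ∀ᵐ t ∂(timeMeasure T), ∑' k, ‖a t k‖ₑ ≤ ENNReal.ofReal Z := by
  filter_upwards [ha.ae_isRegularSlice hZ T] with t ht
  rw [tsum_enorm_eq_moment]
  exact ht.moment_zero_le

/-- Quantities controlled by the fourth moment are integrable in time. -/
lemma lintegral_ne_top (hZ : IsSmallData c Z) (ha : IsCoefSolution c Z a) {T : ℝ} {f : ℝ → ℝ≥0∞}
    {C : ℝ≥0∞} (hC : C ≠ ⊤)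
    (h : ∀ t, IsRegularSlice Z (a t) → f t ≤ C * moment 4 (eabs (a t))) :
    ∫⁻ t, f t ∂(timeMeasure T) ≠ ⊤ := by
  refine ne_top_of_le_ne_top (ENNReal.mul_ne_top hC (ha.lintegral_moment_four_ne_top T)) ?_
  rw [← lintegral_const_mul _ (ha.measurable_moment 4)]
  exact lintegral_mono_ae (by filter_upwards [ha.ae_isRegularSlice hZ T] with t ht using h t ht)

lemma memLp_top (hZ : IsSmallData c Z) (ha : IsCoefSolution c Z a) (T : ℝ) :
    (∀ᵐ t ∂(timeMeasure T), Summable fun k => ‖a t k‖) ∧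
      MemLp (fun t => toLpOne (a t)) ⊤ (timeMeasure T) :=
  memLp_top_toLpOne ha.measurable (ha.ae_tsum_enorm_le hZ T)

lemma memBochner (hZ : IsSmallData c Z) (ha : IsCoefSolution c Z a) (T : ℝ) (q r : ℝ≥0∞)
    [Fact (1 ≤ r)] : MemBochner q r T fun t => rseries (a t) :=
  memBochner_rseries r ⟨(ha.memLp_top hZ T).1, (ha.memLp_top hZ T).2.mono_exponent le_top⟩

lemma memBochner_dcoef_two (hZ : IsSmallData c Z) (ha : IsCoefSolution c Z a) (T : ℝ) (i : Fin d)
    (r : ℝ≥0∞) [Fact (1 ≤ r)] : MemBochner 2 r T fun t => rseries (dcoef i (a t)) := by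
  refine memBochner_rseries (x := fun t => dcoef i (a t)) r ?_
  have h := memLp_toLpOne (x := fun t => dcoef i (a t)) (T := T) (p := 2)
    (fun k => (ha.measurable k).const_mul _) two_pos ?_
  · simpa using h
  · refine ha.lintegral_ne_top hZ (C := ENNReal.ofReal Z) ENNReal.ofReal_ne_top fun t ht => ?_
    rw [tsum_enorm_eq_moment, ENNReal.rpow_two]
    calc moment 0 (eabs (dcoef i (a t))) ^ 2 ≤ moment 1 (eabs (a t)) ^ 2 := by
          gcongr
          exact moment_dcoef_le 0 i _
      _ ≤ moment 0 (eabs (a t)) * moment 2 (eabs (a t)) := moment_sq_le 0 1 _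
      _ ≤ _ := mul_le_mul' ht.moment_zero_le (moment_le_moment_four (by norm_num) (by norm_num) _)

lemma memBochner_dcoef_one (hZ : IsSmallData c Z) (ha : IsCoefSolution c Z a) (T : ℝ) (i : Fin d)
    (r : ℝ≥0∞) [Fact (1 ≤ r)] : MemBochner 1 r T fun t => rseries (dcoef i (a t)) := by
  refine memBochner_rseries (x := fun t => dcoef i (a t)) r ?_
  have h := memLp_toLpOne (x := fun t => dcoef i (a t)) (T := T) (p := 1)
    (fun k => (ha.measurable k).const_mul _) one_pos ?_
  · simpa using h
  · refine ha.lintegral_ne_top hZ (C := 1) ENNReal.one_ne_top fun t ht => ?_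
    rw [tsum_enorm_eq_moment, ENNReal.rpow_one, one_mul]
    exact (moment_dcoef_le 0 i _).trans (moment_le_moment_four (by norm_num) (by norm_num) _)

lemma memBochner_dcoef_dcoef (hZ : IsSmallData c Z) (ha : IsCoefSolution c Z a) (T : ℝ)
    (i j : Fin d) (r : ℝ≥0∞) [Fact (1 ≤ r)] :
    MemBochner 1 r T fun t => rseries (dcoef j (dcoef i (a t))) := by
  refine memBochner_rseries (x := fun t => dcoef j (dcoef i (a t))) r ?_
  have h := memLp_toLpOne (x := fun t => dcoef j (dcoef i (a t))) (T := T) (p := 1)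
    (fun k => ((ha.measurable k).const_mul _).const_mul _) one_pos ?_
  · simpa using h
  · refine ha.lintegral_ne_top hZ (C := 1) ENNReal.one_ne_top fun t ht => ?_
    rw [tsum_enorm_eq_moment, ENNReal.rpow_one, one_mul]
    exact ((moment_dcoef_le 0 j _).trans (moment_dcoef_le 1 i _)).trans
      (moment_le_moment_four (by norm_num) (by norm_num) _)

lemma memBochnerSobolevOne_two (hZ : IsSmallData c Z) (ha : IsCoefSolution c Z a) (T : ℝ) :
    MemBochnerSobolevOne 2 2 T fun t => rseries (a t) :=
  ⟨ha.memBochner hZ T 2 2, fun i => ⟨_, ha.memBochner_dcoef_two hZ T i 2, by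
    filter_upwards [ha.ae_isRegularSlice hZ T] with t ht using ht.hasWeakDeriv i⟩⟩

lemma memBochnerSobolevTwo_one (hZ : IsSmallData c Z) (ha : IsCoefSolution c Z a) (T : ℝ) :
    MemBochnerSobolevTwo 1 1 T fun t => rseries (a t) :=
  ⟨⟨ha.memBochner hZ T 1 1, fun i => ⟨_, ha.memBochner_dcoef_one hZ T i 1, by
    filter_upwards [ha.ae_isRegularSlice hZ T] with t ht using ht.hasWeakDeriv i⟩⟩,
    fun i j => ⟨_, ha.memBochner_dcoef_dcoef hZ T i j 1, by
    filter_upwards [ha.ae_isRegularSlice hZ T] with t ht using ht.hasWeakDerivTwo i j⟩⟩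

lemma enorm_ofReal_mul {w : ℝ} (hw : 0 ≤ w) (z : ℂ) : ‖(w : ℂ) * z‖ₑ = ENNReal.ofReal w * ‖z‖ₑ := by
  rw [enorm_mul, ← ofReal_norm (w : ℂ), Complex.norm_real, Real.norm_of_nonneg hw]

lemma memBochnerWiener (hZ : IsSmallData c Z) (ha : IsCoefSolution c Z a) (T : ℝ) {p : ℝ}
    (hp : 1 < p) : MemBochnerWiener (ENNReal.ofReal p) (4 / p) T fun t => rseries (a t) := by
  refine memBochnerFourier_rseries (x := a) ?_ (memLp_toLpOne
    (x := fun t k => ((freqNorm k ^ (4 / p) : ℝ) : ℂ) * a t k)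
    (fun k => (ha.measurable k).const_mul _) (by linarith) ?_)
  · filter_upwards [ha.ae_isRegularSlice hZ T] with t ht using ⟨ht.herm, ht.summable⟩
  · refine ha.lintegral_ne_top hZ (C := ENNReal.ofReal Z ^ (p - 1))
      (ENNReal.rpow_ne_top_of_nonneg (by linarith) ENNReal.ofReal_ne_top) fun t ht => ?_
    simp only [enorm_ofReal_mul (Real.rpow_nonneg (freqNorm_nonneg _) _)]
    refine (tsum_rpow_freqNorm_le hp (eabs (a t))).trans ?_
    exact mul_le_mul' (ENNReal.rpow_le_rpow ht.moment_zero_le (by linarith)) le_rfl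

lemma memBochnerFourier_exp (hZ : IsSmallData c Z) (ha : IsCoefSolution c Z a) (T : ℝ) {σ : ℝ}
    (hσ : 0 ≤ σ) (hσ1 : σ ≤ 1 - (d : ℝ) ^ 2 * P1 Z) :
    MemBochnerFourier ⊤ (fun t k => Real.exp (σ * t * freqNorm k)) T fun t => rseries (a t) := by
  refine memBochnerFourier_rseries (x := a) ?_ (memLp_top_toLpOne
    (x := fun t k => ((Real.exp (σ * t * freqNorm k) : ℝ) : ℂ) * a t k) (C := Z)
    (fun k => Measurable.mul (by fun_prop) (ha.measurable k)) ?_)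
  · filter_upwards [ha.ae_isRegularSlice hZ T] with t ht using ⟨ht.herm, ht.summable⟩
  · filter_upwards [ae_restrict_mem measurableSet_Ioo] with t ht
    refine le_trans (le_of_eq (tsum_congr fun k => ?_))
      (ha.weight_le σ 0 hσ le_rfl (by linarith) t ht.1.le)
    rw [enorm_ofReal_mul (Real.exp_nonneg _), expWeight, add_zero, mul_right_comm, eabs]

lemma abs_rseries_le (hZ : IsSmallData c Z) (ha : IsCoefSolution c Z a) {t : ℝ} (ht : 0 ≤ t)
    (x : Fin d → ℝ) :
    |rseries (a t) x| ≤ Z * Real.exp (-(1 - (d : ℝ) ^ 2 * P1 Z) * t) := by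
  set μ := 1 - (d : ℝ) ^ 2 * P1 Z with hμ
  have h := ha.weight_le 0 μ le_rfl (by linarith [hZ.small]) (by linarith) t ht
  simp only [expWeight, zero_mul, zero_add, ENNReal.tsum_mul_left] at h
  have hsum : Summable fun k => ‖a t k‖ := summable_of_moment_zero_le (ha.moment_zero_le hZ ht)
  have h2 : ∑' k, eabs (a t) k = ENNReal.ofReal (∑' k, ‖a t k‖) := by
    rw [ENNReal.ofReal_tsum_of_nonneg (fun _ => norm_nonneg _) hsum]
    simp [eabs]
  rw [h2, ← ENNReal.ofReal_mul (Real.exp_nonneg _), ENNReal.ofReal_le_ofReal_iff hZ.nonneg] at h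
  refine (DLSS.abs_rseries_le hsum x).trans ?_
  rw [neg_mul, Real.exp_neg, ← div_eq_mul_inv, le_div_iff₀ (Real.exp_pos _), mul_comm]
  exact h

end IsCoefSolution

/-! ### The weak formulation -/

lemma hasSum_pairing {b : (Fin d → ℤ) → ℂ} (hb : Summable fun k => ‖b k‖) (hh : IsHermitian b)
    {ψ : (Fin d → ℝ) → ℝ} (hψ : Integrable ψ (torusMeasure d)) :
    HasSum (fun k => b k * pairing ψ k)
      ((∫ x, rseries b x * ψ x ∂(torusMeasure d) : ℝ) : ℂ) := by
  have h := integral_series_mul hb hψ.ofReal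
  have h1 : ∫ x, series b x * ((ψ x : ℝ) : ℂ) ∂(torusMeasure d) =
      ((∫ x, rseries b x * ψ x ∂(torusMeasure d) : ℝ) : ℂ) := by
    refine Eq.trans ?_ (integral_ofReal (𝕜 := ℂ))
    refine integral_congr_ae (ae_of_all _ fun x => ?_)
    simp only [series_eq_ofReal hh]
    exact (Complex.ofReal_mul _ _).symm
  rw [← h1]
  exact h

/-- Termwise integration in time. -/
lemma hasSum_integral_time {x : ℝ → (Fin d → ℤ) → ℂ} {f : ℝ → ℝ} {T : ℝ}
    (hm : ∀ k, Measurable fun t => x t k) (h : ∫⁻ t, ∑' k, ‖x t k‖ₑ ∂(timeMeasure T) ≠ ⊤)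
    (hs : ∀ᵐ t ∂(timeMeasure T), HasSum (x t) (f t : ℂ)) :
    (∀ k, Integrable (fun t => x t k) (timeMeasure T)) ∧
      HasSum (fun k => ∫ t, x t k ∂(timeMeasure T)) ((∫ t, f t ∂(timeMeasure T) : ℝ) : ℂ) := by
  have hsum : ∑' k, ∫⁻ t, ‖x t k‖ₑ ∂(timeMeasure T) ≠ ⊤ := by
    rwa [← lintegral_tsum fun k => (hm k).enorm.aemeasurable]
  have hint : ∀ k, Integrable (fun t => x t k) (timeMeasure T) := fun k =>
    ⟨(hm k).aestronglyMeasurable, (ENNReal.ne_top_of_tsum_ne_top hsum k).lt_top⟩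
  refine ⟨hint, ?_⟩
  have h1 := hasSum_integral_of_summable_integral_norm hint
    ((ENNReal.summable_toReal hsum).congr fun k =>
      (integral_norm_eq_lintegral_enorm (hm k).aestronglyMeasurable).symm)
  have h2 : ∫ t, (f t : ℂ) ∂(timeMeasure T) = ∫ t, ∑' k, x t k ∂(timeMeasure T) :=
    integral_congr_ae (by filter_upwards [hs] with t ht using ht.tsum_eq.symm)
  have h3 : ((∫ t, f t ∂(timeMeasure T) : ℝ) : ℂ) = ∫ t, (f t : ℂ) ∂(timeMeasure T) :=
    (integral_ofReal (𝕜 := ℂ)).symm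
  rw [h3, h2]
  exact h1

lemma norm_pairing_le {ψ : (Fin d → ℝ) → ℝ} {C : ℝ} (h : ∀ x ∈ cell d, |ψ x| ≤ C) (k : Fin d → ℤ) :
    ‖pairing ψ k‖ ≤ C * (torusMeasure d).real univ := by
  refine norm_integral_le_of_norm_le_const ?_
  filter_upwards [ae_restrict_mem measurableSet_Icc] with x hx
  rw [norm_mul, norm_chi, one_mul, Complex.norm_real]
  exact h x hx

lemma exists_norm_pairing_le {F : ℝ → (Fin d → ℝ) → ℝ}
    (hF : Continuous fun z : ℝ × (Fin d → ℝ) => F z.1 z.2) (T : ℝ) :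
    ∃ C : ℝ, ∀ t ∈ Icc 0 T, ∀ k, ‖pairing (F t) k‖ ≤ C := by
  obtain ⟨C, hC⟩ := (isCompact_Icc.prod
    (isCompact_Icc : IsCompact (cell d))).exists_bound_of_continuousOn
    (s := Icc 0 T ×ˢ cell d) hF.continuousOn
  exact ⟨C * (torusMeasure d).real univ, fun t ht k =>
    norm_pairing_le (fun x hx => hC (t, x) ⟨ht, hx⟩) k⟩

section testFunction

variable {φ : ℝ → (Fin d → ℝ) → ℝ}

lemma contDiff_slice (hφ : ContDiff ℝ ∞ fun z : ℝ × (Fin d → ℝ) => φ z.1 z.2) (t : ℝ) :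
    ContDiff ℝ ∞ (φ t) :=
  hφ.comp (contDiff_prodMk_right t)

lemma hasDerivAt_time (hφ : ContDiff ℝ ∞ fun z : ℝ × (Fin d → ℝ) => φ z.1 z.2) (t : ℝ)
    (x : Fin d → ℝ) : HasDerivAt (fun s => φ s x) (deriv (fun s => φ s x) t) t :=
  ((hφ.comp (contDiff_prodMk_left x)).differentiable (by simp) t).hasDerivAt

lemma continuous_deriv_time (hφ : ContDiff ℝ ∞ fun z : ℝ × (Fin d → ℝ) => φ z.1 z.2) :
    Continuous fun z : ℝ × (Fin d → ℝ) => deriv (fun s => φ s z.2) z.1 := by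
  have h : (fun z : ℝ × (Fin d → ℝ) => deriv (fun s => φ s z.2) z.1) =
      fun z => fderiv ℝ (fun z : ℝ × (Fin d → ℝ) => φ z.1 z.2) z (1, 0) := by
    funext z
    have h1 := ((hφ.differentiable (by simp)) z).hasFDerivAt.comp_hasDerivAt z.1
      ((hasDerivAt_id z.1).prodMk (hasDerivAt_const z.1 z.2))
    exact h1.deriv
  rw [h]
  exact (hφ.continuous_fderiv (by simp)).clm_apply continuous_const

lemma hasDerivAt_pairing (hφ : ContDiff ℝ ∞ fun z : ℝ × (Fin d → ℝ) => φ z.1 z.2) (t : ℝ)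
    (k : Fin d → ℤ) : HasDerivAt (fun s => pairing (φ s) k)
      (pairing (fun x => deriv (fun s => φ s x) t) k) t := by
  obtain ⟨C, hC⟩ := ((isCompact_closedBall t 1).prod
    (isCompact_Icc : IsCompact (cell d))).exists_bound_of_continuousOn
    (s := Metric.closedBall t 1 ×ˢ cell d) (continuous_deriv_time hφ).continuousOn
  have hcont : ∀ s, Continuous fun x => chi k x * (φ s x : ℂ) := fun s =>
    (continuous_chi k).mul (Complex.continuous_ofReal.comp (contDiff_slice hφ s).continuous)
  have hcont' : Continuous fun x => chi k x * ((deriv (fun s => φ s x) t : ℝ) : ℂ) :=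
    (continuous_chi k).mul (Complex.continuous_ofReal.comp
      ((continuous_deriv_time hφ).comp (Continuous.prodMk_right t)))
  refine (hasDerivAt_integral_of_dominated_loc_of_deriv_le (𝕜 := ℝ) (bound := fun _ => C)
    (F := fun s x => chi k x * (φ s x : ℂ))
    (F' := fun s x => chi k x * ((deriv (fun s => φ s x) s : ℝ) : ℂ))
    (Metric.closedBall_mem_nhds t one_pos)
    (Eventually.of_forall fun s => (hcont s).aestronglyMeasurable)
    (integrable_of_continuous (hcont t)) hcont'.aestronglyMeasurable ?_ (integrable_const C)
    (ae_of_all _ fun x s _ => ((hasDerivAt_time hφ s x).ofReal_comp).const_mul _)).2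
  filter_upwards [ae_restrict_mem measurableSet_Icc] with x hx s hs
  rw [norm_mul, norm_chi, one_mul, Complex.norm_real]
  exact hC (s, x) ⟨hs, hx⟩

lemma pairing_pderiv_pderiv {ψ : (Fin d → ℝ) → ℝ} (hψ : ContDiff ℝ ∞ ψ) (hψp : IsPeriodic ψ)
    (i j : Fin d) (k : Fin d → ℤ) :
    pairing (pderiv i (pderiv j ψ)) k = -((k i : ℂ) * (k j : ℂ)) * pairing ψ k := by
  rw [pairing_pderiv ((contDiff_pderiv hψ j).of_le (by simp)) (hψp.pderiv j),
    pairing_pderiv (hψ.of_le (by simp)) hψp]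
  linear_combination ((k i : ℂ) * (k j : ℂ) * pairing ψ k) * Complex.I_sq

end testFunction

/-- The flux term of the weak formulation at a fixed time, as a sum over the modes. -/
lemma IsRegularSlice.hasSum_flux_pairing {Z : ℝ} {b : (Fin d → ℤ) → ℂ} (h : IsRegularSlice Z b)
    (hZ0 : 0 ≤ Z) (hZ1 : Z < 1) {ψ : (Fin d → ℝ) → ℝ} (hψ : ContDiff ℝ ∞ ψ) (hψp : IsPeriodic ψ) :
    HasSum (fun k => (((freqNorm k ^ 4 : ℝ) : ℂ) * b k + nlTerm ⊤ b k) * pairing ψ k)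
      ((∫ x, ∑ i, ∑ j, logHess b i j x * (rseries b x + 1) * pderiv i (pderiv j ψ) x
        ∂(torusMeasure d) : ℝ) : ℂ) := by
  have hc : ∀ i j, Continuous (pderiv i (pderiv j ψ)) := fun i j =>
    (DLSS.contDiff_pderiv (DLSS.contDiff_pderiv hψ j) i).continuous
  have h1 : ∀ i j, HasSum (fun k => -((k i : ℂ) * (k j : ℂ)) * flux b i j k * pairing ψ k)
      ((∫ x, rseries (flux b i j) x * pderiv i (pderiv j ψ) x ∂(torusMeasure d) : ℝ) : ℂ) := by
    intro i j
    have h2 := hasSum_pairing (h.summable_flux hZ0 hZ1 i j) (h.hermitian_flux i j)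
      (integrable_of_continuous (hc i j))
    refine h2.congr_fun ?_
    intro k
    rw [pairing_pderiv_pderiv hψ hψp]
    ring
  have h3 := hasSum_sum (s := Finset.univ) fun i _ =>
    hasSum_sum (s := Finset.univ) fun j _ => h1 i j
  have hint : ∀ i j, Integrable (fun x => rseries (flux b i j) x * pderiv i (pderiv j ψ) x)
      (torusMeasure d) := fun i j => integrable_of_continuous
    ((continuous_rseries (h.summable_flux hZ0 hZ1 i j)).mul (hc i j))
  simp only [h.logHess_mul hZ0 hZ1]
  rw [integral_finsetSum _ fun i _ => integrable_finsetSum _ fun j _ => hint i j]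
  simp only [integral_finsetSum _ fun j _ => hint _ j]
  simp only [Complex.ofReal_sum]
  convert h3 using 2 with k
  rw [← sum_flux, Finset.sum_mul]
  exact Finset.sum_congr rfl fun i _ => Finset.sum_mul _ _ _

namespace IsCoefSolution

variable {c : (Fin d → ℤ) → ℂ} {Z : ℝ} {a : ℝ → (Fin d → ℤ) → ℂ}

/-- The `ℓ¹` norm of the time derivative is controlled by the fourth moment. -/
lemma tsum_enorm_rate_le {b : (Fin d → ℤ) → ℂ} (hZ : IsSmallData c Z) (hb : IsRegularSlice Z b) :
    ∑' k, ‖((freqNorm k ^ 4 : ℝ) : ℂ) * b k + nlTerm ⊤ b k‖ₑ ≤ 2 * moment 4 (eabs b) := by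
  have h1 := tsum_weight_nlTerm_le (W := fun _ : Fin d → ℤ => 1) rfl (by simp) (Λ := 1) le_rfl ⊤ b
    hZ.nonneg hZ.lt_one (by simpa using hb.moment_zero_le)
  simp only [one_mul] at h1
  have h2 : ∀ k, ‖((freqNorm k ^ 4 : ℝ) : ℂ) * b k‖ₑ = efreq k ^ 4 * eabs b k := fun k => by
    rw [enorm_ofReal_mul (pow_nonneg (freqNorm_nonneg k) 4), efreq,
      ENNReal.ofReal_pow (freqNorm_nonneg k), eabs]
  calc ∑' k, ‖((freqNorm k ^ 4 : ℝ) : ℂ) * b k + nlTerm ⊤ b k‖ₑ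
      ≤ ∑' k, (efreq k ^ 4 * eabs b k + ‖nlTerm ⊤ b k‖ₑ) :=
        ENNReal.tsum_le_tsum fun k => (enorm_add_le _ _).trans (by rw [h2])
    _ ≤ moment 4 (eabs b) + 1 * moment 4 (eabs b) := by
        rw [ENNReal.tsum_add]
        refine add_le_add le_rfl (h1.trans (mul_le_mul' ?_ le_rfl))
        rw [← ENNReal.ofReal_one]
        exact ENNReal.ofReal_le_ofReal hZ.small.le
    _ = _ := by rw [one_mul, two_mul]

/-- The integrated equation for a single Fourier mode, tested with a test function. -/
lemma integral_mode (ha : IsCoefSolution c Z a) {φ : ℝ → (Fin d → ℝ) → ℝ} {T : ℝ} (hT : 0 < T)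
    (hφ : IsTestFunction T φ) (k : Fin d → ℤ)
    (h1 : Integrable (fun t => a t k * pairing (fun x => deriv (fun s => φ s x) t) k)
      (timeMeasure T))
    (h2 : Integrable (fun t => (((freqNorm k ^ 4 : ℝ) : ℂ) * a t k + nlTerm ⊤ (a t) k) *
      pairing (φ t) k) (timeMeasure T)) :
    ∫ t, a t k * pairing (fun x => deriv (fun s => φ s x) t) k ∂(timeMeasure T) -
      ∫ t, (((freqNorm k ^ 4 : ℝ) : ℂ) * a t k + nlTerm ⊤ (a t) k) * pairing (φ t) k
        ∂(timeMeasure T) = -(c k * pairing (φ 0) k) := by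
  have hp := fun t => hasDerivAt_pairing hφ.1 t k
  have hpT : pairing (φ T) k = 0 := by simp [pairing, hφ.2.2]
  rw [← integral_sub h1 h2]
  have hI := h1.sub h2
  rw [timeMeasure, ← integral_Ioc_eq_integral_Ioo, ← intervalIntegral.integral_of_le hT.le]
  have hI' : IntervalIntegrable (fun t => a t k * pairing (fun x => deriv (fun s => φ s x) t) k -
      (((freqNorm k ^ 4 : ℝ) : ℂ) * a t k + nlTerm ⊤ (a t) k) * pairing (φ t) k) volume 0 T := by
    rw [intervalIntegrable_iff_integrableOn_Ioo_of_le hT.le]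
    exact hI
  rw [intervalIntegral.integral_eq_sub_of_hasDerivAt_of_le hT.le
    (f := fun t => a t k * pairing (φ t) k) ?_ ?_ hI', hpT, ha.init]
  · ring
  · exact ((ha.cont k).mul (continuous_iff_continuousAt.mpr fun t =>
      (hp t).continuousAt)).continuousOn
  · intro t ht
    refine ((ha.hasDerivAt t ht.1 k).mul (hp t)).congr_deriv ?_
    ring

/-- The weak formulation, by termwise integration of the equations of the single modes. -/
lemma weak_form (hZ : IsSmallData c Z) (ha : IsCoefSolution c Z a) {T : ℝ} (hT : 0 < T)
    {u₀ : (Fin d → ℝ) → ℝ} {φ : ℝ → (Fin d → ℝ) → ℝ} (hφ : IsTestFunction T φ)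
    (h0 : HasSum (fun k => c k * pairing (φ 0) k)
      ((∫ x, φ 0 x * u₀ x ∂(torusMeasure d) : ℝ) : ℂ)) :
    -(∫ t, ∫ x, deriv (fun s => φ s x) t * rseries (a t) x ∂(torusMeasure d) ∂(timeMeasure T))
      - (∫ x, φ 0 x * u₀ x ∂(torusMeasure d))
      + (∫ t, ∫ x, ∑ i, ∑ j, logHess (a t) i j x * (rseries (a t) x + 1) *
          pderiv i (pderiv j (φ t)) x ∂(torusMeasure d) ∂(timeMeasure T)) = 0 := by
  have hp := fun t k => hasDerivAt_pairing hφ.1 t k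
  have hpm : ∀ k, Measurable fun t => pairing (φ t) k := fun k =>
    (continuous_iff_continuousAt.mpr fun t => (hp t k).continuousAt).measurable
  have hpm' : ∀ k, Measurable fun t => pairing (fun x => deriv (fun s => φ s x) t) k := fun k => by
    have : (fun t => pairing (fun x => deriv (fun s => φ s x) t) k) =
        deriv fun s => pairing (φ s) k := funext fun t => (hp t k).deriv.symm
    rw [this]
    exact measurable_deriv _
  obtain ⟨C, hC⟩ := exists_norm_pairing_le hφ.1.continuous T
  obtain ⟨C', hC'⟩ := exists_norm_pairing_le
    (F := fun t x => deriv (fun s => φ s x) t) (continuous_deriv_time hφ.1) T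
  have hbound : ∀ {K : ℝ} {y q : (Fin d → ℤ) → ℂ}, (∀ k, ‖q k‖ ≤ K) →
      ∑' k, ‖y k * q k‖ₑ ≤ ENNReal.ofReal K * ∑' k, ‖y k‖ₑ := by
    intro K y q hq
    rw [← ENNReal.tsum_mul_left]
    refine ENNReal.tsum_le_tsum fun k => ?_
    rw [enorm_mul, mul_comm]
    refine mul_le_mul' ?_ le_rfl
    rw [← ofReal_norm]
    exact ENNReal.ofReal_le_ofReal (hq k)
  have hmem : ∀ᵐ t ∂(timeMeasure T), t ∈ Icc 0 T := by
    filter_upwards [ae_restrict_mem measurableSet_Ioo] with t ht using Ioo_subset_Icc_self ht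
  obtain ⟨i1, s1⟩ := hasSum_integral_time (T := T)
    (x := fun t k => a t k * pairing (fun x => deriv (fun s => φ s x) t) k)
    (f := fun t => ∫ x, deriv (fun s => φ s x) t * rseries (a t) x ∂(torusMeasure d))
    (fun k => (ha.measurable k).mul (hpm' k)) (by
      refine ne_top_of_le_ne_top (b := ∫⁻ _, ENNReal.ofReal C' * ENNReal.ofReal Z ∂(timeMeasure T))
        ?_ (lintegral_mono_ae ?_)
      · rw [lintegral_const]
        exact ENNReal.mul_ne_top (ENNReal.mul_ne_top ENNReal.ofReal_ne_top ENNReal.ofReal_ne_top)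
          (measure_ne_top _ _)
      · filter_upwards [hmem, ha.ae_tsum_enorm_le hZ T] with t ht htZ
        exact (hbound (hC' t ht)).trans (mul_le_mul' le_rfl htZ)) (by
      filter_upwards [ha.ae_isRegularSlice hZ T] with t ht
      simp only [mul_comm (deriv _ _) (rseries _ _)]
      exact hasSum_pairing ht.summable ht.herm (integrable_of_continuous
        ((continuous_deriv_time hφ.1).comp (Continuous.prodMk_right t))))
  obtain ⟨i2, s2⟩ := hasSum_integral_time (T := T)
    (x := fun t k => (((freqNorm k ^ 4 : ℝ) : ℂ) * a t k + nlTerm ⊤ (a t) k) * pairing (φ t) k)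
    (f := fun t => ∫ x, ∑ i, ∑ j, logHess (a t) i j x * (rseries (a t) x + 1) *
          pderiv i (pderiv j (φ t)) x ∂(torusMeasure d))
    (fun k => by
      refine Measurable.mul (((ha.measurable k).const_mul _).add ?_) (hpm k)
      exact Finset.measurable_sum _ fun i _ => Finset.measurable_sum _ fun j _ =>
        (measurable_gradProd_neumann ha.measurable i j k).const_mul _) (by
      refine ne_top_of_le_ne_top (ENNReal.mul_ne_top
        (ENNReal.mul_ne_top (a := ENNReal.ofReal C) (b := 2) ENNReal.ofReal_ne_top
          ENNReal.ofNat_ne_top)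
        (ha.lintegral_moment_four_ne_top T)) ?_
      rw [← lintegral_const_mul _ (ha.measurable_moment 4)]
      refine lintegral_mono_ae ?_
      filter_upwards [hmem, ha.ae_isRegularSlice hZ T] with t ht hr
      rw [mul_assoc]
      exact (hbound (hC t ht)).trans (mul_le_mul' le_rfl (tsum_enorm_rate_le hZ hr))) (by
      filter_upwards [ha.ae_isRegularSlice hZ T] with t ht
      exact ht.hasSum_flux_pairing hZ.nonneg hZ.lt_one (contDiff_slice hφ.1 t) (hφ.2.1 t))
  have h3 := s1.sub s2
  simp only [ha.integral_mode hT hφ _ (i1 _) (i2 _)] at h3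
  have h4 := h3.unique h0.neg
  rw [← Complex.ofReal_sub, ← Complex.ofReal_neg, Complex.ofReal_inj] at h4
  linarith

end IsCoefSolution

/-! ### The initial datum -/

section initial

variable {u₀ : (Fin d → ℝ) → ℝ}

lemma hermitian_fourierCoef (u : (Fin d → ℝ) → ℝ) : IsHermitian (fourierCoef u) := by
  intro k
  rw [fourierCoef_eq, fourierCoef_eq, map_mul, neg_neg, pairing, pairing, ← integral_conj]
  congr 1
  · rw [map_div₀, map_pow, map_mul, Complex.conj_ofReal, map_one, Complex.conj_ofNat]
  · refine integral_congr_ae (ae_of_all _ fun x => ?_)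
    simp [chi_neg]

lemma pairing_eq_fourierCoef (u : (Fin d → ℝ) → ℝ) (k : Fin d → ℤ) :
    pairing u k = (2 * (Real.pi : ℂ)) ^ d * fourierCoef u (-k) := by
  have hpi : (Real.pi : ℂ) ≠ 0 := by exact_mod_cast Real.pi_ne_zero
  rw [fourierCoef_eq, neg_neg]
  field_simp

lemma summable_fourierCoef (h : MemWiener 0 u₀) : Summable fun k => ‖fourierCoef u₀ k‖ := by
  simpa using h.2

lemma isSmallData_fourierCoef (h : MemWiener 0 u₀) (hmean : ∫ x, u₀ x ∂(torusMeasure d) = 0)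
    (hnorm : wienerNorm 0 u₀ < 1) (hsmall : (d : ℝ) ^ 2 * P1 (wienerNorm 0 u₀) < 1) :
    IsSmallData (fourierCoef u₀) (wienerNorm 0 u₀) where
  nonneg := tsum_nonneg fun k => mul_nonneg (Real.rpow_nonneg (freqNorm_nonneg k) _) (norm_nonneg _)
  lt_one := hnorm
  moment_le := by
    rw [← tsum_enorm_eq_moment, wienerNorm]
    simp only [Real.rpow_zero, one_mul]
    rw [ENNReal.ofReal_tsum_of_nonneg (fun _ => norm_nonneg _) (summable_fourierCoef h)]
    simp
  mean := by
    have : ∫ x, (u₀ x : ℂ) ∂(torusMeasure d) = 0 := by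
      rw [integral_complex_ofReal, hmean, Complex.ofReal_zero]
    simp [fourierCoef_eq, pairing, chi_zero, this]
  small := hsmall

/-- Parseval's identity for the initial datum and a continuous periodic function. -/
lemma hasSum_fourierCoef_pairing (h : MemWiener 0 u₀) {ψ : (Fin d → ℝ) → ℝ} (hψ : Continuous ψ)
    (hψp : IsPeriodic ψ) :
    HasSum (fun k => fourierCoef u₀ k * pairing ψ k)
      ((∫ x, ψ x * u₀ x ∂(torusMeasure d) : ℝ) : ℂ) := by
  have hs := summable_fourierCoef h
  have hh := hermitian_fourierCoef u₀
  have hr := integrable_of_continuous (continuous_rseries hs)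
  have h0 : ∀ k, pairing (fun x => u₀ x - rseries (fourierCoef u₀) x) k = 0 := by
    intro k
    have hint : ∀ {f : (Fin d → ℝ) → ℝ}, Integrable f (torusMeasure d) →
        Integrable (fun x => chi k x * (f x : ℂ)) (torusMeasure d) := fun hf =>
      hf.ofReal.bdd_mul (c := 1) (continuous_chi k).aestronglyMeasurable
        (ae_of_all _ fun x => (norm_chi k x).le)
    have h1 : pairing (fun x => u₀ x - rseries (fourierCoef u₀) x) k =
        pairing u₀ k - pairing (rseries (fourierCoef u₀)) k := by
      simp only [pairing, Complex.ofReal_sub, mul_sub]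
      exact integral_sub (hint h.1) (hint hr)
    rw [h1, pairing_eq_fourierCoef, pairing_eq_fourierCoef, fourierCoef_rseries hs hh, sub_self]
  have h2 := integral_mul_eq_zero_of_pairing (h.1.sub hr) h0 hψ hψp
  have hbdd : ∃ C, ∀ᵐ x ∂(torusMeasure d), ‖ψ x‖ ≤ C := by
    obtain ⟨C, hC⟩ := (isCompact_Icc : IsCompact (cell d)).exists_bound_of_continuousOn
      hψ.continuousOn
    exact ⟨C, by filter_upwards [ae_restrict_mem measurableSet_Icc] with x hx using hC x hx⟩
  obtain ⟨C, hC⟩ := hbdd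
  have h3 : ∫ x, ψ x * u₀ x ∂(torusMeasure d) =
      ∫ x, rseries (fourierCoef u₀) x * ψ x ∂(torusMeasure d) := by
    have hr' : Integrable (fun x => rseries (fourierCoef u₀) x * ψ x) (torusMeasure d) :=
      integrable_of_continuous ((continuous_rseries hs).mul hψ)
    rw [← sub_eq_zero, ← h2, ← integral_sub (h.1.bdd_mul hψ.aestronglyMeasurable hC) hr']
    refine integral_congr_ae (ae_of_all _ fun x => ?_)
    simp only [Pi.sub_apply]
    ring
  rw [h3]
  exact hasSum_pairing hs hh (integrable_of_continuous hψ)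

end initial

/-- A solution in Fourier space is a strong solution in physical space. -/
lemma IsCoefSolution.isStrongSolution {u₀ : (Fin d → ℝ) → ℝ} {Z : ℝ} {a : ℝ → (Fin d → ℤ) → ℂ}
    (h₀ : MemWiener 0 u₀) (hZ : IsSmallData (fourierCoef u₀) Z)
    (ha : IsCoefSolution (fourierCoef u₀) Z a) {T : ℝ} (hT : 0 < T) :
    IsStrongSolution T u₀ fun t => rseries (a t) where
  periodic t := rseries_periodic _
  integrable := by
    refine integrable_prod_rseries ha.measurable (ne_top_of_le_ne_top ?_
      (lintegral_mono_ae (ha.ae_tsum_enorm_le hZ T)))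
    rw [lintegral_const]
    exact ENNReal.mul_ne_top ENNReal.ofReal_ne_top (measure_ne_top _ _)
  mem_Linfty := ha.memBochner hZ T ⊤ ⊤
  mem_H1 := ha.memBochnerSobolevOne_two hZ T
  mem_W21 := ha.memBochnerSobolevTwo_one hZ T
  pos := by
    filter_upwards [ha.ae_isRegularSlice hZ T] with t ht using
      ae_of_all _ (ht.pos hZ.nonneg hZ.lt_one)
  weak_form := by
    refine ⟨fun i j t => logHess (a t) i j, fun i j => ?_, fun i j => ?_, fun φ hφ => ?_⟩
    · filter_upwards [ha.ae_isRegularSlice hZ T] with t ht using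
        ht.hasWeakDerivTwo_log hZ.nonneg hZ.lt_one i j
    · have hflux := integrable_prod_rseries (T := T) (x := fun t => flux (a t) i j)
        (fun k => ((((ha.measurable k).const_mul _).const_mul _)).sub
          (measurable_gradProd_neumann ha.measurable i j k))
        (ha.lintegral_ne_top hZ ENNReal.ofReal_ne_top fun t ht =>
          ht.moment_flux_le hZ.nonneg hZ.lt_one i j)
      refine hflux.congr ?_
      filter_upwards [Measure.quasiMeasurePreserving_fst.ae (ha.ae_isRegularSlice hZ T)] with z hz
      exact (hz.logHess_mul hZ.nonneg hZ.lt_one i j z.2).symm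
    · exact ha.weak_form hZ hT hφ (hasSum_fourierCoef_pairing h₀ (contDiff_slice hφ.1 0).continuous
        (hφ.2.1 0))

end

end DLSS

theorem theorem2p2 (d : ℕ) (hd1 : 1 ≤ d) (hd3 : d ≤ 3)
    (u₀ : (Fin d → ℝ) → ℝ) (hper : DLSS.IsPeriodic u₀)
    (hu₀ : DLSS.MemWiener 0 u₀)
    (hmean : ∫ x, u₀ x ∂(DLSS.torusMeasure d) = 0)
    (hnorm : DLSS.wienerNorm 0 u₀ < 1)
    (hsmall : (d : ℝ) ^ 2 * DLSS.P1 (DLSS.wienerNorm 0 u₀) < 1) :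
    ∃ u : ℝ → (Fin d → ℝ) → ℝ,
      (∀ T : ℝ, 0 < T →
        DLSS.IsStrongSolution T u₀ u ∧
        DLSS.MemBochner ∞ ∞ T u ∧
        ∀ p : ℝ, 1 < p → DLSS.MemBochnerWiener (ENNReal.ofReal p) (4 / p) T u) ∧
      (∀ t : ℝ, 0 ≤ t →
        eLpNorm (u t) ∞ (DLSS.torusMeasure d) ≤
          ENNReal.ofReal (DLSS.wienerNorm 0 u₀ *
            Real.exp (-(1 - (d : ℝ) ^ 2 * DLSS.P1 (DLSS.wienerNorm 0 u₀)) * t))) ∧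
      (∀ σ : ℝ, 0 < σ → 0 < 1 - σ - (d : ℝ) ^ 2 * DLSS.P1 (DLSS.wienerNorm 0 u₀) →
        ∀ T : ℝ, 0 < T →
          DLSS.MemBochnerFourier ∞ (fun t k => Real.exp (σ * t * DLSS.freqNorm k)) T u) := by
  have hZ := DLSS.isSmallData_fourierCoef hu₀ hmean hnorm hsmall
  obtain ⟨a, ha⟩ := DLSS.exists_isCoefSolution hZ (DLSS.hermitian_fourierCoef u₀)
  refine ⟨fun t => DLSS.rseries (a t), fun T hT => ⟨ha.isStrongSolution hu₀ hZ hT,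
    ha.memBochner hZ T _ _, fun p hp => ha.memBochnerWiener hZ T hp⟩, fun t ht => ?_,
    fun σ hσ hσ1 T _ => ha.memBochnerFourier_exp hZ T hσ.le (by linarith)⟩
  rw [eLpNorm_exponent_top]
  exact eLpNormEssSup_le_of_ae_bound (ae_of_all _ (ha.abs_rseries_le hZ ht))
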